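/- Fix $q\in(0,1)$, $\lambda>0$, $\xi>0$, and put $\phi_n(w)=\sum_{k\ge1}\frac{k^n w^k}{1-q^k}$ for $|w|<1$. Consider locally finite particle configurations on $\mathbb R$, with $\eta(x)\in\mathbb Z_{\ge0}$ particles at $x$ (several particles per location are allowed). In the homogeneous exponential jump model with speed $\xi$ and jumping distance parameter $\lambda$, one particle leaves each location $x$ at rate $\xi(1-q^{\eta(x)})$, independently for different locations. It instantaneously jumps to the right, by a distance that is $\ge y$ with probability $e^{-\lambda y}q^{N(x,x+y)}$ for every $y>0$, where $N(x,x+y)$ is the number of particles strictly between $x$ and $x+y$. For a configuration with finitely many particles this is a continuous time Markov jump process. The model on the whole line started from $\eta$ is the limit, as $a\to-\infty$ and $b\to+\infty$, of the systems started from the particles of $\eta$ in $[a,b]$: its law at time $t$ in a bounded window is the setwise limit of their laws at time $t$ in that window, and the model is said to exist from $\eta$ if these limits exist for all $t\ge0$ and all bounded windows. For $0<c<1$ let $\mathfrak m_{c,\lambda}$ be the marked Poisson process on $\mathbb R$ of intensity $\lambda\phi_0(c)$ in which each point independently carries $j\ge1$ particles with probability $\frac{c^j}{(1-q^j)\phi_0(c)}$;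 let $\mathfrak m_{0,\lambda}$ be the unit mass at the empty configuration. **Proposition.** For every $0\le c<1$ (and every speed $\xi>0$) the probability measure $\mathfrak m_{c,\lambda}$ is stationary under the homogeneous exponential jump model on the whole line with parameters $\lambda$ and $\xi$: the model exists from $\mathfrak m_{c,\lambda}$-almost every initial configuration, and if the initial configuration has law $\mathfrak m_{c,\lambda}$, then so does the configuration at every time $t\ge0$. The particle density under $\mathfrak m_{c,\lambda}$ is $\lambda\phi_1(c)$, that is, the mean number of particles in $(u,v]$ is $\lambda\phi_1(c)(v-u)$ for all $u\le v$. The particle current is $\xi c$, that is, for each $x\in\mathbb R$ the mean under $\mathfrak m_{c,\lambda}$ of the total rate at which particles jump over $x$, $$\sum_{y<x,\ \eta(y)\ge1}\xi\,(1-q^{\eta(y)})\,e^{-\lambda(x-y)}q^{N(y,x)},$$ equals $\xi c$. -/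

import Mathlib

open MeasureTheory ProbabilityTheory Filter Topology
open scoped NNReal ENNReal

namespace ExpJump

noncomputable section

/-! ### Particle configurations on the line -/

/-- Possibly infinite particle configurations on `ℝ`, with several particles per location allowed:
`η x` is the number of particles at `x`, and every bounded interval contains finitely many occupied
locations. -/
def Conf : Type := {η : ℝ → ℕ // ∀ a b : ℝ, (Function.support η ∩ Set.Icc a b).Finite}

instance : CoeFun Conf (fun _ => ℝ → ℕ) := ⟨Subtype.val⟩

namespace Conf

/-- The number of particles of `η` in a bounded set `B`. -/
def num (η : Conf) (B : Set ℝ) : ℕ := ∑ᶠ x ∈ B, η x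

/-- The σ-algebra generated by the numbers of particles in bounded intervals. -/
instance : MeasurableSpace Conf :=
  ⨆ (a : ℝ) (b : ℝ), MeasurableSpace.comap (fun η : Conf => η.num (Set.Ioc a b)) ⊤

/-- The empty configuration. -/
def empty : Conf := ⟨fun _ => 0, fun a b => by
  have h : Function.support (fun _ : ℝ => (0 : ℕ)) = ∅ := by simp
  rw [h, Set.empty_inter]; exact Set.finite_empty⟩

open Classical in
/-- The particles of `η` that lie in `B`, all others being removed. -/
def restrict (η : Conf) (B : Set ℝ) : Conf :=
  ⟨fun x => if x ∈ B then η x else 0, fun a b => (η.2 a b).subset (by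
    rintro x ⟨hx, hab⟩
    refine ⟨fun h0 => hx ?_, hab⟩
    show (if x ∈ B then η x else 0) = 0
    rw [h0, ite_self])⟩

open Classical in
/-- The configuration after one particle of `η` has moved from `y` to `z`
(used only if there is a particle at `y`). -/
def move (η : Conf) (y z : ℝ) : Conf :=
  ⟨fun x => (η x - if x = y then 1 else 0) + if x = z then 1 else 0, fun a b =>
    ((η.2 a b).union (Set.finite_singleton z)).subset (by
      rintro x ⟨hx, hab⟩
      by_cases hz : x = z
      · exact Or.inr hz
      · refine Or.inl ⟨fun h0 => hx ?_, hab⟩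
        show (η x - if x = y then 1 else 0) + (if x = z then 1 else 0) = 0
        rw [h0, if_neg hz]; simp)⟩

end Conf

/-! ### The dynamics of finitely many particles -/

/-- The rate at which one particle leaves the location `y`. -/
def wakeRate (q xi : ℝ) (η : Conf) (y : ℝ) : ℝ := xi * (1 - q ^ η y)

/-- The law of the landing point of a particle that jumps to the right from `y`. The desired
distance is exponential of rate `lam`, and each sitting particle that is met stops the flying one,
which then joins its stack, unless it is passed with probability `q`. So the particle reaches `z > y`
with probability `exp (-lam (z - y)) * q ^ (number of particles in (y, z))`: it stops in `dz` away
from the stacks with that probability times `lam dz`, and at a stack `z` with that probability times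
`1 - q ^ η z`. -/
def landingLaw (q lam : ℝ) (η : Conf) (y : ℝ) : Measure ℝ :=
  (volume.restrict (Set.Ioi y)).withDensity
      (fun z => ENNReal.ofReal (lam * Real.exp (-lam * (z - y)) * q ^ η.num (Set.Ioo y z)))
    + Measure.sum (fun z : {z : ℝ // y < z ∧ η z ≠ 0} =>
        ENNReal.ofReal (Real.exp (-lam * (z - y)) * q ^ η.num (Set.Ioo y z) * (1 - q ^ η z))
          • Measure.dirac (z : ℝ))

/-- The generator of the homogeneous model, on configurations of finitely many particles. -/
def generator (q lam xi : ℝ) (f : Conf → ℝ) (η : Conf) : ℝ :=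
  ∑ᶠ y : ℝ, wakeRate q xi η y * ∫ z, (f (η.move y z) - f η) ∂(landingLaw q lam η y)

/-- The expectation of `f` at time `t` for the model started from the finite configuration `η`,
that is `exp (t * generator) f η`. The generator is bounded on the configurations with a given
number of particles, so the exponential series converges for bounded measurable `f`. -/
def finiteSemigroup (q lam xi t : ℝ) (f : Conf → ℝ) (η : Conf) : ℝ :=
  ∑' k : ℕ, t ^ k / (k.factorial : ℝ) * ((generator q lam xi)^[k] f) η

/-! ### The model on the whole line -/

/-- Bounded measurable functions of the configuration in a bounded window. -/
structure IsLocalObservable (f : Conf → ℝ) : Prop where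
  measurable : Measurable f
  bounded : ∃ C : ℝ, ∀ η, |f η| ≤ C
  isLocal : ∃ u v : ℝ, ∀ η ζ : Conf, (∀ x ∈ Set.Icc u v, η x = ζ x) → f η = f ζ

/-- The finite systems, started from the particles of `η` in `[w.1, w.2]`, that approximate the
model on the whole line started from `η`. -/
def windowSemigroup (q lam xi t : ℝ) (f : Conf → ℝ) (η : Conf) (w : ℝ × ℝ) : ℝ :=
  finiteSemigroup q lam xi t f (η.restrict (Set.Icc w.1 w.2))

/-- The model on the whole line exists from the initial configuration `η`: at every time, the law in
every bounded window of the system started from the particles in `[a, b]` converges setwise as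
`a → -∞`, `b → ∞`. -/
def ExistsFrom (q lam xi : ℝ) (η : Conf) : Prop :=
  ∀ t : ℝ, 0 ≤ t → ∀ f : Conf → ℝ, IsLocalObservable f →
    ∃ l : ℝ, Tendsto (windowSemigroup q lam xi t f η) (atBot ×ˢ atTop) (𝓝 l)

/-- The transition operator of the model on the whole line: the expectation of the local observable
`f` at time `t` for the model started from `η`. -/
def transitionOp (q lam xi t : ℝ) (f : Conf → ℝ) (η : Conf) : ℝ :=
  limUnder (atBot ×ˢ atTop) (windowSemigroup q lam xi t f η)

/-- `ν` is the law of the configuration at time `t` for the model on the whole line with random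
initial configuration of law `μ`. -/
def IsLawAt (q lam xi t : ℝ) (μ ν : Measure Conf) : Prop :=
  ∀ f : Conf → ℝ, IsLocalObservable f →
    Integrable (transitionOp q lam xi t f) μ ∧
      ∫ η, transitionOp q lam xi t f η ∂μ = ∫ η, f η ∂ν

/-- A probability measure `μ` on configurations is stationary under the model on the whole line: the
model exists from `μ`-almost every initial configuration, and if `μ` is the law of the initial
configuration, then it is the law of the configuration at every time. -/
structure IsStationary (q lam xi : ℝ) (μ : Measure Conf) : Prop where
  isProbabilityMeasure : IsProbabilityMeasure μ
  existsFrom : ∀ᵐ η ∂μ, ExistsFrom q lam xi η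
  law : ∀ t : ℝ, 0 ≤ t → IsLawAt q lam xi t μ μ

/-- The rate at which particles jump over the location `x` when the configuration is `η`: the sum,
over the locations to the left of `x`, of the rate at which a particle leaves the location times
the probability that it flies at least up to `x`. -/
def jumpRateOver (q lam xi : ℝ) (η : Conf) (x : ℝ) : ℝ≥0∞ :=
  ∑' y : Set.Iio x, ENNReal.ofReal (wakeRate q xi η y) * landingLaw q lam η y (Set.Ici x)

/-! ### Marked Poisson processes -/

/-- The uniform distribution on `[0, 1)`. -/
def uniform01 : Measure ℝ := volume.restrict (Set.Ico 0 1)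

instance : IsProbabilityMeasure uniform01 := ⟨by simp [uniform01]⟩

/-- For each cell `[k, k + 1)`, `k : ℤ`, the number of its points and a sequence of pairs
(position of a point relative to `k`, its mark). -/
abbrev PoissonData : Type := ℤ → ℕ × (ℕ → ℝ × ℕ)

/-- Independently for each cell: a Poisson number of points of mean `r`, independent uniform
positions, independent marks of law `marks`. -/
def poissonDataLaw (r : ℝ≥0) (marks : PMF ℕ) : Measure PoissonData :=
  Measure.infinitePi fun _ : ℤ =>
    (poissonMeasure r).prod (Measure.infinitePi fun _ : ℕ => uniform01.prod marks.toMeasure)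

open Classical in
/-- The configuration with, at each point, as many particles as its mark says. -/
def PoissonData.toConf (ω : PoissonData) : Conf :=
  ⟨fun x => ∑ i ∈ Finset.range (ω ⌊x⌋).1,
      if (⌊x⌋ : ℝ) + ((ω ⌊x⌋).2 i).1 = x then ((ω ⌊x⌋).2 i).2 else 0, fun a b => by
    refine Set.Finite.subset (Set.Finite.biUnion (Set.finite_Icc ⌊a⌋ ⌊b⌋) fun k _ =>
      ((Finset.range (ω k).1).image fun i => (k : ℝ) + ((ω k).2 i).1).finite_toSet) ?_
    rintro x ⟨hx, hab⟩
    obtain ⟨i, hi, hne⟩ := Finset.exists_ne_zero_of_sum_ne_zero (Function.mem_support.mp hx)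
    refine Set.mem_biUnion (x := ⌊x⌋) ⟨Int.floor_mono hab.1, Int.floor_mono hab.2⟩ ?_
    refine Finset.mem_coe.mpr (Finset.mem_image.mpr ⟨i, hi, ?_⟩)
    by_contra h
    exact hne (if_neg h)⟩

/-- The marked Poisson process on `ℝ`: a homogeneous Poisson process of intensity `r`, each point of
which carries, independently, a random number of particles of law `marks`. -/
def markedPoisson (r : ℝ≥0) (marks : PMF ℕ) : Measure Conf :=
  (poissonDataLaw r marks).map PoissonData.toConf

/-! ### The measures `m_{c,λ}` -/

/-- `φ_n(w) = ∑_{k ≥ 1} k ^ n w ^ k / (1 - q ^ k)`. -/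
def phi (q : ℝ) (n : ℕ) (w : ℝ) : ℝ :=
  ∑' k : ℕ, ((k + 1 : ℕ) : ℝ) ^ n * w ^ (k + 1) / (1 - q ^ (k + 1))

theorem summable_phi_zero {q c : ℝ} (hq0 : 0 < q) (hq1 : q < 1) (hc0 : 0 < c) (hc1 : c < 1) :
    Summable fun k : ℕ => c ^ (k + 1) / (1 - q ^ (k + 1)) := by
  have hg : Summable fun k : ℕ => c ^ (k + 1) / (1 - q) :=
    ((summable_nat_add_iff 1).mpr (summable_geometric_of_lt_one hc0.le hc1)).div_const _
  refine Summable.of_nonneg_of_le (fun k => ?_) (fun k => ?_) hg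
  · have : q ^ (k + 1) ≤ 1 := pow_le_one₀ hq0.le hq1.le
    exact div_nonneg (by positivity) (by linarith)
  · have : q ^ (k + 1) ≤ q := pow_le_of_le_one hq0.le hq1.le (by omega)
    exact div_le_div_of_nonneg_left (by positivity) (by linarith) (by linarith)

theorem phi_zero_pos {q c : ℝ} (hq0 : 0 < q) (hq1 : q < 1) (hc0 : 0 < c) (hc1 : c < 1) :
    0 < phi q 0 c := by
  have hpos : ∀ k : ℕ, 0 < c ^ (k + 1) / (1 - q ^ (k + 1)) := fun k => by
    have : q ^ (k + 1) < 1 := pow_lt_one₀ hq0.le hq1 (by omega)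
    exact div_pos (by positivity) (by linarith)
  have h := (summable_phi_zero hq0 hq1 hc0 hc1).tsum_pos (fun k => (hpos k).le) 0 (hpos 0)
  simpa [phi] using h

/-- The probability `c ^ j / ((1 - q ^ j) φ_0(c))` of the mark `j ≥ 1`. -/
def markProb (q c : ℝ) (j : ℕ) : ℝ :=
  if j = 0 then 0 else c ^ j / ((1 - q ^ j) * phi q 0 c)

theorem hasSum_markProb {q c : ℝ} (hq0 : 0 < q) (hq1 : q < 1) (hc0 : 0 < c) (hc1 : c < 1) :
    HasSum (fun j => ENNReal.ofReal (markProb q c j)) 1 := by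
  have hp := phi_zero_pos hq0 hq1 hc0 hc1
  have hnn : ∀ j, 0 ≤ markProb q c j := fun j => by
    unfold markProb
    split_ifs with h
    · exact le_rfl
    · have : q ^ j < 1 := pow_lt_one₀ hq0.le hq1 h
      exact div_nonneg (by positivity) (mul_nonneg (by linarith) hp.le)
  have hs : HasSum (fun k : ℕ => markProb q c (k + 1)) 1 := by
    have h1 := (summable_phi_zero hq0 hq1 hc0 hc1).hasSum.div_const (phi q 0 c)
    have h2 : (∑' k : ℕ, c ^ (k + 1) / (1 - q ^ (k + 1))) = phi q 0 c := by simp [phi]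
    rw [h2, div_self hp.ne'] at h1
    refine h1.congr_fun ?_ |> fun h => h
    intro k
    simp [markProb, div_div]
  have hs' : HasSum (markProb q c) 1 := by
    rw [← hasSum_nat_add_iff' 1]
    simpa [markProb] using hs
  rw [← ENNReal.ofReal_one, ← hs'.tsum_eq, ENNReal.ofReal_tsum_of_nonneg hnn hs'.summable]
  exact ENNReal.summable.hasSum

/-- The mark distribution. -/
def markLaw (q c : ℝ) (hq0 : 0 < q) (hq1 : q < 1) (hc0 : 0 < c) (hc1 : c < 1) : PMF ℕ :=
  ⟨fun j => ENNReal.ofReal (markProb q c j), hasSum_markProb hq0 hq1 hc0 hc1⟩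

open Classical in
/-- The measure `m_{c,λ}`, for `0 < q < 1` and `0 ≤ c < 1`: the marked Poisson process of intensity
`λ φ_0(c)` and marks `j ≥ 1` of probability `c ^ j / ((1 - q ^ j) φ_0(c))`. For `c = 0` the
intensity is `0`, so that there are no particles. -/
def stationaryMeasure (q lam c : ℝ) : Measure Conf :=
  if h : (0 < q ∧ q < 1) ∧ (0 < c ∧ c < 1) then
    markedPoisson (lam * phi q 0 c).toNNReal (markLaw q c h.1.1 h.1.2 h.2.1 h.2.2)
  else Measure.dirac Conf.empty

end

end ExpJump

open MeasureTheory ProbabilityTheory Filter Topology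
open scoped NNReal ENNReal

namespace ExpJump

noncomputable section

namespace Conf

/-! A flying particle is subject to a hazard, the measure `trap`: `lam` times Lebesgue measure plus
an atom of mass `1 - q ^ η z` at each stack `z`. The function `reach` is the survival probability
for this hazard, so the landing law is `reach` times `trap`. Survival can be read forward from the
starting point or backward from the end point. Both readings give a total mass identity,
`lintegral_reach_right` and `lintegral_reach_left`, and the proof draws on both.

Existence holds from every configuration. A particle to the right of `v` never affects what happens
on `(-∞, v]`, so the right end of the window soon becomes irrelevant. For the left end, couple two
configurations that agree to the right of `X`. Common particles jump together, and the others cross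
`X` at total rate at most `xi` in each configuration. By lack of memory a particle that crosses `X`
continues as if it had started there, so its overshoot has an exponential moment. Hence the
influence of `(-∞, X]` on a local observable at time `t` is at most a constant times `exp (2 * xi *
t) * exp (lam / 2 * X)`, for any number of particles (`hasInfluence_uniStep`, `hasInfluence_semi`).
The window expectations are therefore Cauchy.

Stationarity and current both follow from the balance equation `IsBalanced`: under the measure,
removing a particle at rate `1 - q ^ η y` corresponds to inserting one along `c` times `trap`. For
`m_{c,λ}` it comes from the Mecke formula. The factor `1 - q ^ j` cancels the denominator of the
mark weight, and the remaining geometric weights `c ^ j` reproduce themselves when one particle is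
added (`isBalanced_stationaryMeasure`). Integrating the backward identity gives the current at once.

For stationarity, balance and Tonelli show that the window `(a, v)` would be exactly invariant if
flying particles arrived at `a` at rate `xi * c` (`IsBalanced.window`). The window system without
arrivals thus has an expectation whose time derivative is only the effect of the missing arrivals.
By the influence bound this is of order `exp (lam / 2 * a)`, and it vanishes as `a → -∞`
(`integral_transitionOp_eq`). -/

@[ext] theorem ext {η ζ : Conf} (h : ∀ x, η x = ζ x) : η = ζ := Subtype.ext (funext h)

/-! ### The counting measure of a configuration -/

/-- The measure that gives each location its number of particles. -/
def pts (η : Conf) : Measure ℝ := Measure.sum fun y : ℝ => (η y : ℝ≥0∞) • Measure.dirac y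

theorem lintegral_pts (η : Conf) (h : ℝ → ℝ≥0∞) :
    ∫⁻ y, h y ∂η.pts = ∑' y, (η y : ℝ≥0∞) * h y := by
  simp [pts, lintegral_sum_measure]

theorem pts_apply (η : Conf) {B : Set ℝ} (hB : MeasurableSet B) :
    η.pts B = ∑' y, (η y : ℝ≥0∞) * B.indicator 1 y := by
  rw [← lintegral_indicator_one hB, lintegral_pts]

theorem pts_singleton (η : Conf) (y : ℝ) : η.pts {y} = η y := by
  rw [pts_apply _ (measurableSet_singleton y), tsum_eq_single y]
  · simp
  · intro z hz; simp [hz]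

theorem finite_support_inter (η : Conf) {B : Set ℝ} {a b : ℝ} (hB : B ⊆ Set.Icc a b) :
    (Function.support η ∩ B).Finite :=
  (η.2 a b).subset (Set.inter_subset_inter_right _ hB)

theorem num_eq_sum (η : Conf) {B : Set ℝ} (s : Finset ℝ)
    (hs : ∀ x, x ∈ s ↔ η x ≠ 0 ∧ x ∈ B) : η.num B = ∑ x ∈ s, η x := by
  unfold num
  refine finsum_mem_eq_sum_of_inter_support_eq _ ?_
  ext x; simp only [Set.mem_inter_iff, Function.mem_support, Finset.mem_coe, hs]; tauto

theorem num_eq_sum_toFinset (η : Conf) {B : Set ℝ} (hB : (Function.support η ∩ B).Finite) :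
    η.num B = ∑ x ∈ hB.toFinset, η x :=
  η.num_eq_sum _ (by simp)

theorem pts_eq_num (η : Conf) {B : Set ℝ} (hm : MeasurableSet B) {a b : ℝ}
    (hB : B ⊆ Set.Icc a b) : η.pts B = η.num B := by
  rw [pts_apply _ hm, num_eq_sum_toFinset η (η.finite_support_inter hB),
    tsum_eq_sum (s := (η.finite_support_inter hB).toFinset)]
  · push_cast
    refine Finset.sum_congr rfl fun x hx => ?_
    simp at hx
    simp [hx.2]
  · intro x hx
    simp at hx
    by_cases h : η x = 0
    · simp [h]
    · simp [hx h]

theorem pts_Ioc (η : Conf) (a b : ℝ) : η.pts (Set.Ioc a b) = η.num (Set.Ioc a b) :=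
  η.pts_eq_num measurableSet_Ioc Set.Ioc_subset_Icc_self

theorem pts_Ioo (η : Conf) (a b : ℝ) : η.pts (Set.Ioo a b) = η.num (Set.Ioo a b) :=
  η.pts_eq_num measurableSet_Ioo Set.Ioo_subset_Icc_self

theorem measurable_num (a b : ℝ) : Measurable fun η : Conf => η.num (Set.Ioc a b) :=
  measurable_iff_comap_le.2 (le_iSup₂ (f := fun (a b : ℝ) =>
    MeasurableSpace.comap (fun η : Conf => η.num (Set.Ioc a b)) ⊤) a b)

theorem measurable_of_num {α : Type*} [MeasurableSpace α] {F : α → Conf}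
    (h : ∀ a b, Measurable fun x => (F x).num (Set.Ioc a b)) : Measurable F := by
  rw [measurable_iff_comap_le]
  unfold instMeasurableSpace
  rw [MeasurableSpace.comap_iSup]
  refine iSup_le fun a => ?_
  rw [MeasurableSpace.comap_iSup]
  refine iSup_le fun b => ?_
  rw [MeasurableSpace.comap_comp]
  exact measurable_iff_comap_le.1 (h a b)

theorem measurable_of_pts {α : Type*} [MeasurableSpace α] {F : α → Conf}
    (h : ∀ a b, Measurable fun x => (F x).pts (Set.Ioc a b)) : Measurable F := by
  refine measurable_of_num fun a b => measurable_to_countable' fun n => ?_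
  have : (fun x => (F x).num (Set.Ioc a b)) ⁻¹' {n}
      = (fun x => (F x).pts (Set.Ioc a b)) ⁻¹' {(n : ℝ≥0∞)} := by
    ext x; simp [pts_Ioc]
  rw [this]
  exact h a b (measurableSet_singleton _)

instance (η : Conf) (a b : ℝ) : IsFiniteMeasure (η.pts.restrict (Set.Ioc a b)) :=
  ⟨by simp [pts_Ioc]⟩

theorem measurable_pts_restrict (a b : ℝ) :
    Measurable fun η : Conf => η.pts.restrict (Set.Ioc a b) := by
  refine Measurable.measure_of_isPiSystem
    ((BorelSpace.measurable_eq (α := ℝ)).trans (borel_eq_generateFrom_Ioc ℝ))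
    (isPiSystem_Ioc id id) ?_ ?_
  · rintro _ ⟨u, v, -, rfl⟩
    simp_rw [Measure.restrict_apply measurableSet_Ioc, Set.Ioc_inter_Ioc, pts_Ioc]
    exact measurable_from_nat.comp (measurable_num _ _)
  · simp_rw [Measure.restrict_apply MeasurableSet.univ, Set.univ_inter, pts_Ioc]
    exact measurable_from_nat.comp (measurable_num _ _)

open Classical in
/-- The part of the counting measure on a unit interval, if it has the given mass. -/
def cellPiece (i : ℤ × ℕ) : Kernel Conf ℝ where
  toFun η := if η.num (Set.Ioc (i.1 : ℝ) (i.1 + 1)) = i.2 then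
    η.pts.restrict (Set.Ioc (i.1 : ℝ) (i.1 + 1)) else 0
  measurable' := Measurable.ite (measurable_num _ _ (measurableSet_singleton _))
    (measurable_pts_restrict _ _) measurable_const

/-- A finite kernel needs a mass bound uniform in the configuration. This is why `cellPiece` fixes
the number of particles in the cell as well as the cell. -/
instance (i : ℤ × ℕ) : IsFiniteKernel (cellPiece i) :=
  ⟨⟨i.2, ENNReal.natCast_lt_top _, fun η => by
    show (if η.num (Set.Ioc (i.1 : ℝ) (i.1 + 1)) = i.2 then
      η.pts.restrict (Set.Ioc (i.1 : ℝ) (i.1 + 1)) else 0) Set.univ ≤ _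
    split_ifs with h
    · simp [pts_Ioc, h]
    · simp⟩⟩

theorem sum_cellPiece (η : Conf) : Kernel.sum cellPiece η = η.pts := by
  refine Measure.ext fun B hB => ?_
  rw [Kernel.sum_apply' _ _ hB, ENNReal.tsum_prod']
  have h1 : ∀ k : ℤ, ∑' n : ℕ, cellPiece (k, n) η B
      = η.pts (B ∩ Set.Ioc (k : ℝ) (k + 1)) := by
    intro k
    rw [tsum_eq_single (η.num (Set.Ioc (k : ℝ) (k + 1)))]
    · simp [cellPiece, Measure.restrict_apply hB]
    · intro n hn
      simp [cellPiece, hn.symm]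
  simp_rw [h1]
  rw [← measure_iUnion (fun i j hij => ?_) fun i => hB.inter measurableSet_Ioc,
    ← Set.inter_iUnion]
  · congr 1
    have := iUnion_Ioc_intCast ℝ
    simp [this]
  · have := Set.pairwise_disjoint_Ioc_intCast ℝ hij
    exact this.mono Set.inter_subset_right Set.inter_subset_right

/-- The counting measure as a kernel. -/
def ptsKernel : Kernel Conf ℝ := Kernel.sum cellPiece

instance : IsSFiniteKernel ptsKernel := by unfold ptsKernel; infer_instance

theorem ptsKernel_apply (η : Conf) : ptsKernel η = η.pts := sum_cellPiece η

theorem measurable_lintegral_pts {α : Type*} [MeasurableSpace α] {F : α → Conf}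
    (hF : Measurable F) {h : α → ℝ → ℝ≥0∞} (hh : Measurable (Function.uncurry h)) :
    Measurable fun x => ∫⁻ y, h x y ∂(F x).pts := by
  have := Measurable.lintegral_kernel_prod_right (κ := ptsKernel.comap F hF) hh
  simpa only [Kernel.comap_apply, ptsKernel_apply] using this

theorem measurable_pts_section {α : Type*} [MeasurableSpace α] {F : α → Conf}
    (hF : Measurable F) {s : Set (α × ℝ)} (hs : MeasurableSet s) :
    Measurable fun x => (F x).pts (Prod.mk x ⁻¹' s) := by
  have := Kernel.measurable_kernel_prodMk_left (κ := ptsKernel.comap F hF) hs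
  simpa only [Kernel.comap_apply, ptsKernel_apply] using this

theorem measurable_nat_of_cast {α : Type*} [MeasurableSpace α] {f : α → ℕ}
    (h : Measurable fun x => (f x : ℝ≥0∞)) : Measurable f := by
  refine measurable_to_countable' fun n => ?_
  have : f ⁻¹' {n} = (fun x => (f x : ℝ≥0∞)) ⁻¹' {(n : ℝ≥0∞)} := by ext x; simp
  rw [this]
  exact h (measurableSet_singleton _)

/-- The number of particles at a point is the mass of a singleton, which is a section of the
measurable graph of `y`. -/
theorem measurable_eval {α : Type*} [MeasurableSpace α] {F : α → Conf} (hF : Measurable F)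
    {y : α → ℝ} (hy : Measurable y) : Measurable fun x => F x (y x) := by
  refine measurable_nat_of_cast ?_
  have hs : MeasurableSet {p : α × ℝ | p.2 = y p.1} :=
    measurableSet_eq_fun measurable_snd (hy.comp measurable_fst)
  have := measurable_pts_section hF hs
  convert this using 2 with x
  rw [← pts_singleton]
  rfl

theorem measurable_num_Ioo {α : Type*} [MeasurableSpace α] {F : α → Conf} (hF : Measurable F)
    {y z : α → ℝ} (hy : Measurable y) (hz : Measurable z) :
    Measurable fun x => (F x).num (Set.Ioo (y x) (z x)) := by
  refine measurable_nat_of_cast ?_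
  have hs : MeasurableSet {p : α × ℝ | y p.1 < p.2 ∧ p.2 < z p.1} :=
    (measurableSet_lt (hy.comp measurable_fst) measurable_snd).inter
      (measurableSet_lt measurable_snd (hz.comp measurable_fst))
  convert measurable_pts_section hF hs using 2 with x
  rw [← pts_Ioo]
  rfl

/-! ### Adding, moving and removing particles -/

open Classical in
/-- The configuration with `j` particles added at `y`. -/
def add (η : Conf) (y : ℝ) (j : ℕ) : Conf :=
  ⟨fun x => η x + if x = y then j else 0, fun a b =>
    ((η.2 a b).union (Set.finite_singleton y)).subset (by
      rintro x ⟨hx, hab⟩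
      by_cases hz : x = y
      · exact Or.inr hz
      · refine Or.inl ⟨fun h0 => hx ?_, hab⟩
        show η x + (if x = y then j else 0) = 0
        rw [h0, if_neg hz])⟩

open Classical in
theorem add_apply (η : Conf) (y : ℝ) (j : ℕ) (x : ℝ) :
    η.add y j x = η x + if x = y then j else 0 := rfl

open Classical in
theorem move_apply (η : Conf) (y z x : ℝ) :
    η.move y z x = (η x - if x = y then 1 else 0) + if x = z then 1 else 0 := rfl

open Classical in
theorem restrict_apply (η : Conf) (B : Set ℝ) (x : ℝ) :
    η.restrict B x = if x ∈ B then η x else 0 := rfl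

theorem lintegral_pts_add (η : Conf) (y : ℝ) (j : ℕ) (h : ℝ → ℝ≥0∞) :
    ∫⁻ x, h x ∂(η.add y j).pts = ∫⁻ x, h x ∂η.pts + j * h y := by
  classical
  simp_rw [lintegral_pts, add_apply, Nat.cast_add, add_mul]
  rw [ENNReal.tsum_add]
  congr 1
  rw [tsum_eq_single y]
  · simp
  · intro x hx; simp [hx]

theorem pts_add (η : Conf) (y : ℝ) (j : ℕ) {B : Set ℝ} (hB : MeasurableSet B) :
    (η.add y j).pts B = η.pts B + j * B.indicator 1 y := by
  rw [← lintegral_indicator_one hB, lintegral_pts_add, lintegral_indicator_one hB]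

theorem exists_eq_add {η : Conf} {y : ℝ} (h : η y ≠ 0) : ∃ ζ : Conf, η = ζ.add y 1 := by
  classical
  refine ⟨⟨fun x => η x - if x = y then 1 else 0, fun a b => (η.2 a b).subset ?_⟩, ?_⟩
  · rintro x ⟨hx, hab⟩
    refine ⟨fun h0 => hx ?_, hab⟩
    show η x - (if x = y then 1 else 0) = 0
    omega
  · ext x
    show η x = (η x - if x = y then 1 else 0) + if x = y then 1 else 0
    split_ifs with hx
    · subst hx; omega
    · omega

theorem move_add_one (η : Conf) (y z : ℝ) : (η.add y 1).move y z = η.add z 1 := by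
  classical
  ext x; simp only [move_apply, add_apply]; split_ifs <;> omega

/-- Truncated subtraction makes a move from an empty location create a particle. The case has no
dynamical meaning, but joint measurability of `move` has to cover it. -/
theorem move_eq_add {η : Conf} {y : ℝ} (h : η y = 0) (z : ℝ) : η.move y z = η.add z 1 := by
  classical
  ext x; simp only [move_apply, add_apply]; split_ifs with h1 h2 h2 <;> subst_vars <;> omega

theorem measurable_add {α : Type*} [MeasurableSpace α] {F : α → Conf} (hF : Measurable F)
    {y : α → ℝ} (hy : Measurable y) (j : ℕ) : Measurable fun x => (F x).add (y x) j := by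
  refine measurable_of_pts fun a b => ?_
  simp_rw [pts_add _ _ _ measurableSet_Ioc]
  refine ((measurable_pts_section hF (s := {p | p.2 ∈ Set.Ioc a b})
    (measurable_snd measurableSet_Ioc))).add ?_
  exact ((measurable_one.indicator measurableSet_Ioc).comp hy).const_mul _

theorem measurable_move {α : Type*} [MeasurableSpace α] {F : α → Conf} (hF : Measurable F)
    {y z : α → ℝ} (hy : Measurable y) (hz : Measurable z) :
    Measurable fun x => (F x).move (y x) (z x) := by
  classical
  refine measurable_of_pts fun a b => ?_
  -- The correction vanishes where nothing can be removed, in line with the truncated subtraction in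
  -- `move`.
  have key : ∀ x, ((F x).move (y x) (z x)).pts (Set.Ioc a b) =
      (F x).pts (Set.Ioc a b) - (if F x (y x) = 0 then 0 else (Set.Ioc a b).indicator 1 (y x))
        + (Set.Ioc a b).indicator 1 (z x) := by
    intro x
    split_ifs with h
    · rw [move_eq_add h, pts_add _ _ _ measurableSet_Ioc]; simp
    · obtain ⟨ζ, hζ⟩ := exists_eq_add h
      rw [hζ, move_add_one, pts_add _ _ _ measurableSet_Ioc, pts_add _ _ _ measurableSet_Ioc]
      by_cases hb : y x ∈ Set.Ioc a b <;> simp [hb]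
  simp_rw [key]
  refine ((measurable_pts_section hF (s := {p | p.2 ∈ Set.Ioc a b})
    (measurable_snd measurableSet_Ioc)).sub (Measurable.ite
      (measurable_eval hF hy (measurableSet_singleton 0)) measurable_const
      ((measurable_one.indicator measurableSet_Ioc).comp hy))).add
      ((measurable_one.indicator measurableSet_Ioc).comp hz)

theorem pts_restrict (η : Conf) {A B : Set ℝ} (hA : MeasurableSet A) (hB : MeasurableSet B) :
    (η.restrict A).pts B = η.pts (B ∩ A) := by
  classical
  rw [pts_apply _ hB, pts_apply _ (hB.inter hA)]
  refine tsum_congr fun x => ?_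
  rw [restrict_apply]
  by_cases hx : x ∈ A <;> by_cases hx' : x ∈ B <;> simp [hx, hx']

theorem measurable_restrict {A : Set ℝ} (hA : MeasurableSet A) :
    Measurable fun η : Conf => η.restrict A := by
  refine measurable_of_pts fun a b => ?_
  simp_rw [pts_restrict _ hA measurableSet_Ioc]
  exact measurable_pts_section measurable_id (s := {p | p.2 ∈ Set.Ioc a b ∩ A})
    (measurable_snd (measurableSet_Ioc.inter hA))

end Conf

/-! ### Traps and landing points -/

/-- The probability to fly from `y` up to `z`. -/
def reach (q lam : ℝ) (η : Conf) (y z : ℝ) : ℝ :=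
  Real.exp (-lam * (z - y)) * q ^ η.num (Set.Ioo y z)

/-- The measure that gives each location `y` the mass `1 - q ^ η y`. -/
def dep (q : ℝ) (η : Conf) : Measure ℝ :=
  Measure.sum fun y : ℝ => ENNReal.ofReal (1 - q ^ η y) • Measure.dirac y

/-- The rate at which a flying particle is stopped, as a measure on the line. -/
def trap (q lam : ℝ) (η : Conf) : Measure ℝ := ENNReal.ofReal lam • volume + dep q η

theorem lintegral_dep (q : ℝ) (η : Conf) (h : ℝ → ℝ≥0∞) :
    ∫⁻ y, h y ∂dep q η = ∑' y, ENNReal.ofReal (1 - q ^ η y) * h y := by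
  simp [dep, lintegral_sum_measure]

theorem lintegral_trap (q lam : ℝ) (η : Conf) (h : ℝ → ℝ≥0∞) :
    ∫⁻ y, h y ∂trap q lam η = ENNReal.ofReal lam * (∫⁻ y, h y) + ∫⁻ y, h y ∂dep q η := by
  rw [trap, lintegral_add_measure, lintegral_smul_measure, smul_eq_mul]

theorem setLIntegral_trap (q lam : ℝ) (η : Conf) {s : Set ℝ} (hs : MeasurableSet s)
    (h : ℝ → ℝ≥0∞) : ∫⁻ y in s, h y ∂trap q lam η =
      ENNReal.ofReal lam * (∫⁻ y in s, h y) + ∫⁻ y in s, h y ∂dep q η := by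
  rw [← lintegral_indicator hs, lintegral_trap, lintegral_indicator hs, lintegral_indicator hs]

open Classical in
/-- The density of `dep` with respect to the counting measure. -/
def depDensity (q : ℝ) (η : Conf) (y : ℝ) : ℝ≥0 :=
  (1 - q ^ η y).toNNReal / (η y : ℝ≥0)

theorem measurable_depDensity (q : ℝ) : Measurable (Function.uncurry (depDensity q)) := by
  have : Measurable fun p : Conf × ℝ => p.1 p.2 := Conf.measurable_eval measurable_fst measurable_snd
  have h2 : Measurable fun n : ℕ => (1 - q ^ n).toNNReal / (n : ℝ≥0) := measurable_from_nat
  exact h2.comp this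

/-- The kernel `η ↦ dep q η`. -/
def depKernel (q : ℝ) : Kernel Conf ℝ :=
  Conf.ptsKernel.withDensity fun η y => (depDensity q η y : ℝ≥0∞)

instance (q : ℝ) : IsSFiniteKernel (depKernel q) := by unfold depKernel; infer_instance

theorem depKernel_apply (q : ℝ) (η : Conf) : depKernel q η = dep q η := by
  have hm : Measurable (Function.uncurry fun (η : Conf) y => (depDensity q η y : ℝ≥0∞)) :=
    measurable_coe_nnreal_ennreal.comp (measurable_depDensity q)
  refine Measure.ext fun B hB => ?_
  rw [depKernel, Kernel.withDensity_apply' _ hm, Conf.ptsKernel_apply,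
    ← lintegral_indicator hB, Conf.lintegral_pts, ← lintegral_indicator_one hB, lintegral_dep]
  refine tsum_congr fun y => ?_
  by_cases hy : y ∈ B
  · by_cases h0 : η y = 0
    · simp [h0]
    · have : (η y : ℝ≥0) ≠ 0 := by exact_mod_cast h0
      simp only [Set.indicator_of_mem hy, depDensity, Pi.one_apply, mul_one]
      rw [ENNReal.ofReal, ENNReal.coe_div this, ENNReal.coe_natCast]
      exact ENNReal.mul_div_cancel (by exact_mod_cast h0) (ENNReal.natCast_ne_top _)
  · simp [hy]

instance (q : ℝ) (η : Conf) : SFinite (dep q η) := by rw [← depKernel_apply]; infer_instance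

instance (q lam : ℝ) (η : Conf) : SFinite (trap q lam η) := by unfold trap; infer_instance

/-- The kernel `η ↦ trap q lam η`. -/
def trapKernel (q lam : ℝ) : Kernel Conf ℝ :=
  Kernel.const Conf (ENNReal.ofReal lam • volume) + depKernel q

instance (q lam : ℝ) : IsSFiniteKernel (trapKernel q lam) := by unfold trapKernel; infer_instance

theorem trapKernel_apply (q lam : ℝ) (η : Conf) : trapKernel q lam η = trap q lam η := by
  rw [trapKernel, add_apply, depKernel_apply, Kernel.const_apply, trap]

theorem measurable_lintegral_dep {α : Type*} [MeasurableSpace α] (q : ℝ) {F : α → Conf}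
    (hF : Measurable F) {h : α → ℝ → ℝ≥0∞} (hh : Measurable (Function.uncurry h)) :
    Measurable fun x => ∫⁻ y, h x y ∂dep q (F x) := by
  have := Measurable.lintegral_kernel_prod_right (κ := (depKernel q).comap F hF) hh
  simpa only [Kernel.comap_apply, depKernel_apply] using this

theorem measurable_reach {α : Type*} [MeasurableSpace α] (q lam : ℝ) {F : α → Conf}
    (hF : Measurable F) {y z : α → ℝ} (hy : Measurable y) (hz : Measurable z) :
    Measurable fun x => reach q lam (F x) (y x) (z x) := by
  have h1 := Conf.measurable_num_Ioo hF hy hz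
  have h2 : Measurable fun n : ℕ => q ^ n := measurable_from_nat
  exact (Real.measurable_exp.comp ((hz.sub hy).const_mul _)).mul (h2.comp h1)

/-- The diffuse part and the atoms of the landing law have the same density `reach` with respect to
`trap`. All later facts on landing points use only this form. -/
theorem landingLaw_eq_withDensity {q lam : ℝ} (hq0 : 0 ≤ q) (hlam : 0 ≤ lam)
    (η : Conf) (y : ℝ) : landingLaw q lam η y =
      ((trap q lam η).restrict (Set.Ioi y)).withDensity
        fun z => ENNReal.ofReal (reach q lam η y z) := by
  have hr : Measurable fun z => reach q lam η y z :=
    measurable_reach q lam measurable_const measurable_const measurable_id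
  have hr0 : ∀ z, 0 ≤ reach q lam η y z := fun z => by unfold reach; positivity
  refine Measure.ext fun B hB => ?_
  rw [withDensity_apply _ hB, Measure.restrict_restrict hB,
    setLIntegral_trap _ _ _ (hB.inter measurableSet_Ioi), landingLaw, Measure.add_apply,
    withDensity_apply _ hB, Measure.restrict_restrict hB, Measure.sum_apply _ hB,
    ← lintegral_const_mul _ hr.ennreal_ofReal]
  congr 1
  · refine lintegral_congr fun z => ?_
    rw [← ENNReal.ofReal_mul hlam, reach, mul_assoc]
  · rw [← lintegral_indicator (hB.inter measurableSet_Ioi), lintegral_dep]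
    have : ∀ z : {z : ℝ // y < z ∧ η z ≠ 0},
        (ENNReal.ofReal (Real.exp (-lam * (z - y)) * q ^ η.num (Set.Ioo y z) * (1 - q ^ η z))
          • Measure.dirac (z : ℝ)) B = (fun z : ℝ => ENNReal.ofReal (1 - q ^ η z) *
            ENNReal.ofReal (reach q lam η y z) * B.indicator 1 z) z := by
      intro z
      simp only [Measure.smul_apply, Measure.dirac_apply' _ hB, smul_eq_mul]
      rw [← reach, mul_comm (reach q lam η y z), ENNReal.ofReal_mul' (hr0 z)]
    simp_rw [this]
    refine (tsum_subtype {z : ℝ | y < z ∧ η z ≠ 0} (fun z : ℝ => ENNReal.ofReal (1 - q ^ η z) *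
            ENNReal.ofReal (reach q lam η y z) * B.indicator 1 z)).trans ?_
    refine tsum_congr fun z => ?_
    by_cases hz : η z = 0
    · simp [hz]
    · by_cases hyz : y < z <;> by_cases hzB : z ∈ B <;> simp [hz, hyz, hzB]

theorem lintegral_landingLaw {q lam : ℝ} (hq0 : 0 ≤ q) (hlam : 0 ≤ lam)
    (η : Conf) (y : ℝ) {h : ℝ → ℝ≥0∞} (hh : Measurable h) :
    ∫⁻ z, h z ∂landingLaw q lam η y =
      ∫⁻ z in Set.Ioi y, ENNReal.ofReal (reach q lam η y z) * h z ∂trap q lam η := by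
  rw [landingLaw_eq_withDensity hq0 hlam, lintegral_withDensity_eq_lintegral_mul _ _ hh]
  · rfl
  · exact (measurable_reach q lam measurable_const measurable_const measurable_id).ennreal_ofReal

theorem landingLaw_apply {q lam : ℝ} (hq0 : 0 ≤ q) (hlam : 0 ≤ lam)
    (η : Conf) (y : ℝ) {B : Set ℝ} (hB : MeasurableSet B) :
    landingLaw q lam η y B =
      ∫⁻ z in B ∩ Set.Ioi y, ENNReal.ofReal (reach q lam η y z) ∂trap q lam η := by
  rw [landingLaw_eq_withDensity hq0 hlam, withDensity_apply _ hB, Measure.restrict_restrict hB]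

/-- The landing law as a kernel. -/
def landKernel (q lam : ℝ) : Kernel (Conf × ℝ) ℝ :=
  ((trapKernel q lam).comap Prod.fst measurable_fst).withDensity fun p z =>
    ((if p.2 < z then (reach q lam p.1 p.2 z).toNNReal else 0 : ℝ≥0) : ℝ≥0∞)

instance (q lam : ℝ) : IsSFiniteKernel (landKernel q lam) := by unfold landKernel; infer_instance

theorem landKernel_apply {q lam : ℝ} (hq0 : 0 ≤ q) (hlam : 0 ≤ lam) (p : Conf × ℝ) :
    landKernel q lam p = landingLaw q lam p.1 p.2 := by
  have hm : Measurable (Function.uncurry fun (p : Conf × ℝ) z =>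
      ((if p.2 < z then (reach q lam p.1 p.2 z).toNNReal else 0 : ℝ≥0) : ℝ≥0∞)) := by
    refine measurable_coe_nnreal_ennreal.comp (Measurable.ite ?_ ?_ measurable_const)
    · exact measurableSet_lt (measurable_snd.comp measurable_fst) measurable_snd
    · exact (measurable_reach q lam (measurable_fst.comp measurable_fst)
        (measurable_snd.comp measurable_fst) measurable_snd).real_toNNReal
  refine Measure.ext fun B hB => ?_
  rw [landKernel, Kernel.withDensity_apply' _ hm, Kernel.comap_apply, trapKernel_apply,
    landingLaw_apply hq0 hlam _ _ hB, ← lintegral_indicator hB,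
    ← lintegral_indicator (hB.inter measurableSet_Ioi)]
  refine lintegral_congr fun z => ?_
  by_cases hz : z ∈ B <;> by_cases hy : p.2 < z <;> simp [hz, hy, ENNReal.ofReal]

/-! ### The mass of the landing law -/

/-- The survival function decreases at rate `lam` between atoms and loses the fraction `1 - q ^ m w`
at an atom `w`, so the losses add up to one minus the final value. The induction removes the last
atom, and `r` varies because the shorter interval ends there. -/
theorem trap_mass_real (q lam : ℝ) (hq0 : 0 ≤ q) (hq1 : q ≤ 1) (hlam : 0 ≤ lam) (m : ℝ → ℕ)
    (S : Finset ℝ) : ∀ r : ℝ, 0 ≤ r → (∀ w ∈ S, 0 < w ∧ w ≤ r) →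
    (∫ t in (0 : ℝ)..r, lam * (Real.exp (-lam * t) * q ^ (∑ w ∈ S with w < t, m w)))
      + ∑ w ∈ S, (1 - q ^ m w) * (Real.exp (-lam * w) * q ^ (∑ w' ∈ S with w' < w, m w'))
      = 1 - Real.exp (-lam * r) * q ^ (∑ w ∈ S, m w) := by
  have hexp : ∀ a b : ℝ, ∫ t in a..b, lam * Real.exp (-lam * t)
      = Real.exp (-lam * a) - Real.exp (-lam * b) := by
    intro a b
    have h : ∀ t ∈ Set.uIcc a b, HasDerivAt (fun t => -Real.exp (-lam * t))
        (lam * Real.exp (-lam * t)) t := by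
      intro t _
      have := (((hasDerivAt_id' t).const_mul (-lam)).exp).fun_neg
      simpa [mul_comm] using this
    rw [intervalIntegral.integral_eq_sub_of_hasDerivAt h
      (Continuous.intervalIntegrable (by fun_prop) _ _)]
    ring
  have hanti : ∀ (S : Finset ℝ) (a b : ℝ), IntervalIntegrable
      (fun t => lam * (Real.exp (-lam * t) * q ^ (∑ w ∈ S with w < t, m w))) volume a b := by
    intro S a b
    refine Antitone.intervalIntegrable fun s t hst => ?_
    have h1 : (∑ w ∈ S with w < s, m w) ≤ ∑ w ∈ S with w < t, m w :=
      Finset.sum_le_sum_of_subset (Finset.monotone_filter_right _ fun w _ hw => hw.trans_le hst)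
    have h2 := pow_le_pow_of_le_one hq0 hq1 h1
    have h3 : Real.exp (-lam * t) ≤ Real.exp (-lam * s) := Real.exp_le_exp.2 (by nlinarith)
    gcongr
  induction S using Finset.induction_on_max with
  | empty =>
    intro r hr _
    simpa using hexp 0 r
  | insert w S hlt ih =>
    intro r hr hS
    have hw := hS w (by simp)
    have hnot : w ∉ S := fun h => (hlt w h).false
    -- The interval is cut at the largest atom `w`: before it the exponent ignores `w`, beyond it
    -- the exponent is constant.
    have ih' := ih w hw.1.le fun x hx => ⟨(hS x (by simp [hx])).1, (hlt x hx).le⟩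
    rw [← intervalIntegral.integral_add_adjacent_intervals (hanti _ 0 w) (hanti _ w r)]
    have e1 : (∫ t in (0 : ℝ)..w, lam * (Real.exp (-lam * t) *
        q ^ (∑ x ∈ insert w S with x < t, m x))) = ∫ t in (0 : ℝ)..w, lam *
          (Real.exp (-lam * t) * q ^ (∑ x ∈ S with x < t, m x)) := by
      refine intervalIntegral.integral_congr fun t ht => ?_
      rw [Set.uIcc_of_le hw.1.le] at ht
      simp only [Finset.filter_insert, if_neg ht.2.not_gt]
    have e2 : (∫ t in w..r, lam * (Real.exp (-lam * t) *
        q ^ (∑ x ∈ insert w S with x < t, m x))) = ∫ t in w..r, lam *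
          Real.exp (-lam * t) * q ^ (∑ x ∈ insert w S, m x) := by
      refine intervalIntegral.integral_congr_ae (Filter.Eventually.of_forall fun t ht => ?_)
      rw [Set.uIoc_of_le hw.2] at ht
      rw [Finset.filter_true_of_mem, mul_assoc]
      intro x hx
      rcases Finset.mem_insert.1 hx with rfl | hx
      · exact ht.1
      · exact (hlt x hx).trans ht.1
    have e3 : ∑ x ∈ S, (1 - q ^ m x) * (Real.exp (-lam * x) *
        q ^ (∑ w' ∈ insert w S with w' < x, m w')) = ∑ x ∈ S, (1 - q ^ m x) *
          (Real.exp (-lam * x) * q ^ (∑ w' ∈ S with w' < x, m w')) := by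
      refine Finset.sum_congr rfl fun x hx => ?_
      simp only [Finset.filter_insert, if_neg (hlt x hx).not_gt]
    have e4 : (∑ w' ∈ insert w S with w' < w, m w') = ∑ w' ∈ S, m w' := by
      rw [Finset.filter_insert, if_neg (lt_irrefl w), Finset.filter_true_of_mem hlt]
    rw [e1, e2, intervalIntegral.integral_mul_const, hexp, Finset.sum_insert hnot,
      Finset.sum_insert hnot, e3, e4, pow_add]
    linear_combination ih'

theorem trap_mass (q lam : ℝ) (hq0 : 0 ≤ q) (hq1 : q ≤ 1) (hlam : 0 ≤ lam) (m : ℝ → ℕ)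
    (S : Finset ℝ) (r : ℝ) (hr : 0 ≤ r) (hS : ∀ w ∈ S, 0 < w ∧ w ≤ r) :
    (ENNReal.ofReal lam * ∫⁻ t in Set.Ioo 0 r, ENNReal.ofReal (Real.exp (-lam * t) *
        q ^ (∑ w ∈ S with w < t, m w)))
      + ∑ w ∈ S, ENNReal.ofReal (1 - q ^ m w) *
        ENNReal.ofReal (Real.exp (-lam * w) * q ^ (∑ w' ∈ S with w' < w, m w'))
      + ENNReal.ofReal (Real.exp (-lam * r) * q ^ (∑ w ∈ S, m w)) = 1 := by
  have h := trap_mass_real q lam hq0 hq1 hlam m S r hr hS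
  have hpw : ∀ n : ℕ, 0 ≤ 1 - q ^ n := fun n => sub_nonneg.2 (pow_le_one₀ hq0 hq1)
  have hanti : Antitone fun t => Real.exp (-lam * t) * q ^ (∑ w ∈ S with w < t, m w) := by
    intro s t hst
    have h1 : (∑ w ∈ S with w < s, m w) ≤ ∑ w ∈ S with w < t, m w :=
      Finset.sum_le_sum_of_subset (Finset.monotone_filter_right _ fun w _ hw => hw.trans_le hst)
    have h2 := pow_le_pow_of_le_one hq0 hq1 h1
    have h3 : Real.exp (-lam * t) ≤ Real.exp (-lam * s) := Real.exp_le_exp.2 (by nlinarith)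
    dsimp only
    gcongr
  have hint := hanti.intervalIntegrable (μ := volume) (a := 0) (b := r)
  rw [intervalIntegrable_iff_integrableOn_Ioo_of_le hr] at hint
  rw [← ofReal_integral_eq_lintegral_ofReal hint (Filter.Eventually.of_forall fun t => by positivity),
    ← ENNReal.ofReal_mul hlam, ← integral_const_mul]
  simp_rw [← ENNReal.ofReal_mul (hpw _)]
  rw [← ENNReal.ofReal_sum_of_nonneg (fun w _ => mul_nonneg (hpw _) (by positivity)),
    ← ENNReal.ofReal_add, ← ENNReal.ofReal_add]
  · rw [intervalIntegral.integral_of_le hr, integral_Ioc_eq_integral_Ioo] at h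
    rw [h]; simp
  · exact add_nonneg (integral_nonneg fun t => by positivity)
      (Finset.sum_nonneg fun w _ => mul_nonneg (hpw _) (by positivity))
  · positivity
  · exact integral_nonneg fun t => by positivity
  · exact Finset.sum_nonneg fun w _ => mul_nonneg (hpw _) (by positivity)

/-- Here `t` is the distance flown and `e` places it on the line. Translations and reflections both
preserve Lebesgue measure, so one computation serves the forward and the backward reading of the
survival probability `R`. -/
theorem trap_mass_param (q lam : ℝ) (hq0 : 0 ≤ q) (hq1 : q ≤ 1) (hlam : 0 ≤ lam) (η : Conf)
    (e : ℝ ≃ ℝ) (he : ∀ f : ℝ → ℝ≥0∞, ∫⁻ t, f (e t) = ∫⁻ x, f x) {I : Set ℝ} {r : ℝ}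
    (hr : 0 < r) (hI : ∀ t, e t ∈ I ↔ t ∈ Set.Ioo 0 r) (hm : MeasurableSet I)
    (hfin : (Function.support η ∩ I).Finite) (R : ℝ → ℝ)
    (hR : ∀ t, 0 < t → t ≤ r →
      R t = Real.exp (-lam * t) * q ^ (η.num {x | x ∈ I ∧ e.symm x < t})) :
    ∫⁻ x in I, ENNReal.ofReal (R (e.symm x)) ∂trap q lam η + ENNReal.ofReal (R r) = 1 := by
  classical
  set S : Finset ℝ := hfin.toFinset.image e.symm with hS
  have hmem : ∀ t, t ∈ S ↔ η (e t) ≠ 0 ∧ e t ∈ I := by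
    intro t
    simp only [hS, Finset.mem_image, Set.Finite.mem_toFinset, Set.mem_inter_iff,
      Function.mem_support]
    constructor
    · rintro ⟨x, hx, rfl⟩
      simpa using hx
    · intro h
      exact ⟨e t, h, by simp⟩
  have hnum : ∀ t, η.num {x | x ∈ I ∧ e.symm x < t} = ∑ w ∈ S with w < t, η (e w) := by
    intro t
    rw [η.num_eq_sum ((S.filter (· < t)).image e)]
    · rw [Finset.sum_image e.injective.injOn]
    · intro x
      simp only [Finset.mem_image, Finset.mem_filter, hmem, Set.mem_ofPred_eq]
      constructor
      · rintro ⟨w, ⟨h1, h2⟩, rfl⟩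
        simpa using ⟨h1.1, h1.2, h2⟩
      · rintro ⟨h1, h2, h3⟩
        exact ⟨e.symm x, by simpa using ⟨⟨h1, h2⟩, h3⟩, by simp⟩
  have hSr : ∀ w ∈ S, 0 < w ∧ w < r := fun w hw => (hI w).1 ((hmem w).1 hw).2
  have key := trap_mass q lam hq0 hq1 hlam (fun w => η (e w)) S r hr.le
    fun w hw => ⟨(hSr w hw).1, (hSr w hw).2.le⟩
  have hRr : R r = Real.exp (-lam * r) * q ^ (∑ w ∈ S, η (e w)) := by
    rw [hR r hr le_rfl, hnum, Finset.filter_true_of_mem fun w hw => (hSr w hw).2]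
  rw [← key, setLIntegral_trap _ _ _ hm, ← hRr]
  congr 2
  · congr 1
    rw [← lintegral_indicator hm, ← he, ← lintegral_indicator measurableSet_Ioo]
    refine lintegral_congr fun t => ?_
    by_cases ht : t ∈ Set.Ioo 0 r
    · rw [Set.indicator_of_mem ht, Set.indicator_of_mem ((hI t).2 ht), e.symm_apply_apply,
        hR t ht.1 ht.2.le, hnum]
    · rw [Set.indicator_of_notMem ht, Set.indicator_of_notMem (fun h => ht ((hI t).1 h))]
  · rw [← lintegral_indicator hm, lintegral_dep, tsum_eq_sum (s := S.image e),
      Finset.sum_image e.injective.injOn]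
    · refine Finset.sum_congr rfl fun w hw => ?_
      rw [Set.indicator_of_mem ((hmem w).1 hw).2, e.symm_apply_apply,
        hR w (hSr w hw).1 (hSr w hw).2.le, hnum]
    · intro x hx
      by_cases h0 : η x = 0
      · simp [h0]
      · have : x ∉ I := fun h => hx (Finset.mem_image.2 ⟨e.symm x, (hmem _).2 (by simpa using ⟨h0, h⟩),
          by simp⟩)
        simp [this]

theorem lintegral_reach_right {q lam : ℝ} (hq0 : 0 ≤ q) (hq1 : q ≤ 1) (hlam : 0 ≤ lam) (η : Conf)
    {y x : ℝ} (hyx : y < x) : ∫⁻ z in Set.Ioo y x, ENNReal.ofReal (reach q lam η y z) ∂trap q lam η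
      + ENNReal.ofReal (reach q lam η y x) = 1 := by
  have := trap_mass_param q lam hq0 hq1 hlam η (Equiv.addLeft y)
    (fun f => lintegral_add_left_eq_self f y) (I := Set.Ioo y x) (r := x - y) (sub_pos.2 hyx)
    (fun t => by simp [lt_sub_iff_add_lt']) measurableSet_Ioo
    (η.finite_support_inter Set.Ioo_subset_Icc_self) (fun t => reach q lam η y (y + t))
    (fun t h0 hr => by
      unfold reach
      congr 2
      · ring
      · congr 1
        ext w
        simp only [Set.mem_Ioo, Set.mem_ofPred_eq, Equiv.addLeft_symm, Equiv.coe_addLeft]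
        constructor
        · rintro ⟨h1, h2⟩; exact ⟨⟨h1, by linarith⟩, by linarith⟩
        · rintro ⟨⟨h1, h2⟩, h3⟩; exact ⟨h1, by linarith⟩)
  simpa using this

/-- Seen backward from `z`, the function `y ↦ reach q lam η y z` is again the survival function of
the same hazard. This reversal symmetry is what makes the current and the window balance computable.
-/
theorem lintegral_reach_left {q lam : ℝ} (hq0 : 0 ≤ q) (hq1 : q ≤ 1) (hlam : 0 ≤ lam) (η : Conf)
    {a z : ℝ} (haz : a < z) : ∫⁻ y in Set.Ioo a z, ENNReal.ofReal (reach q lam η y z) ∂trap q lam η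
      + ENNReal.ofReal (reach q lam η a z) = 1 := by
  have := trap_mass_param q lam hq0 hq1 hlam η (Equiv.subLeft z)
    (fun f => lintegral_sub_left_eq_self f z) (I := Set.Ioo a z) (r := z - a) (sub_pos.2 haz)
    (fun t => by
      simp only [Equiv.subLeft_apply, Set.mem_Ioo]
      constructor <;> rintro ⟨h1, h2⟩ <;> constructor <;> linarith) measurableSet_Ioo
    (η.finite_support_inter Set.Ioo_subset_Icc_self) (fun t => reach q lam η (z - t) z)
    (fun t h0 hr => by
      unfold reach
      congr 2
      · ring
      · congr 1
        ext w
        simp only [Set.mem_Ioo, Set.mem_ofPred_eq, Equiv.subLeft_symm_apply]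
        constructor
        · rintro ⟨h1, h2⟩; exact ⟨⟨by linarith, by linarith⟩, by linarith⟩
        · rintro ⟨⟨h1, h2⟩, h3⟩; exact ⟨by linarith, by linarith⟩)
  simpa [sub_eq_add_neg, neg_add_eq_sub] using this

theorem reach_nonneg {q : ℝ} (hq0 : 0 ≤ q) (lam : ℝ) (η : Conf) (y z : ℝ) :
    0 ≤ reach q lam η y z := by unfold reach; positivity

theorem reach_le_exp {q : ℝ} (hq0 : 0 ≤ q) (hq1 : q ≤ 1) (lam : ℝ) (η : Conf) (y z : ℝ) :
    reach q lam η y z ≤ Real.exp (-lam * (z - y)) :=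
  mul_le_of_le_one_right (Real.exp_pos _).le (pow_le_one₀ hq0 hq1)

theorem tendsto_exp_far {lam : ℝ} (hlam : 0 < lam) (y : ℝ) :
    Tendsto (fun n : ℕ => ENNReal.ofReal (Real.exp (-lam * ((y + (n + 1)) - y)))) atTop (𝓝 0) := by
  rw [← ENNReal.ofReal_zero]
  refine ENNReal.tendsto_ofReal (Real.tendsto_exp_atBot.comp ?_)
  simp_rw [add_sub_cancel_left]
  exact (tendsto_atTop_add_const_right _ _ tendsto_natCast_atTop_atTop).const_mul_atTop_of_neg
    (neg_lt_zero.2 hlam)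

theorem iUnion_Ioo_right (y : ℝ) : ⋃ n : ℕ, Set.Ioo y (y + (n + 1)) = Set.Ioi y := by
  ext z
  simp only [Set.mem_iUnion, Set.mem_Ioo, Set.mem_Ioi]
  constructor
  · rintro ⟨n, h⟩; exact h.1
  · intro h
    obtain ⟨n, hn⟩ := exists_nat_gt (z - y)
    exact ⟨n, h, by linarith⟩

theorem landingLaw_Ioo_add {q lam : ℝ} (hq0 : 0 ≤ q) (hq1 : q ≤ 1) (hlam : 0 ≤ lam) (η : Conf)
    {y x : ℝ} (hyx : y < x) :
    landingLaw q lam η y (Set.Ioo y x) + ENNReal.ofReal (reach q lam η y x) = 1 := by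
  rw [landingLaw_apply hq0 hlam _ _ measurableSet_Ioo, Set.inter_eq_left.2 Set.Ioo_subset_Ioi_self]
  exact lintegral_reach_right hq0 hq1 hlam η hyx

theorem landingLaw_Iic {q lam : ℝ} (hq0 : 0 ≤ q) (hlam : 0 ≤ lam) (η : Conf) (y : ℝ) :
    landingLaw q lam η y (Set.Iic y) = 0 := by
  rw [landingLaw_apply hq0 hlam _ _ measurableSet_Iic, Set.Iic_inter_Ioi, Set.Ioc_self,
    Measure.restrict_empty, lintegral_zero_measure]

theorem landingLaw_univ {q lam : ℝ} (hq0 : 0 ≤ q) (hq1 : q ≤ 1) (hlam : 0 < lam) (η : Conf)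
    (y : ℝ) : landingLaw q lam η y Set.univ = 1 := by
  have h1 : landingLaw q lam η y Set.univ = landingLaw q lam η y (Set.Ioi y) := by
    rw [← Set.Iic_union_Ioi (a := y), measure_union (Set.Iic_disjoint_Ioi le_rfl) measurableSet_Ioi,
      landingLaw_Iic hq0 hlam.le, zero_add]
  rw [h1, ← iUnion_Ioo_right]
  have hmono : Monotone fun n : ℕ => Set.Ioo y (y + (n + 1)) := fun m n h =>
    Set.Ioo_subset_Ioo_right (by gcongr)
  have t1 := tendsto_measure_iUnion_atTop (μ := landingLaw q lam η y) hmono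
  have t2 : Tendsto (fun n : ℕ => ENNReal.ofReal (reach q lam η y (y + (n + 1)))) atTop (𝓝 0) :=
    tendsto_of_tendsto_of_tendsto_of_le_of_le tendsto_const_nhds (tendsto_exp_far hlam y)
      (fun _ => zero_le) fun n => ENNReal.ofReal_le_ofReal (reach_le_exp hq0 hq1 _ _ _ _)
  have t3 := t1.add t2
  have : ∀ n : ℕ, landingLaw q lam η y (Set.Ioo y (y + (n + 1)))
      + ENNReal.ofReal (reach q lam η y (y + (n + 1))) = 1 := fun n =>
    landingLaw_Ioo_add hq0 hq1 hlam.le η (by have := n.cast_nonneg (α := ℝ); linarith)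
  simp only [Function.comp_def, this, add_zero] at t3
  exact (tendsto_nhds_unique t3 tendsto_const_nhds)

theorem isProbabilityMeasure_landingLaw {q lam : ℝ} (hq0 : 0 ≤ q) (hq1 : q ≤ 1) (hlam : 0 < lam)
    (η : Conf) (y : ℝ) : IsProbabilityMeasure (landingLaw q lam η y) :=
  ⟨landingLaw_univ hq0 hq1 hlam η y⟩

theorem landingLaw_Ici {q lam : ℝ} (hq0 : 0 ≤ q) (hq1 : q ≤ 1) (hlam : 0 < lam) (η : Conf)
    {y x : ℝ} (hyx : y < x) :
    landingLaw q lam η y (Set.Ici x) = ENNReal.ofReal (reach q lam η y x) := by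
  have h1 := landingLaw_Ioo_add hq0 hq1 hlam.le η hyx
  have h2 := landingLaw_univ hq0 hq1 hlam η y
  have h3 : (Set.univ : Set ℝ) = Set.Iic y ∪ (Set.Ioo y x ∪ Set.Ici x) := by
    rw [Set.Ioo_union_Ici_eq_Ioi hyx, Set.Iic_union_Ioi]
  rw [h3, measure_union _ (measurableSet_Ioo.union measurableSet_Ici),
    measure_union _ measurableSet_Ici, landingLaw_Iic hq0 hlam.le, zero_add, ← h1] at h2
  · refine (ENNReal.add_right_inj ?_).1 h2
    exact ne_top_of_le_ne_top ENNReal.one_ne_top (h1 ▸ le_self_add)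
  · exact Set.disjoint_left.2 fun z h h' => (h.2.trans_le h').false
  · refine Set.disjoint_left.2 fun z h h' => ?_
    rcases h' with h' | h'
    · exact (h'.1.trans_le h).false
    · exact (hyx.trans_le (le_trans h' h)).false

/-- The total mass that `trap` weighted by the probability to reach `z` gives to `(-∞, z)`. -/
theorem lintegral_reach_Iio {q lam : ℝ} (hq0 : 0 ≤ q) (hq1 : q ≤ 1) (hlam : 0 < lam) (η : Conf)
    (z : ℝ) : ∫⁻ y in Set.Iio z, ENNReal.ofReal (reach q lam η y z) ∂trap q lam η = 1 := by
  have hU : ⋃ n : ℕ, Set.Ioo (z - (n + 1)) z = Set.Iio z := by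
    ext y
    simp only [Set.mem_iUnion, Set.mem_Ioo, Set.mem_Iio]
    constructor
    · rintro ⟨n, h⟩; exact h.2
    · intro h
      obtain ⟨n, hn⟩ := exists_nat_gt (z - y)
      exact ⟨n, by linarith, h⟩
  have hmono : Monotone fun n : ℕ => Set.Ioo (z - (n + 1)) z := fun m n h =>
    Set.Ioo_subset_Ioo_left (by gcongr)
  have hmeas : Measurable fun y => ENNReal.ofReal (reach q lam η y z) :=
    (measurable_reach q lam measurable_const measurable_id measurable_const).ennreal_ofReal
  have t1 := tendsto_measure_iUnion_atTop
    (μ := (trap q lam η).withDensity fun y => ENNReal.ofReal (reach q lam η y z)) hmono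
  rw [hU] at t1
  simp only [Function.comp_def, withDensity_apply _ measurableSet_Ioo,
    withDensity_apply _ measurableSet_Iio] at t1
  have t2 : Tendsto (fun n : ℕ => ENNReal.ofReal (reach q lam η (z - (n + 1)) z)) atTop (𝓝 0) := by
    refine tendsto_of_tendsto_of_tendsto_of_le_of_le tendsto_const_nhds (tendsto_exp_far hlam 0)
      (fun _ => zero_le) fun n => ENNReal.ofReal_le_ofReal
        ((reach_le_exp hq0 hq1 _ _ _ _).trans (le_of_eq ?_))
    congr 1; ring
  have t3 := t1.add t2
  have : ∀ n : ℕ, ∫⁻ y in Set.Ioo (z - (n + 1)) z, ENNReal.ofReal (reach q lam η y z) ∂trap q lam η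
      + ENNReal.ofReal (reach q lam η (z - (n + 1)) z) = 1 := fun n =>
    lintegral_reach_left hq0 hq1 hlam.le η (by have := n.cast_nonneg (α := ℝ); linarith)
  simp only [this, add_zero] at t3
  exact (tendsto_nhds_unique t3 tendsto_const_nhds)

/-! ### Locality and regeneration of the landing law -/

theorem Conf.num_congr {η ζ : Conf} {B : Set ℝ} (h : ∀ x ∈ B, η x = ζ x) : η.num B = ζ.num B :=
  finsum_mem_congr rfl h

theorem reach_congr {q lam : ℝ} {η ζ : Conf} {y z : ℝ} (h : ∀ x ∈ Set.Ioo y z, η x = ζ x) :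
    reach q lam η y z = reach q lam ζ y z := by
  unfold reach; rw [Conf.num_congr h]

theorem dep_restrict_congr {q : ℝ} {η ζ : Conf} {I : Set ℝ} (hI : MeasurableSet I)
    (h : ∀ x ∈ I, η x = ζ x) : (dep q η).restrict I = (dep q ζ).restrict I := by
  refine Measure.ext fun B hB => ?_
  rw [Measure.restrict_apply hB, Measure.restrict_apply hB,
    ← lintegral_indicator_one (hB.inter hI), ← lintegral_indicator_one (hB.inter hI),
    lintegral_dep, lintegral_dep]
  refine tsum_congr fun x => ?_
  by_cases hx : x ∈ I
  · rw [h x hx]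
  · simp [hx]

theorem trap_restrict_congr {q lam : ℝ} {η ζ : Conf} {I : Set ℝ} (hI : MeasurableSet I)
    (h : ∀ x ∈ I, η x = ζ x) : (trap q lam η).restrict I = (trap q lam ζ).restrict I := by
  rw [trap, trap, Measure.restrict_add, Measure.restrict_add, dep_restrict_congr hI h]

/-- Both `trap` near `z` and the probability to reach `z` involve only particles in `(y, z]`. These
lie in `J` together with `z` because `J` is a lower set. -/
theorem landingLaw_restrict_congr {q lam : ℝ} (hq0 : 0 ≤ q) (hlam : 0 ≤ lam) {η ζ : Conf} {y : ℝ}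
    {J : Set ℝ} (hJ : MeasurableSet J) (hlow : IsLowerSet J)
    (h : ∀ x ∈ J, y < x → η x = ζ x) :
    (landingLaw q lam η y).restrict J = (landingLaw q lam ζ y).restrict J := by
  refine Measure.ext fun B hB => ?_
  have hm : MeasurableSet (B ∩ J ∩ Set.Ioi y) := (hB.inter hJ).inter measurableSet_Ioi
  rw [Measure.restrict_apply hB, Measure.restrict_apply hB, landingLaw_apply hq0 hlam _ _ (hB.inter hJ),
    landingLaw_apply hq0 hlam _ _ (hB.inter hJ),
    trap_restrict_congr hm (η := η) (ζ := ζ) fun x hx => h x hx.1.2 hx.2]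
  refine setLIntegral_congr_fun hm fun z hz => ?_
  rw [reach_congr (η := η) (ζ := ζ) fun x hx => h x (hlow hx.2.le hz.1.2) hx.1]

theorem landingLaw_congr {q lam : ℝ} (hq0 : 0 ≤ q) (hlam : 0 ≤ lam) {η ζ : Conf} {y : ℝ}
    (h : ∀ x, y < x → η x = ζ x) : landingLaw q lam η y = landingLaw q lam ζ y := by
  simpa using landingLaw_restrict_congr hq0 hlam MeasurableSet.univ isLowerSet_univ
    fun x _ => h x

/-- The probability to fly from `y` beyond `X`. -/
def passProb (q lam : ℝ) (η : Conf) (y X : ℝ) : ℝ :=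
  Real.exp (-lam * (X - y)) * q ^ η.num (Set.Ioc y X)

theorem passProb_nonneg {q : ℝ} (hq0 : 0 ≤ q) (lam : ℝ) (η : Conf) (y X : ℝ) :
    0 ≤ passProb q lam η y X := by unfold passProb; positivity

theorem reach_eq_passProb_mul (q lam : ℝ) (η : Conf) {y X z : ℝ} (hy : y ≤ X) (hz : X < z) :
    reach q lam η y z = passProb q lam η y X * reach q lam η X z := by
  have h : η.num (Set.Ioo y z) = η.num (Set.Ioc y X) + η.num (Set.Ioo X z) := by
    have h1 := η.pts_Ioo y z
    rw [← Set.Ioc_union_Ioo_eq_Ioo hy hz, measure_union _ measurableSet_Ioo, Conf.pts_Ioo,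
      Conf.pts_Ioc, Set.Ioc_union_Ioo_eq_Ioo hy hz] at h1
    · exact_mod_cast h1.symm
    · exact Set.disjoint_left.2 fun w hw hw' => (hw.2.trans_lt hw'.1).false
  unfold reach passProb
  rw [h, pow_add, show -lam * (z - y) = -lam * (X - y) + -lam * (z - X) by ring, Real.exp_add]
  ring

/-- Lack of memory: the exponential and the power of `q` are both multiplicative, so a flight beyond
`X` restarts at `X`. The particles at `X` itself are charged to `passProb`. -/
theorem landingLaw_restrict_Ioi {q lam : ℝ} (hq0 : 0 ≤ q) (hlam : 0 ≤ lam) (η : Conf) {y X : ℝ}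
    (hy : y ≤ X) : (landingLaw q lam η y).restrict (Set.Ioi X) =
      ENNReal.ofReal (passProb q lam η y X) • landingLaw q lam η X := by
  refine Measure.ext fun B hB => ?_
  rw [Measure.restrict_apply hB, landingLaw_apply hq0 hlam _ _ (hB.inter measurableSet_Ioi),
    Measure.smul_apply, landingLaw_apply hq0 hlam _ _ hB, Set.inter_assoc,
    Set.inter_eq_left.2 (Set.Ioi_subset_Ioi hy), smul_eq_mul, ← lintegral_const_mul]
  · refine setLIntegral_congr_fun (hB.inter measurableSet_Ioi) fun z hz => ?_
    rw [reach_eq_passProb_mul q lam η hy hz.2, ENNReal.ofReal_mul (passProb_nonneg hq0 _ _ _ _)]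
  · exact (measurable_reach q lam measurable_const measurable_const measurable_id).ennreal_ofReal

theorem landingLaw_Ioi {q lam : ℝ} (hq0 : 0 ≤ q) (hq1 : q ≤ 1) (hlam : 0 < lam) (η : Conf)
    {y X : ℝ} (hy : y ≤ X) :
    landingLaw q lam η y (Set.Ioi X) = ENNReal.ofReal (passProb q lam η y X) := by
  have h := congrArg (fun m : Measure ℝ => m Set.univ) (landingLaw_restrict_Ioi hq0 hlam.le η hy)
  simpa [landingLaw_univ hq0 hq1 hlam] using h

/-- An exponential moment of the landing law, by comparison with the landing law for a smaller
parameter. -/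
theorem lintegral_exp_landingLaw_le {q lam kap : ℝ} (hq0 : 0 ≤ q) (hq1 : q ≤ 1) (hkap : 0 ≤ kap)
    (hlam : kap < lam) (η : Conf) (X : ℝ) :
    ∫⁻ z, ENNReal.ofReal (Real.exp (kap * (z - X))) ∂landingLaw q lam η X
      ≤ ENNReal.ofReal (lam / (lam - kap)) := by
  have hd : 0 < lam - kap := sub_pos.2 hlam
  have hl : 0 ≤ lam := hkap.trans hlam.le
  -- The exponential weight lowers the rate in the survival function from `lam` to `lam - kap`.
  have h1 : ∀ z, ENNReal.ofReal (reach q lam η X z) * ENNReal.ofReal (Real.exp (kap * (z - X)))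
      = ENNReal.ofReal (reach q (lam - kap) η X z) := by
    intro z
    rw [← ENNReal.ofReal_mul (reach_nonneg hq0 _ _ _ _)]
    congr 1
    unfold reach
    rw [mul_right_comm, ← Real.exp_add]
    congr 2; ring
  rw [lintegral_landingLaw hq0 hl]
  swap
  · exact (Real.measurable_exp.comp ((measurable_id.sub_const X).const_mul kap)).ennreal_ofReal
  simp_rw [h1]
  have h2 := landingLaw_univ hq0 hq1 hd η X
  rw [landingLaw_apply hq0 hd.le _ _ MeasurableSet.univ, Set.univ_inter,
    setLIntegral_trap _ _ _ measurableSet_Ioi] at h2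
  rw [setLIntegral_trap _ _ _ measurableSet_Ioi]
  have hge : (1 : ℝ) ≤ lam / (lam - kap) := by rw [le_div_iff₀ hd]; linarith
  -- The factor `lam / (lam - kap)` corrects the Lebesgue part of `trap` exactly. It is at least
  -- `1`, so it only enlarges the atomic part.
  calc _ ≤ ENNReal.ofReal (lam / (lam - kap)) * (ENNReal.ofReal (lam - kap) *
          (∫⁻ z in Set.Ioi X, ENNReal.ofReal (reach q (lam - kap) η X z))) +
        ENNReal.ofReal (lam / (lam - kap)) *
          ∫⁻ z in Set.Ioi X, ENNReal.ofReal (reach q (lam - kap) η X z) ∂dep q η := by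
        refine add_le_add (le_of_eq ?_) (le_mul_of_one_le_left zero_le (by simpa using hge))
        rw [← mul_assoc, ← ENNReal.ofReal_mul (by positivity), div_mul_cancel₀ _ hd.ne']
    _ = _ := by rw [← mul_add, h2, mul_one]

/-- Subtracting the constant value beyond `v` leaves an integral over `(-∞, v]`, where the two
landing laws coincide. -/
theorem integral_landingLaw_congr {q lam : ℝ} (hq0 : 0 ≤ q) (hq1 : q ≤ 1) (hlam : 0 < lam)
    {η ζ : Conf} {y v : ℝ} (hag : ∀ x ≤ v, y < x → η x = ζ x) {h : ℝ → ℝ} (hm : Measurable h)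
    {C : ℝ} (hC : ∀ z, |h z| ≤ C) {h₀ : ℝ} (hv : ∀ z, v < z → h z = h₀) :
    ∫ z, h z ∂landingLaw q lam η y = ∫ z, h z ∂landingLaw q lam ζ y := by
  have key : ∀ ω : Conf, ∫ z, h z ∂landingLaw q lam ω y =
      (∫ z in Set.Iic v, (h z - h₀) ∂landingLaw q lam ω y) + h₀ := by
    intro ω
    have := isProbabilityMeasure_landingLaw hq0 hq1 hlam ω y
    have hi : Integrable h (landingLaw q lam ω y) :=
      Integrable.of_bound hm.aestronglyMeasurable C (Eventually.of_forall hC)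
    rw [setIntegral_eq_integral_of_forall_compl_eq_zero, integral_sub hi (integrable_const _)]
    · simp
    · intro z hz
      rw [hv z (not_le.1 hz), sub_self]
  rw [key, key, landingLaw_restrict_congr hq0 hlam.le measurableSet_Iic (isLowerSet_Iic v) hag]

/-! ### The generator on configurations with a bounded number of particles -/

/-- The configurations of at most `n` particles. -/
def atMost (n : ℕ) : Set Conf := {η | η.pts Set.univ ≤ n}

theorem measurableSet_atMost (n : ℕ) : MeasurableSet (atMost n) := by
  have := Conf.measurable_pts_section (F := id) measurable_id (MeasurableSet.univ (α := Conf × ℝ))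
  exact this measurableSet_Iic

theorem atMost_mono {m n : ℕ} (h : m ≤ n) : atMost m ⊆ atMost n := fun η hη =>
  le_trans (show η.pts Set.univ ≤ m from hη) (by exact_mod_cast h)

theorem finite_support_of_mem_atMost {n : ℕ} {η : Conf} (h : η ∈ atMost n) :
    (Function.support η).Finite := by
  have h1 : η.pts Set.univ ≤ n := h
  rw [Conf.pts_apply _ MeasurableSet.univ] at h1
  simp only [Set.indicator_univ, Pi.one_apply, mul_one] at h1
  have h2 := ENNReal.finite_const_le_of_tsum_ne_top
    (ne_top_of_le_ne_top (ENNReal.natCast_ne_top n) h1) one_ne_zero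
  refine h2.subset fun x hx => ?_
  show (1 : ℝ≥0∞) ≤ (η x : ℝ≥0∞)
  exact_mod_cast Nat.one_le_iff_ne_zero.2 hx

theorem card_support_le {n : ℕ} {η : Conf} (h : η ∈ atMost n) :
    (finite_support_of_mem_atMost h).toFinset.card ≤ n := by
  have h1 : η.pts Set.univ ≤ n := h
  rw [Conf.pts_apply _ MeasurableSet.univ] at h1
  simp only [Set.indicator_univ, Pi.one_apply, mul_one] at h1
  have h2 := (ENNReal.sum_le_tsum (finite_support_of_mem_atMost h).toFinset).trans h1
  have h3 : ∑ x ∈ (finite_support_of_mem_atMost h).toFinset, η x ≤ n := by exact_mod_cast h2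
  refine le_trans ?_ h3
  rw [Finset.card_eq_sum_ones]
  refine Finset.sum_le_sum fun x hx => ?_
  exact Nat.one_le_iff_ne_zero.2 (by simpa using hx)

theorem move_mem_atMost {n : ℕ} {η : Conf} (h : η ∈ atMost n) {y : ℝ} (hy : η y ≠ 0) (z : ℝ) :
    η.move y z ∈ atMost n := by
  obtain ⟨ζ, rfl⟩ := Conf.exists_eq_add hy
  have h1 : (ζ.add y 1).pts Set.univ ≤ n := h
  show ((ζ.add y 1).move y z).pts Set.univ ≤ n
  rw [Conf.move_add_one]
  rw [Conf.pts_add _ _ _ MeasurableSet.univ] at h1 ⊢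
  simpa using h1

theorem restrict_mem_atMost (η : Conf) {B : Set ℝ} (hB : MeasurableSet B) {a b : ℝ}
    (hab : B ⊆ Set.Icc a b) : η.restrict B ∈ atMost (η.num B) := by
  show (η.restrict B).pts Set.univ ≤ _
  rw [Conf.pts_restrict _ hB MeasurableSet.univ, Set.univ_inter, Conf.pts_eq_num η hB hab]

theorem generator_eq_sum (q lam xi : ℝ) (g : Conf → ℝ) {η : Conf}
    (h : (Function.support η).Finite) : generator q lam xi g η =
      ∑ y ∈ h.toFinset, wakeRate q xi η y *
        ∫ z, (g (η.move y z) - g η) ∂landingLaw q lam η y := by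
  refine finsum_eq_sum_of_support_subset _ fun y hy => ?_
  simp only [Set.Finite.coe_toFinset, Function.mem_support] at hy ⊢
  intro h0
  exact hy (by simp [wakeRate, h0])

theorem wakeRate_nonneg {q xi : ℝ} (hq0 : 0 ≤ q) (hq1 : q ≤ 1) (hxi : 0 ≤ xi) (η : Conf) (y : ℝ) :
    0 ≤ wakeRate q xi η y := mul_nonneg hxi (sub_nonneg.2 (pow_le_one₀ hq0 hq1))

theorem wakeRate_le {q xi : ℝ} (hq0 : 0 ≤ q) (hxi : 0 ≤ xi) (η : Conf) (y : ℝ) :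
    wakeRate q xi η y ≤ xi :=
  mul_le_of_le_one_right hxi (by linarith [pow_nonneg hq0 (η y)])

theorem dep_eq_sum (q : ℝ) {η : Conf} (h : (Function.support η).Finite) :
    dep q η = ∑ y ∈ h.toFinset, ENNReal.ofReal (1 - q ^ η y) • Measure.dirac y := by
  refine Measure.ext fun B hB => ?_
  rw [← lintegral_indicator_one hB, lintegral_dep, tsum_eq_sum (s := h.toFinset)]
  · simp [Measure.dirac_apply' _ hB]
  · intro y hy
    have : η y = 0 := by simpa using hy
    simp [this]

/-- As an integral against `dep`, the sum over occupied locations depends on the configuration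
through kernels, which yields its measurability. -/
theorem generator_eq_integral {q lam xi : ℝ} (hq0 : 0 ≤ q) (hq1 : q ≤ 1) (g : Conf → ℝ) {η : Conf}
    (h : (Function.support η).Finite) : generator q lam xi g η =
      xi * ∫ y, (∫ z, (g (η.move y z) - g η) ∂landingLaw q lam η y) ∂dep q η := by
  rw [generator_eq_sum _ _ _ _ h, dep_eq_sum q h, integral_finsetSum_measure, Finset.mul_sum]
  · refine Finset.sum_congr rfl fun y _ => ?_
    rw [integral_smul_measure, integral_dirac, ENNReal.toReal_ofReal, wakeRate, smul_eq_mul,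
      mul_assoc]
    exact sub_nonneg.2 (pow_le_one₀ hq0 hq1)
  · intro y _
    exact (integrable_dirac enorm_lt_top).smul_measure ENNReal.ofReal_ne_top

/-- The generator on the configurations of at most `n` particles. -/
def truncGen (q lam xi : ℝ) (n : ℕ) (g : Conf → ℝ) : Conf → ℝ :=
  (atMost n).indicator (generator q lam xi g)

theorem measurable_truncGen {q lam : ℝ} (hq0 : 0 ≤ q) (hq1 : q ≤ 1) (hlam : 0 ≤ lam) (xi : ℝ)
    (n : ℕ) {g : Conf → ℝ} (hg : Measurable g) : Measurable (truncGen q lam xi n g) := by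
  have h1 : StronglyMeasurable fun p : (Conf × ℝ) × ℝ => g (p.1.1.move p.1.2 p.2) - g p.1.1 := by
    refine (Measurable.sub (hg.comp (Conf.measurable_move (measurable_fst.comp measurable_fst)
      (measurable_snd.comp measurable_fst) measurable_snd))
      (hg.comp (measurable_fst.comp measurable_fst))).stronglyMeasurable
  have h2 := h1.integral_kernel_prod_right' (κ := landKernel q lam)
  simp_rw [landKernel_apply hq0 hlam] at h2
  have h3 := h2.integral_kernel_prod_right' (κ := depKernel q)
  simp_rw [depKernel_apply] at h3
  have h4 : truncGen q lam xi n g = (atMost n).indicator fun η =>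
      xi * ∫ y, (∫ z, (g (η.move y z) - g η) ∂landingLaw q lam η y) ∂dep q η := by
    refine Set.indicator_congr fun η hη => ?_
    exact generator_eq_integral hq0 hq1 g (finite_support_of_mem_atMost hη)
  rw [h4]
  exact (h3.measurable.const_mul xi).indicator (measurableSet_atMost n)

theorem integrable_move {q lam : ℝ} (hq0 : 0 ≤ q) (hq1 : q ≤ 1) (hlam : 0 < lam) {g : Conf → ℝ}
    (hg : Measurable g) {C : ℝ} (hC : ∀ η, |g η| ≤ C) (η ζ : Conf) (y y' : ℝ) :
    Integrable (fun z => g (η.move y z)) (landingLaw q lam ζ y') := by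
  have := isProbabilityMeasure_landingLaw hq0 hq1 hlam ζ y'
  exact Integrable.of_bound (hg.comp (Conf.measurable_move measurable_const measurable_const
    measurable_id)).aestronglyMeasurable C (Eventually.of_forall fun z => hC _)

theorem abs_integral_move_le {q lam : ℝ} (hq0 : 0 ≤ q) (hq1 : q ≤ 1) (hlam : 0 < lam)
    {g : Conf → ℝ} {C : ℝ} (hC : ∀ η, |g η| ≤ C) (η : Conf) (y : ℝ) :
    |∫ z, g (η.move y z) ∂landingLaw q lam η y| ≤ C := by
  have := isProbabilityMeasure_landingLaw hq0 hq1 hlam η y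
  have := norm_integral_le_of_norm_le_const (μ := landingLaw q lam η y)
    (f := fun z => g (η.move y z)) (Eventually.of_forall fun z => hC _)
  simpa using this

theorem truncGen_eq_sum {q lam : ℝ} (hq0 : 0 ≤ q) (hq1 : q ≤ 1) (hlam : 0 < lam) (xi : ℝ) {n : ℕ}
    {g : Conf → ℝ} (hg : Measurable g) {C : ℝ} (hC : ∀ η, |g η| ≤ C) {η : Conf}
    (h : η ∈ atMost n) : truncGen q lam xi n g η =
      ∑ y ∈ (finite_support_of_mem_atMost h).toFinset, wakeRate q xi η y *
        (∫ z, g (η.move y z) ∂landingLaw q lam η y - g η) := by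
  rw [truncGen, Set.indicator_of_mem h, generator_eq_sum _ _ _ _ (finite_support_of_mem_atMost h)]
  refine Finset.sum_congr rfl fun y _ => ?_
  have := isProbabilityMeasure_landingLaw hq0 hq1 hlam η y
  rw [integral_sub (integrable_move hq0 hq1 hlam hg hC _ _ _ _) (integrable_const _)]
  simp

theorem sum_wakeRate_le {q xi : ℝ} (hq0 : 0 ≤ q) (hxi : 0 ≤ xi) {n : ℕ}
    {η : Conf} (h : η ∈ atMost n) :
    ∑ y ∈ (finite_support_of_mem_atMost h).toFinset, wakeRate q xi η y ≤ xi * n := by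
  calc _ ≤ ∑ y ∈ (finite_support_of_mem_atMost h).toFinset, xi :=
        Finset.sum_le_sum fun y _ => wakeRate_le hq0 hxi η y
    _ ≤ _ := by
        rw [Finset.sum_const, nsmul_eq_mul, mul_comm]
        have := card_support_le h
        gcongr

/-! ### Flux and influence bounds -/

/-- A telescoping sum: remove the leftmost location, which no other exponent counts. -/
theorem sum_trap_pow_eq (q : ℝ) (m : ℝ → ℕ) (S : Finset ℝ) :
    ∑ w ∈ S, (1 - q ^ m w) * q ^ (∑ x ∈ S with w < x, m x) = 1 - q ^ (∑ x ∈ S, m x) := by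
  induction S using Finset.induction_on_min with
  | empty => simp
  | insert w S hlt ih =>
    have hnot : w ∉ S := fun h => (hlt w h).false
    rw [Finset.sum_insert hnot, Finset.sum_insert hnot, Finset.filter_insert, if_neg (lt_irrefl w),
      Finset.filter_true_of_mem hlt]
    have : ∑ x ∈ S, (1 - q ^ m x) * q ^ (∑ x' ∈ insert w S with x < x', m x') =
        ∑ x ∈ S, (1 - q ^ m x) * q ^ (∑ x' ∈ S with x < x', m x') := by
      refine Finset.sum_congr rfl fun x hx => ?_
      rw [Finset.filter_insert, if_neg (hlt x hx).not_gt]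
    rw [this, ih, pow_add]
    ring

/-- The rate at which particles fly over a location is at most `xi`. -/
theorem sum_wakeRate_passProb_le {q lam xi : ℝ} (hq0 : 0 ≤ q) (hq1 : q ≤ 1) (hlam : 0 ≤ lam)
    (hxi : 0 ≤ xi) (η : Conf) (X : ℝ) (L : Finset ℝ) (hL : ∀ y, y ∈ L ↔ η y ≠ 0 ∧ y ≤ X) :
    ∑ y ∈ L, wakeRate q xi η y * passProb q lam η y X ≤ xi := by
  have h1 : ∀ y ∈ L, wakeRate q xi η y * passProb q lam η y X ≤
      xi * ((1 - q ^ η y) * q ^ (∑ x ∈ L with y < x, η x)) := by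
    intro y hy
    have h2 : η.num (Set.Ioc y X) = ∑ x ∈ L with y < x, η x :=
      η.num_eq_sum _ fun x => by simp only [Finset.mem_filter, hL, Set.mem_Ioc]; tauto
    rw [wakeRate, mul_assoc]
    refine mul_le_mul_of_nonneg_left (mul_le_mul_of_nonneg_left ?_
      (sub_nonneg.2 (pow_le_one₀ hq0 hq1))) hxi
    rw [passProb, h2]
    refine mul_le_of_le_one_left (by positivity) (Real.exp_le_one_iff.2 ?_)
    have := ((hL y).1 hy).2
    nlinarith
  refine (Finset.sum_le_sum h1).trans ?_
  rw [← Finset.mul_sum, sum_trap_pow_eq]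
  exact mul_le_of_le_one_right hxi (by linarith [pow_nonneg hq0 (∑ x ∈ L, η x)])

/-- A flight that stops before or at `X` contributes `1`. One that passes `X` restarts there and
contributes the exponential moment bound for `kap = lam / 2`, which is `lam / (lam - lam / 2) = 2`.
-/
theorem lintegral_exp_max_landingLaw_le {q lam : ℝ} (hq0 : 0 ≤ q) (hq1 : q ≤ 1) (hlam : 0 < lam)
    (η : Conf) {y X : ℝ} (hy : y ≤ X) :
    ∫⁻ z, ENNReal.ofReal (Real.exp (lam / 2 * (max X z - X))) ∂landingLaw q lam η y
      ≤ ENNReal.ofReal (1 + passProb q lam η y X) := by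
  have hp := passProb_nonneg hq0 lam η y X
  have h1 : ∫⁻ z in Set.Iic X, ENNReal.ofReal (Real.exp (lam / 2 * (max X z - X)))
      ∂landingLaw q lam η y = landingLaw q lam η y (Set.Iic X) := by
    rw [← setLIntegral_one]
    refine setLIntegral_congr_fun measurableSet_Iic fun z hz => ?_
    rw [max_eq_left hz]; simp
  have h2 : ∫⁻ z in Set.Ioi X, ENNReal.ofReal (Real.exp (lam / 2 * (max X z - X)))
      ∂landingLaw q lam η y ≤ ENNReal.ofReal (passProb q lam η y X) * ENNReal.ofReal 2 := by
    rw [setLIntegral_congr_fun (g := fun z => ENNReal.ofReal (Real.exp (lam / 2 * (z - X))))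
      measurableSet_Ioi fun z (hz : X < z) => by rw [max_eq_right hz.le]]
    rw [landingLaw_restrict_Ioi hq0 hlam.le η hy, lintegral_smul_measure, smul_eq_mul]
    refine mul_le_mul_right ((lintegral_exp_landingLaw_le hq0 hq1 (by positivity)
      (half_lt_self hlam) η X).trans (le_of_eq ?_)) _
    congr 1; field_simp; norm_num
  have h3 := landingLaw_univ hq0 hq1 hlam η y
  rw [← Set.Iic_union_Ioi (a := X), measure_union (Set.Iic_disjoint_Ioi le_rfl) measurableSet_Ioi,
    landingLaw_Ioi hq0 hq1 hlam η hy] at h3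
  rw [← lintegral_add_compl _ (measurableSet_Iic (a := X)), h1, Set.compl_Iic]
  refine (add_le_add_right h2 _).trans ?_
  rw [ENNReal.ofReal_ofNat, mul_two, ← add_assoc, h3, ENNReal.ofReal_add zero_le_one hp,
    ENNReal.ofReal_one]

/-- Changing a configuration on `(-∞, X]` changes `g` by at most `A * exp (lam / 2 * X)`. -/
def HasInfluence (lam A : ℝ) (n : ℕ) (g : Conf → ℝ) : Prop :=
  ∀ (X : ℝ) (η ζ : Conf), η ∈ atMost n → ζ ∈ atMost n → (∀ x, X < x → η x = ζ x) →
    |g η - g ζ| ≤ A * Real.exp (lam / 2 * X)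

/-- `g` does not depend on the particles to the right of `v`. -/
def IsLeftLocal (v : ℝ) (n : ℕ) (g : Conf → ℝ) : Prop :=
  ∀ η ζ : Conf, η ∈ atMost n → ζ ∈ atMost n → (∀ x ≤ v, η x = ζ x) → g η = g ζ

/-- After a jump to `z` that is made in `η` only, the two configurations still agree beyond `max X
z`. The influence bound there is averaged over the overshoot. -/
theorem abs_integral_move_sub_le {q lam : ℝ} (hq0 : 0 ≤ q) (hq1 : q ≤ 1) (hlam : 0 < lam)
    {n : ℕ} {g : Conf → ℝ} (hg : Measurable g) {C : ℝ} (hC : ∀ η, |g η| ≤ C) {A : ℝ} (hA : 0 ≤ A)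
    (hI : HasInfluence lam A n g) {η ζ : Conf} (hη : η ∈ atMost n) (hζ : ζ ∈ atMost n) {X y : ℝ}
    (hX : ∀ x, X < x → η x = ζ x) (hy : y ≤ X) (hy0 : η y ≠ 0) :
    |∫ z, g (η.move y z) ∂landingLaw q lam η y - g ζ| ≤
      A * Real.exp (lam / 2 * X) * (1 + passProb q lam η y X) := by
  classical
  have := isProbabilityMeasure_landingLaw hq0 hq1 hlam η y
  have hp := passProb_nonneg hq0 lam η y X
  have h1 : ∫ z, g (η.move y z) ∂landingLaw q lam η y - g ζ =
      ∫ z, (g (η.move y z) - g ζ) ∂landingLaw q lam η y := by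
    rw [integral_sub (integrable_move hq0 hq1 hlam hg hC _ _ _ _) (integrable_const _)]
    simp
  have h2 : ∀ z, |g (η.move y z) - g ζ| ≤
      A * Real.exp (lam / 2 * X) * Real.exp (lam / 2 * (max X z - X)) := by
    intro z
    rw [mul_assoc, ← Real.exp_add, ← mul_add, add_sub_cancel]
    refine hI _ _ _ (move_mem_atMost hη hy0 z) hζ fun x hx => ?_
    rw [Conf.move_apply, if_neg (hy.trans_lt ((le_max_left _ _).trans_lt hx)).ne',
      if_neg ((le_max_right _ _).trans_lt hx).ne', hX x ((le_max_left _ _).trans_lt hx)]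
    rfl
  have h3 : ‖∫ z, (g (η.move y z) - g ζ) ∂landingLaw q lam η y‖ₑ ≤
      ENNReal.ofReal (A * Real.exp (lam / 2 * X) * (1 + passProb q lam η y X)) := by
    refine (enorm_integral_le_lintegral_enorm _).trans ?_
    rw [ENNReal.ofReal_mul (by positivity)]
    refine le_trans ?_ (mul_le_mul_right (lintegral_exp_max_landingLaw_le hq0 hq1 hlam η hy) _)
    rw [← lintegral_const_mul]
    · refine lintegral_mono fun z => ?_
      rw [← ENNReal.ofReal_mul (by positivity), Real.enorm_eq_ofReal_abs]
      exact ENNReal.ofReal_le_ofReal (h2 z)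
    · exact (Real.measurable_exp.comp (((measurable_const.max measurable_id).sub_const X).const_mul
        _)).ennreal_ofReal
  rw [Real.enorm_eq_ofReal_abs, ENNReal.ofReal_le_ofReal_iff (by positivity)] at h3
  rwa [h1]

/-- A particle to the right of `X` sees the same configuration ahead in both systems. It can take
the same jump in both, which leaves the region of agreement unchanged. -/
theorem abs_integral_move_sub_move_le {q lam : ℝ} (hq0 : 0 ≤ q) (hq1 : q ≤ 1) (hlam : 0 < lam)
    {n : ℕ} {g : Conf → ℝ} (hg : Measurable g) {C : ℝ} (hC : ∀ η, |g η| ≤ C) {A : ℝ}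
    (hI : HasInfluence lam A n g) {η ζ : Conf} (hη : η ∈ atMost n) (hζ : ζ ∈ atMost n) {X y : ℝ}
    (hX : ∀ x, X < x → η x = ζ x) (hy : X < y) (hy0 : η y ≠ 0) :
    |∫ z, g (η.move y z) ∂landingLaw q lam η y - ∫ z, g (ζ.move y z) ∂landingLaw q lam ζ y| ≤
      A * Real.exp (lam / 2 * X) := by
  classical
  have hl : landingLaw q lam ζ y = landingLaw q lam η y :=
    landingLaw_congr hq0 hlam.le fun x hx => (hX x (hy.trans hx)).symm
  have := isProbabilityMeasure_landingLaw hq0 hq1 hlam η y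
  rw [hl, ← integral_sub (integrable_move hq0 hq1 hlam hg hC _ _ _ _)
    (integrable_move hq0 hq1 hlam hg hC _ _ _ _)]
  have := norm_integral_le_of_norm_le_const (μ := landingLaw q lam η y)
    (f := fun z => g (η.move y z) - g (ζ.move y z)) (C := A * Real.exp (lam / 2 * X))
    (Eventually.of_forall fun z => hI X _ _ (move_mem_atMost hη hy0 z)
      (move_mem_atMost hζ (hX y hy ▸ hy0) z) fun x hx => by
        simp only [Conf.move_apply]
        rw [hX x hx])
  simpa using this

/-- One step of the uniformized chain of rate `K`. -/
def uniStep (q lam xi K : ℝ) (n : ℕ) (g : Conf → ℝ) (η : Conf) : ℝ :=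
  g η + K⁻¹ * truncGen q lam xi n g η

/-! ### One uniformized step: contraction, influence and locality -/

section step

variable {q lam xi K : ℝ} (hq0 : 0 ≤ q) (hq1 : q ≤ 1) (hlam : 0 < lam) (hxi : 0 ≤ xi) {n : ℕ}
  (hK0 : 0 < K) (hK : 2 * (xi * n) ≤ K) {g : Conf → ℝ} (hg : Measurable g) {C : ℝ}
  (hC : ∀ η, |g η| ≤ C)

include hq0 hq1 hlam hxi hg hC

theorem abs_truncGen_le (η : Conf) : |truncGen q lam xi n g η| ≤ 2 * (xi * n) * C := by
  have hC0 : 0 ≤ C := (abs_nonneg _).trans (hC η)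
  by_cases h : η ∈ atMost n
  · rw [truncGen_eq_sum hq0 hq1 hlam xi hg hC h]
    refine (Finset.abs_sum_le_sum_abs _ _).trans ?_
    calc _ ≤ ∑ y ∈ (finite_support_of_mem_atMost h).toFinset, wakeRate q xi η y * (2 * C) := by
          refine Finset.sum_le_sum fun y _ => ?_
          have hw := wakeRate_nonneg hq0 hq1 hxi η y
          rw [abs_mul, abs_of_nonneg hw]
          refine mul_le_mul_of_nonneg_left ?_ hw
          have h1 := abs_integral_move_le hq0 hq1 hlam hC η y
          have h2 := hC η
          rw [abs_le] at *
          constructor <;> linarith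
      _ ≤ _ := by
          rw [← Finset.sum_mul]
          have := sum_wakeRate_le hq0 hxi h
          nlinarith
  · rw [truncGen, Set.indicator_of_notMem h, abs_zero]
    positivity

include hK0 hK

/-- The total jump rate is at most `xi * n ≤ K`, so a step is an average: stay with weight `1 - R /
K`, otherwise jump. The factor `2` in `hK` is for the coupling below, which needs room for the rates
of two configurations. -/
theorem abs_uniStep_le (η : Conf) : |uniStep q lam xi K n g η| ≤ C := by
  by_cases h : η ∈ atMost n
  · set S := (finite_support_of_mem_atMost h).toFinset
    set R := ∑ y ∈ S, wakeRate q xi η y with hR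
    have hR1 : R ≤ xi * n := sum_wakeRate_le hq0 hxi h
    have hR0 : 0 ≤ R := Finset.sum_nonneg fun y _ => wakeRate_nonneg hq0 hq1 hxi η y
    have e : uniStep q lam xi K n g η = K⁻¹ * ((K - R) * g η +
        ∑ y ∈ S, wakeRate q xi η y * ∫ z, g (η.move y z) ∂landingLaw q lam η y) := by
      rw [uniStep, truncGen_eq_sum hq0 hq1 hlam xi hg hC h]
      simp_rw [mul_sub, Finset.sum_sub_distrib, ← Finset.sum_mul]
      rw [← hR]
      field_simp
      ring
    rw [e, abs_mul, abs_of_pos (inv_pos.2 hK0), inv_mul_le_iff₀ hK0]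
    refine (abs_add_le _ _).trans ?_
    have hKR : 0 ≤ K - R := by linarith
    have h1 : |(K - R) * g η| ≤ (K - R) * C := by
      rw [abs_mul, abs_of_nonneg hKR]
      exact mul_le_mul_of_nonneg_left (hC η) hKR
    have h2 : |∑ y ∈ S, wakeRate q xi η y * ∫ z, g (η.move y z) ∂landingLaw q lam η y| ≤ R * C := by
      refine (Finset.abs_sum_le_sum_abs _ _).trans ?_
      rw [hR, Finset.sum_mul]
      refine Finset.sum_le_sum fun y _ => ?_
      have hw := wakeRate_nonneg hq0 hq1 hxi η y
      rw [abs_mul, abs_of_nonneg hw]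
      exact mul_le_mul_of_nonneg_left (abs_integral_move_le hq0 hq1 hlam hC η y) hw
    linarith
  · simp only [uniStep, truncGen, Set.indicator_of_notMem h, mul_zero, add_zero]
    exact hC η

/-- A coupling of two chains: particles right of `X` jump together, the others one configuration at
a time. All weights sum to `K` and each outcome costs at most `H`, apart from crossings of `X`.
These add at most `xi * H` per configuration by the flux bound, hence the factor `1 + 2 * xi / K`,
with no dependence on `n`. -/
theorem hasInfluence_uniStep {A : ℝ} (hA : 0 ≤ A) (hI : HasInfluence lam A n g) :
    HasInfluence lam (A * (1 + 2 * xi / K)) n (uniStep q lam xi K n g) := by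
  intro X η ζ hη hζ hX
  set S := (finite_support_of_mem_atMost hη).toFinset with hS
  set S' := (finite_support_of_mem_atMost hζ).toFinset with hS'
  set H := A * Real.exp (lam / 2 * X) with hH
  have hH0 : 0 ≤ H := by positivity
  set a : ℝ → ℝ := fun y => ∫ z, g (η.move y z) ∂landingLaw q lam η y
  set b : ℝ → ℝ := fun y => ∫ z, g (ζ.move y z) ∂landingLaw q lam ζ y
  set w := wakeRate q xi η with hw
  set w' := wakeRate q xi ζ with hw'
  have hw0 : ∀ y, 0 ≤ w y := wakeRate_nonneg hq0 hq1 hxi η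
  have hw'0 : ∀ y, 0 ≤ w' y := wakeRate_nonneg hq0 hq1 hxi ζ
  have hSm : ∀ y, y ∈ S ↔ η y ≠ 0 := fun y => by simp [hS]
  have hS'm : ∀ y, y ∈ S' ↔ ζ y ≠ 0 := fun y => by simp [hS']
  -- `c` collects the common particles beyond `X`; `L` and `L'` collect the locations up to `X` in
  -- the two configurations.
  set c := S.filter (X < ·) with hc
  set L := S.filter (fun y => ¬ X < y) with hL
  set L' := S'.filter (fun y => ¬ X < y) with hL'
  have hcc : S'.filter (X < ·) = c := by
    ext y
    simp only [hc, Finset.mem_filter, hSm, hS'm]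
    constructor <;> rintro ⟨h1, h2⟩ <;> refine ⟨?_, h2⟩
    · rwa [hX y h2]
    · rwa [← hX y h2]
  have hww : ∀ y ∈ c, w' y = w y := fun y hy => by
    simp only [hw, hw', wakeRate, hX y (Finset.mem_filter.1 hy).2]
  set D := g η - g ζ with hD
  have hDH : |D| ≤ H := hI X η ζ hη hζ hX
  -- The coupling written out: the four terms are no jump, a common jump, a jump in `η` only and a
  -- jump in `ζ` only.
  have e1 : uniStep q lam xi K n g η - uniStep q lam xi K n g ζ = K⁻¹ *
      ((K - (∑ y ∈ c, w y + ∑ y ∈ L, w y + ∑ y ∈ L', w' y)) * D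
        + ∑ y ∈ c, w y * (a y - b y) + ∑ y ∈ L, w y * (a y - g ζ)
        + ∑ y ∈ L', w' y * (g η - b y)) := by
    have s1 : ∑ y ∈ S, w y * (a y - g η) = ∑ y ∈ c, w y * (a y - g η)
        + ∑ y ∈ L, w y * (a y - g η) := (Finset.sum_filter_add_sum_filter_not _ _ _).symm
    have s2 : ∑ y ∈ S', w' y * (b y - g ζ) = ∑ y ∈ c, w y * (b y - g ζ)
        + ∑ y ∈ L', w' y * (b y - g ζ) := by
      rw [← Finset.sum_filter_add_sum_filter_not S' (X < ·), hcc]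
      congr 1
      exact Finset.sum_congr rfl fun y hy => by rw [hww y hy]
    simp only [uniStep]
    rw [truncGen_eq_sum hq0 hq1 hlam xi hg hC hη, truncGen_eq_sum hq0 hq1 hlam xi hg hC hζ]
    change g η + K⁻¹ * ∑ y ∈ S, w y * (a y - g η) - (g ζ + K⁻¹ * ∑ y ∈ S', w' y * (b y - g ζ)) = _
    rw [s1, s2]
    simp only [mul_sub, Finset.sum_sub_distrib, ← Finset.sum_mul]
    field_simp
    ring
  have hR1 : ∑ y ∈ c, w y + ∑ y ∈ L, w y ≤ xi * n := by
    rw [Finset.sum_filter_add_sum_filter_not]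
    exact sum_wakeRate_le hq0 hxi hη
  have hR2 : ∑ y ∈ L', w' y ≤ xi * n :=
    (Finset.sum_le_sum_of_subset_of_nonneg (Finset.filter_subset _ _) fun y _ _ => hw'0 y).trans
      (sum_wakeRate_le hq0 hxi hζ)
  have b0 : |(K - (∑ y ∈ c, w y + ∑ y ∈ L, w y + ∑ y ∈ L', w' y)) * D| ≤
      (K - (∑ y ∈ c, w y + ∑ y ∈ L, w y + ∑ y ∈ L', w' y)) * H := by
    have : 0 ≤ K - (∑ y ∈ c, w y + ∑ y ∈ L, w y + ∑ y ∈ L', w' y) := by linarith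
    rw [abs_mul, abs_of_nonneg this]
    exact mul_le_mul_of_nonneg_left hDH this
  have b1 : |∑ y ∈ c, w y * (a y - b y)| ≤ (∑ y ∈ c, w y) * H := by
    refine (Finset.abs_sum_le_sum_abs _ _).trans ?_
    rw [Finset.sum_mul]
    refine Finset.sum_le_sum fun y hy => ?_
    rw [abs_mul, abs_of_nonneg (hw0 y)]
    have hy' := Finset.mem_filter.1 hy
    exact mul_le_mul_of_nonneg_left (abs_integral_move_sub_move_le hq0 hq1 hlam hg hC hI hη hζ hX
      hy'.2 ((hSm y).1 hy'.1)) (hw0 y)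
  -- The first summand is the cost without a crossing; the second bounds the extra cost of the
  -- overshoot through the flux over `X`.
  have b2 : |∑ y ∈ L, w y * (a y - g ζ)| ≤ (∑ y ∈ L, w y) * H + xi * H := by
    have hflux := sum_wakeRate_passProb_le (lam := lam) hq0 hq1 hlam.le hxi η X L
      fun y => by simp only [hL, Finset.mem_filter, hSm, not_lt]
    refine (Finset.abs_sum_le_sum_abs _ _).trans ?_
    refine le_trans ?_ (add_le_add_right (mul_le_mul_of_nonneg_right hflux hH0) _)
    rw [Finset.sum_mul, Finset.sum_mul, ← Finset.sum_add_distrib]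
    refine Finset.sum_le_sum fun y hy => ?_
    rw [abs_mul, abs_of_nonneg (hw0 y)]
    have hy' := Finset.mem_filter.1 hy
    have := mul_le_mul_of_nonneg_left (abs_integral_move_sub_le hq0 hq1 hlam hg hC hA hI hη hζ hX
      (not_lt.1 hy'.2) ((hSm y).1 hy'.1)) (hw0 y)
    refine this.trans (le_of_eq ?_)
    simp only [hw, hH]; ring
  have b3 : |∑ y ∈ L', w' y * (g η - b y)| ≤ (∑ y ∈ L', w' y) * H + xi * H := by
    have hflux := sum_wakeRate_passProb_le (lam := lam) hq0 hq1 hlam.le hxi ζ X L'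
      fun y => by simp only [hL', Finset.mem_filter, hS'm, not_lt]
    refine (Finset.abs_sum_le_sum_abs _ _).trans ?_
    refine le_trans ?_ (add_le_add_right (mul_le_mul_of_nonneg_right hflux hH0) _)
    rw [Finset.sum_mul, Finset.sum_mul, ← Finset.sum_add_distrib]
    refine Finset.sum_le_sum fun y hy => ?_
    rw [abs_mul, abs_of_nonneg (hw'0 y), abs_sub_comm]
    have hy' := Finset.mem_filter.1 hy
    have := mul_le_mul_of_nonneg_left (abs_integral_move_sub_le hq0 hq1 hlam hg hC hA hI hζ hη
      (fun x hx => (hX x hx).symm) (not_lt.1 hy'.2) ((hS'm y).1 hy'.1)) (hw'0 y)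
    refine this.trans (le_of_eq ?_)
    simp only [hw', hH]; ring
  rw [e1, abs_mul, abs_of_pos (inv_pos.2 hK0), inv_mul_le_iff₀ hK0]
  refine ((abs_add_le _ _).trans (add_le_add ((abs_add_le _ _).trans (add_le_add
    ((abs_add_le _ _).trans (add_le_add b0 b1)) b2)) b3)).trans (le_of_eq ?_)
  rw [hH]
  field_simp
  ring

-- Jumps go to the right, so a particle beyond `v` does not alter the configuration on `(-∞, v]`.
-- For a particle at `y ≤ v`, landing points up to `v` have a law determined by the configuration
-- there, and all landing points beyond `v` are equivalent.
omit hxi hK0 hK in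
theorem isLeftLocal_truncGen {v : ℝ} (hv : IsLeftLocal v n g) :
    IsLeftLocal v n (truncGen q lam xi n g) := by
  classical
  intro η ζ hη hζ hag
  have hzero : ∀ (ω : Conf) (hω : ω ∈ atMost n), ∀ y, v < y → ω y ≠ 0 →
      ∫ z, g (ω.move y z) ∂landingLaw q lam ω y - g ω = 0 := by
    intro ω hω y hy hy0
    have := isProbabilityMeasure_landingLaw hq0 hq1 hlam ω y
    have hae : ∀ᵐ z ∂landingLaw q lam ω y, g (ω.move y z) = g ω := by
      have h0 := landingLaw_Iic hq0 hlam.le ω y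
      filter_upwards [measure_eq_zero_iff_ae_notMem.1 h0] with z hz
      have hz' : y < z := not_le.1 hz
      refine hv _ _ (move_mem_atMost hω hy0 z) hω fun x hx => ?_
      rw [Conf.move_apply, if_neg (hx.trans_lt hy).ne, if_neg (hx.trans_lt (hy.trans hz')).ne]
      rfl
    rw [integral_congr_ae hae]
    simp
  have hred : ∀ (ω : Conf) (hω : ω ∈ atMost n), truncGen q lam xi n g ω =
      ∑ y ∈ (finite_support_of_mem_atMost hω).toFinset with y ≤ v, wakeRate q xi ω y *
        (∫ z, g (ω.move y z) ∂landingLaw q lam ω y - g ω) := by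
    intro ω hω
    rw [truncGen_eq_sum hq0 hq1 hlam xi hg hC hω, Finset.sum_filter]
    refine Finset.sum_congr rfl fun y hy => ?_
    split_ifs with h
    · rfl
    · rw [hzero ω hω y (not_le.1 h) (by simpa using hy), mul_zero]
  rw [hred η hη, hred ζ hζ]
  refine Finset.sum_congr ?_ fun y hy => ?_
  · ext y
    simp only [Finset.mem_filter, Set.Finite.mem_toFinset, Function.mem_support]
    constructor <;> rintro ⟨h1, h2⟩ <;> refine ⟨?_, h2⟩
    · rwa [← hag y h2]
    · rwa [hag y h2]
  · simp only [Finset.mem_filter, Set.Finite.mem_toFinset, Function.mem_support] at hy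
    have hηy : η y ≠ 0 := (hag y hy.2).symm ▸ hy.1
    have h1 : ∀ z, g (η.move y z) = g (ζ.move y z) := fun z =>
      hv _ _ (move_mem_atMost hη hηy z) (move_mem_atMost hζ hy.1 z) fun x hx => by
        simp only [Conf.move_apply]; rw [hag x hx]
    rw [hv η ζ hη hζ hag, wakeRate, wakeRate, hag y hy.2]
    simp_rw [h1]
    congr 2
    -- The point `v + 1` merely represents all landing points beyond `v`.
    refine integral_landingLaw_congr hq0 hq1 hlam (v := v) (fun x hx _ => hag x hx)
      (hg.comp (Conf.measurable_move measurable_const measurable_const measurable_id))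
      (fun z => hC _) (h₀ := g (ζ.move y (v + 1))) fun z hz => ?_
    refine hv _ _ (move_mem_atMost hζ hy.1 z) (move_mem_atMost hζ hy.1 _) fun x hx => ?_
    simp only [Conf.move_apply]
    rw [if_neg (hx.trans_lt hz).ne, if_neg (by linarith : x ≠ v + 1)]

end step

/-! ### The semigroup -/

theorem summable_pow_div_factorial_mul {A C : ℝ} (t : ℝ) {a : ℕ → ℝ} (ha : ∀ k, |a k| ≤ A ^ k * C) :
    Summable fun k : ℕ => |t ^ k / (k.factorial : ℝ) * a k| := by
  refine Summable.of_nonneg_of_le (fun _ => abs_nonneg _) (fun k => ?_)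
    ((Real.summable_pow_div_factorial (|t| * A)).mul_right C)
  rw [abs_mul, abs_div, abs_pow, Nat.abs_cast, mul_pow]
  calc _ ≤ |t| ^ k / (k.factorial : ℝ) * (A ^ k * C) := by
        gcongr; exact ha k
    _ = _ := by ring

/-- This is `exp (t L) = exp (-t K) exp (t K (1 + L / K))`, evaluated at a point: the Cauchy product
with the exponential series produces the binomial coefficients. The growth bound on `a` gives
absolute convergence. -/
theorem tsum_uniformize {A C K : ℝ} (hK : 0 < K) (t : ℝ) {a b : ℕ → ℝ}
    (ha : ∀ k, |a k| ≤ A ^ k * C)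
    (hb : ∀ m, b m = ∑ k ∈ Finset.range (m + 1), (m.choose k : ℝ) * (K⁻¹) ^ k * a k) :
    ∑' k : ℕ, t ^ k / (k.factorial : ℝ) * a k =
      Real.exp (-(t * K)) * ∑' m : ℕ, (t * K) ^ m / (m.factorial : ℝ) * b m := by
  have h1 := summable_pow_div_factorial_mul t ha
  have h2 : Summable fun l : ℕ => ‖(t * K) ^ l / (l.factorial : ℝ)‖ :=
    (Real.summable_pow_div_factorial (t * K)).norm
  have h3 := tsum_mul_tsum_eq_tsum_sum_antidiagonal_of_summable_norm
    (f := fun k : ℕ => t ^ k / (k.factorial : ℝ) * a k)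
    (g := fun l : ℕ => (t * K) ^ l / (l.factorial : ℝ)) h1 h2
  have h4 : ∑' l : ℕ, (t * K) ^ l / (l.factorial : ℝ) = Real.exp (t * K) := by
    rw [Real.exp_eq_exp_ℝ, NormedSpace.exp_eq_tsum_div]
  rw [h4] at h3
  have h5 : ∀ m : ℕ, ∑ p ∈ Finset.HasAntidiagonal.antidiagonal m, t ^ p.1 / (p.1.factorial : ℝ) * a p.1 *
      ((t * K) ^ p.2 / (p.2.factorial : ℝ)) = (t * K) ^ m / (m.factorial : ℝ) * b m := by
    intro m
    rw [hb, Finset.Nat.sum_antidiagonal_eq_sum_range_succ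
      (fun i j => t ^ i / (i.factorial : ℝ) * a i * ((t * K) ^ j / (j.factorial : ℝ))),
      Finset.mul_sum]
    refine Finset.sum_congr rfl fun k hk => ?_
    have hkm : k ≤ m := Nat.lt_succ_iff.1 (Finset.mem_range.1 hk)
    rw [Nat.cast_choose ℝ hkm]
    have f1 := Nat.factorial_ne_zero k
    have f2 := Nat.factorial_ne_zero m
    have f3 := Nat.factorial_ne_zero (m - k)
    have e : (t * K) ^ m = t ^ k * K ^ k * (t * K) ^ (m - k) := by
      rw [← mul_pow, ← pow_add, Nat.add_sub_cancel' hkm]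
    rw [e, inv_pow]
    field_simp
  simp_rw [h5] at h3
  rw [← h3, mul_comm (∑' k : ℕ, _), ← mul_assoc, ← Real.exp_add]
  simp

/-- The left side averages `b` over a Poisson number of mean `s`, and the generating function of
that number at `r` is `exp (s * (r - 1))`. -/
theorem abs_exp_mul_tsum_le {s B r : ℝ} (hs : 0 ≤ s) {b : ℕ → ℝ} (hb : ∀ m, |b m| ≤ r ^ m * B) :
    |Real.exp (-s) * ∑' m : ℕ, s ^ m / (m.factorial : ℝ) * b m| ≤ B * Real.exp (s * r - s) := by
  have h1 := summable_pow_div_factorial_mul s hb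
  rw [abs_mul, abs_of_pos (Real.exp_pos _), Real.exp_sub]
  have h2 : |∑' m : ℕ, s ^ m / (m.factorial : ℝ) * b m| ≤ Real.exp (s * r) * B := by
    have h3 := norm_tsum_le_tsum_norm (f := fun m : ℕ => s ^ m / (m.factorial : ℝ) * b m)
      h1
    refine h3.trans ?_
    rw [Real.exp_eq_exp_ℝ, NormedSpace.exp_eq_tsum_div, ← tsum_mul_right]
    refine Summable.tsum_le_tsum (fun m => ?_) h1
      ((Real.summable_pow_div_factorial (s * r)).mul_right B)
    rw [Real.norm_eq_abs, abs_mul, abs_of_nonneg (by positivity), mul_pow]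
    calc _ ≤ s ^ m / (m.factorial : ℝ) * (r ^ m * B) := by gcongr; exact hb m
      _ = _ := by ring
  calc _ ≤ Real.exp (-s) * (Real.exp (s * r) * B) := by gcongr
    _ = _ := by rw [Real.exp_neg]; ring

theorem hasDerivAt_tsum_pow_div_factorial {A C : ℝ} {a : ℕ → ℝ}
    (ha : ∀ k, |a k| ≤ A ^ k * C) (t : ℝ) :
    HasDerivAt (fun t => ∑' k : ℕ, t ^ k / (k.factorial : ℝ) * a k)
      (∑' k : ℕ, t ^ k / (k.factorial : ℝ) * a (k + 1)) t := by
  -- Termwise differentiation takes place on the ball of radius `T`, which contains both `0` and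
  -- `t`.
  set T := |t| + 1 with hT
  have hT0 : 0 ≤ T := by positivity
  set g' : ℕ → ℝ → ℝ := fun k s => k * s ^ (k - 1) / (k.factorial : ℝ) * a k with hg'
  set u : ℕ → ℝ := fun k => k * T ^ (k - 1) / (k.factorial : ℝ) * (A ^ k * C) with hu
  have hsucc : ∀ (k : ℕ) (s x : ℝ), ((k + 1 : ℕ) : ℝ) * s ^ (k + 1 - 1) / ((k + 1).factorial : ℝ) * x
      = s ^ k / (k.factorial : ℝ) * x := by
    intro k s x
    rw [Nat.factorial_succ, Nat.add_sub_cancel]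
    have := Nat.factorial_ne_zero k
    have h2 : ((k + 1 : ℕ) : ℝ) ≠ 0 := by positivity
    push_cast at *
    field_simp
  have hus : Summable u := by
    rw [← summable_nat_add_iff 1]
    have := (Real.summable_pow_div_factorial (T * A)).mul_right (A * C)
    refine this.congr fun k => ?_
    rw [hu]
    dsimp only
    rw [hsucc, mul_pow, pow_succ]
    ring
  have key := hasDerivAt_tsum_of_isPreconnected (𝕜 := ℝ) hus (Metric.isOpen_ball (x := (0 : ℝ)) (ε := T))
    (convex_ball (0 : ℝ) T).isPreconnected (g := fun (k : ℕ) (s : ℝ) => s ^ k / (k.factorial : ℝ) * a k)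
    (g' := g') (fun k s _ => ((hasDerivAt_pow k s).div_const _).mul_const _) (fun k s hs => ?_)
    (Metric.mem_ball_self (by positivity)) ?_ (y := t) (by simp [hT])
  · have hsum : Summable fun k => g' k t := by
      rw [← summable_nat_add_iff 1]
      have ha' : ∀ k, |a (k + 1)| ≤ A ^ k * (A * C) := fun k => by
        rw [← mul_assoc, ← pow_succ]; exact ha _
      refine (summable_pow_div_factorial_mul t ha').of_abs.congr fun k => ?_
      simp only [hg', hsucc]
    have e : ∑' k : ℕ, t ^ k / (k.factorial : ℝ) * a (k + 1) = ∑' k, g' k t := by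
      rw [hsum.tsum_eq_zero_add]
      simp only [hg', hsucc]
      simp
    rw [e]
    exact key
  · rw [Real.norm_eq_abs, hg', abs_mul, abs_div, abs_mul, abs_pow, Nat.abs_cast, Nat.abs_cast]
    have hs' : |s| ≤ T := by simpa using (Metric.mem_ball.1 hs).le
    have := ha k
    rw [hu]
    dsimp only
    gcongr
  · exact (summable_pow_div_factorial_mul 0 ha).of_abs

/-- The bounded measurable functions of the configuration. -/
def boundedMeas : Submodule ℝ (Conf → ℝ) where
  carrier := {g | Measurable g ∧ ∃ C, ∀ η, |g η| ≤ C}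
  add_mem' := by
    rintro f g ⟨hf, C, hC⟩ ⟨hg, D, hD⟩
    exact ⟨hf.add hg, C + D, fun η => (abs_add_le _ _).trans (add_le_add (hC η) (hD η))⟩
  zero_mem' := ⟨measurable_const, 0, fun η => by simp⟩
  smul_mem' := by
    rintro c g ⟨hg, C, hC⟩
    refine ⟨hg.const_smul c, |c| * C, fun η => ?_⟩
    rw [Pi.smul_apply, smul_eq_mul, abs_mul]
    exact mul_le_mul_of_nonneg_left (hC η) (abs_nonneg c)

/-- The exponential series of the generator on the configurations of at most `n` particles. -/
def semi (q lam xi : ℝ) (n : ℕ) (t : ℝ) (f : Conf → ℝ) (η : Conf) : ℝ :=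
  ∑' k : ℕ, t ^ k / (k.factorial : ℝ) * ((truncGen q lam xi n)^[k] f) η

/-- Moves conserve the number of particles, so the truncation is never felt along the iteration. -/
theorem generator_iterate_eq (q lam xi : ℝ) {n : ℕ} (f : Conf → ℝ) (k : ℕ) {η : Conf}
    (h : η ∈ atMost n) : ((generator q lam xi)^[k] f) η = ((truncGen q lam xi n)^[k] f) η := by
  induction k generalizing η with
  | zero => rfl
  | succ k ih =>
    rw [Function.iterate_succ_apply', Function.iterate_succ_apply', truncGen,
      Set.indicator_of_mem h, generator_eq_sum _ _ _ _ (finite_support_of_mem_atMost h),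
      generator_eq_sum _ _ _ _ (finite_support_of_mem_atMost h)]
    refine Finset.sum_congr rfl fun y hy => ?_
    have hy0 : η y ≠ 0 := by simpa using hy
    simp_rw [ih h, ih (move_mem_atMost h hy0 _)]

theorem finiteSemigroup_eq_semi (q lam xi t : ℝ) {n : ℕ} (f : Conf → ℝ) {η : Conf}
    (h : η ∈ atMost n) : finiteSemigroup q lam xi t f η = semi q lam xi n t f η := by
  unfold finiteSemigroup semi
  simp_rw [generator_iterate_eq q lam xi f _ h]

/-! ### The exponential series: contraction, influence and differentiability -/

section semi

variable {q lam xi : ℝ} (hq0 : 0 ≤ q) (hq1 : q ≤ 1) (hlam : 0 < lam) (hxi : 0 ≤ xi)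

/-- `truncGen` as an operator on the bounded measurable functions. -/
def truncGenEnd (n : ℕ) : Module.End ℝ boundedMeas where
  toFun g := ⟨truncGen q lam xi n g, measurable_truncGen hq0 hq1 hlam.le xi n g.2.1, by
    obtain ⟨C, hC⟩ := g.2.2
    exact ⟨_, abs_truncGen_le hq0 hq1 hlam hxi g.2.1 hC⟩⟩
  map_add' f g := by
    obtain ⟨C, hC⟩ := f.2.2
    obtain ⟨D, hD⟩ := g.2.2
    obtain ⟨E, hE⟩ := (f + g).2.2
    ext η
    show truncGen q lam xi n (f + g : boundedMeas) η =
      truncGen q lam xi n f η + truncGen q lam xi n g η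
    by_cases h : η ∈ atMost n
    · rw [truncGen_eq_sum hq0 hq1 hlam xi (f + g).2.1 hE h,
        truncGen_eq_sum hq0 hq1 hlam xi f.2.1 hC h, truncGen_eq_sum hq0 hq1 hlam xi g.2.1 hD h,
        ← Finset.sum_add_distrib]
      refine Finset.sum_congr rfl fun y _ => ?_
      have : ∀ ζ, (f + g : boundedMeas).1 ζ = f.1 ζ + g.1 ζ := fun ζ => rfl
      simp_rw [this]
      rw [integral_add (integrable_move hq0 hq1 hlam f.2.1 hC _ _ _ _)
        (integrable_move hq0 hq1 hlam g.2.1 hD _ _ _ _)]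
      ring
    · simp [truncGen, Set.indicator_of_notMem h]
  map_smul' c g := by
    obtain ⟨D, hD⟩ := g.2.2
    obtain ⟨E, hE⟩ := (c • g).2.2
    ext η
    show truncGen q lam xi n (c • g : boundedMeas) η = c * truncGen q lam xi n g η
    by_cases h : η ∈ atMost n
    · rw [truncGen_eq_sum hq0 hq1 hlam xi (c • g).2.1 hE h,
        truncGen_eq_sum hq0 hq1 hlam xi g.2.1 hD h, Finset.mul_sum]
      refine Finset.sum_congr rfl fun y _ => ?_
      have : ∀ ζ, (c • g : boundedMeas).1 ζ = c * g.1 ζ := fun ζ => rfl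
      simp_rw [this]
      rw [integral_const_mul]
      ring
    · simp [truncGen, Set.indicator_of_notMem h]

theorem truncGenEnd_pow_coe (n k : ℕ) (f : boundedMeas) :
    ((truncGenEnd hq0 hq1 hlam hxi n ^ k) f : Conf → ℝ) =
      (truncGen q lam xi n)^[k] f := by
  induction k with
  | zero => rfl
  | succ k ih => rw [pow_succ', Function.iterate_succ_apply', ← ih]; rfl

-- The binomial theorem in the endomorphism ring of the bounded measurable functions, where the
-- scaled generator commutes with the identity.
include hq0 hq1 hlam hxi in
theorem uniStep_iterate_eq (K : ℝ) (n m : ℕ) (f : boundedMeas) (η : Conf) :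
    ((uniStep q lam xi K n)^[m] f) η = ∑ k ∈ Finset.range (m + 1),
      (m.choose k : ℝ) * (K⁻¹) ^ k * ((truncGen q lam xi n)^[k] f) η := by
  set L := truncGenEnd hq0 hq1 hlam hxi n with hL
  have h1 : ∀ m, (((K⁻¹ • L + 1) ^ m) f : Conf → ℝ) = (uniStep q lam xi K n)^[m] f := by
    intro m
    induction m with
    | zero => rfl
    | succ m ih =>
      rw [pow_succ', Function.iterate_succ_apply', ← ih]
      ext η
      show K⁻¹ * truncGen q lam xi n _ η + _ = _
      rw [add_comm]; rfl
  rw [← h1, (Commute.one_right (K⁻¹ • L)).add_pow, LinearMap.sum_apply,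
    AddSubmonoidClass.coe_finsetSum, Finset.sum_apply]
  refine Finset.sum_congr rfl fun k _ => ?_
  rw [← truncGenEnd_pow_coe hq0 hq1 hlam hxi, one_pow, mul_one, smul_pow, ← hL]
  rw [← nsmul_eq_mul', LinearMap.smul_apply, LinearMap.smul_apply]
  show (m.choose k • (K⁻¹ ^ k * ((L ^ k) f : Conf → ℝ) η) : ℝ) = _
  rw [nsmul_eq_mul, mul_assoc]

variable {n : ℕ} {f : Conf → ℝ} (hf : Measurable f) {C : ℝ} (hC : ∀ η, |f η| ≤ C)

include hq0 hq1 hlam hf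

theorem measurable_truncGen_iterate (k : ℕ) : Measurable ((truncGen q lam xi n)^[k] f) := by
  induction k with
  | zero => exact hf
  | succ k ih =>
    rw [Function.iterate_succ_apply']
    exact measurable_truncGen hq0 hq1 hlam.le xi n ih

theorem measurable_uniStep_iterate (K : ℝ) (k : ℕ) :
    Measurable ((uniStep q lam xi K n)^[k] f) := by
  induction k with
  | zero => exact hf
  | succ k ih =>
    rw [Function.iterate_succ_apply']
    exact ih.add ((measurable_truncGen hq0 hq1 hlam.le xi n ih).const_mul _)

include hxi hC

theorem abs_truncGen_iterate_le (k : ℕ) (η : Conf) :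
    |((truncGen q lam xi n)^[k] f) η| ≤ (2 * (xi * n)) ^ k * C := by
  induction k generalizing η with
  | zero => simpa using hC η
  | succ k ih =>
    rw [Function.iterate_succ_apply', pow_succ', mul_assoc]
    exact abs_truncGen_le hq0 hq1 hlam hxi (measurable_truncGen_iterate hq0 hq1 hlam hf k) ih η

theorem abs_uniStep_iterate_le {K : ℝ} (hK0 : 0 < K) (hK : 2 * (xi * n) ≤ K) (m : ℕ) (η : Conf) :
    |((uniStep q lam xi K n)^[m] f) η| ≤ C := by
  induction m generalizing η with
  | zero => simpa using hC η
  | succ k ih =>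
    rw [Function.iterate_succ_apply']
    exact abs_uniStep_le hq0 hq1 hlam hxi hK0 hK (measurable_uniStep_iterate hq0 hq1 hlam hf K k) ih η

theorem semi_eq_tsum_uniStep {K : ℝ} (hK : 0 < K) (t : ℝ) (η : Conf) :
    semi q lam xi n t f η = Real.exp (-(t * K)) *
      ∑' m : ℕ, (t * K) ^ m / (m.factorial : ℝ) * ((uniStep q lam xi K n)^[m] f) η :=
  tsum_uniformize hK t (fun k => abs_truncGen_iterate_le hq0 hq1 hlam hxi hf hC k η)
    fun m => uniStep_iterate_eq hq0 hq1 hlam hxi K n m ⟨f, hf, C, hC⟩ η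

theorem measurable_semi (t : ℝ) : Measurable (semi q lam xi n t f) := by
  refine measurable_of_tendsto_metrizable (f := fun N η => ∑ k ∈ Finset.range N,
    t ^ k / (k.factorial : ℝ) * ((truncGen q lam xi n)^[k] f) η) (fun N => ?_) ?_
  · exact Finset.measurable_fun_sum _ fun k _ =>
      (measurable_truncGen_iterate hq0 hq1 hlam hf k).const_mul _
  · rw [tendsto_pi_nhds]
    intro η
    exact (summable_pow_div_factorial_mul t fun k =>
      abs_truncGen_iterate_le hq0 hq1 hlam hxi hf hC k η).of_abs.hasSum.tendsto_sum_nat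

/-- The alternating signs in the exponential series hide the contraction; it appears after
uniformization, as a Poisson average of averages. -/
theorem abs_semi_le {t : ℝ} (ht : 0 ≤ t) (η : Conf) : |semi q lam xi n t f η| ≤ C := by
  have hK0 : 0 < 2 * (xi * n) + 1 := by positivity
  rw [semi_eq_tsum_uniStep hq0 hq1 hlam hxi hf hC hK0]
  have := abs_exp_mul_tsum_le (s := t * (2 * (xi * n) + 1)) (by positivity)
    (b := fun m => ((uniStep q lam xi (2 * (xi * n) + 1) n)^[m] f) η) (r := 1) (B := C) fun m => by
      simpa using abs_uniStep_iterate_le hq0 hq1 hlam hxi hf hC hK0 (by linarith) m η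
  simpa using this

/-- Each uniformized step costs a factor `1 + 2 * xi / K`, and the number of steps is Poisson of
mean `t * K`. The averaged factor is `exp (2 * xi * t)`: both `K` and the number of particles drop
out, which permits the passage to infinitely many particles. -/
theorem hasInfluence_semi {A : ℝ} (hA : 0 ≤ A) (hI : HasInfluence lam A n f) {t : ℝ}
    (ht : 0 ≤ t) : HasInfluence lam (A * Real.exp (2 * xi * t)) n (semi q lam xi n t f) := by
  set K := 2 * (xi * n) + 1 with hK
  have hK0 : 0 < K := by positivity
  have hstep : ∀ m, HasInfluence lam (A * (1 + 2 * xi / K) ^ m) n ((uniStep q lam xi K n)^[m] f) := by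
    intro m
    induction m with
    | zero => simpa using hI
    | succ m ih =>
      rw [Function.iterate_succ_apply', pow_succ, ← mul_assoc]
      exact hasInfluence_uniStep hq0 hq1 hlam hxi hK0 (by linarith)
        (measurable_uniStep_iterate hq0 hq1 hlam hf K m)
        (abs_uniStep_iterate_le hq0 hq1 hlam hxi hf hC hK0 (by linarith) m) (by positivity) ih
  intro X η ζ hη hζ hX
  rw [semi_eq_tsum_uniStep hq0 hq1 hlam hxi hf hC hK0,
    semi_eq_tsum_uniStep hq0 hq1 hlam hxi hf hC hK0, ← mul_sub, ← Summable.tsum_sub]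
  · simp_rw [← mul_sub]
    have := abs_exp_mul_tsum_le (s := t * K) (by positivity)
      (b := fun m => ((uniStep q lam xi K n)^[m] f) η - ((uniStep q lam xi K n)^[m] f) ζ)
      (r := 1 + 2 * xi / K) (B := A * Real.exp (lam / 2 * X)) fun m => by
        refine (hstep m X η ζ hη hζ hX).trans (le_of_eq ?_); ring
    refine this.trans (le_of_eq ?_)
    rw [show t * K * (1 + 2 * xi / K) - t * K = 2 * xi * t by field_simp; ring]
    ring
  all_goals
    exact (summable_pow_div_factorial_mul (A := 1) (C := C) _ fun m => by
      simpa using abs_uniStep_iterate_le hq0 hq1 hlam hxi hf hC hK0 (by linarith) m _).of_abs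

theorem isLeftLocal_semi {v : ℝ} (hv : IsLeftLocal v n f) (t : ℝ) :
    IsLeftLocal v n (semi q lam xi n t f) := by
  have h : ∀ k, IsLeftLocal v n ((truncGen q lam xi n)^[k] f) := by
    intro k
    induction k with
    | zero => exact hv
    | succ k ih =>
      rw [Function.iterate_succ_apply']
      exact isLeftLocal_truncGen hq0 hq1 hlam (measurable_truncGen_iterate hq0 hq1 hlam hf k)
        (abs_truncGen_iterate_le hq0 hq1 hlam hxi hf hC k) ih
  intro η ζ hη hζ hag
  unfold semi
  simp_rw [h _ η ζ hη hζ hag]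

/-- The generator may be applied termwise because the series is dominated by a summable sequence
uniform in the configuration. Only finitely many locations contribute to it, and the landing
integrals exchange with the series. -/
theorem truncGen_semi (t : ℝ) (η : Conf) : truncGen q lam xi n (semi q lam xi n t f) η =
    ∑' k : ℕ, t ^ k / (k.factorial : ℝ) * ((truncGen q lam xi n)^[k + 1] f) η := by
  by_cases h : η ∈ atMost n
  swap
  · simp_rw [Function.iterate_succ_apply', truncGen, Set.indicator_of_notMem h]
    simp
  set F : ℕ → Conf → ℝ := fun k ζ => t ^ k / (k.factorial : ℝ) * ((truncGen q lam xi n)^[k] f) ζ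
    with hF
  set B : ℕ → ℝ := fun k => |t| ^ k / (k.factorial : ℝ) * ((2 * (xi * n)) ^ k * C) with hB
  have hC0 : 0 ≤ C := (abs_nonneg _).trans (hC η)
  have hBs : Summable B := by
    refine ((Real.summable_pow_div_factorial (|t| * (2 * (xi * n)))).mul_right C).congr fun k => ?_
    rw [hB, mul_pow]; ring
  have hFB : ∀ k ζ, |F k ζ| ≤ B k := fun k ζ => by
    rw [hF]; dsimp only
    rw [abs_mul, abs_div, abs_pow, Nat.abs_cast]
    exact mul_le_mul_of_nonneg_left (abs_truncGen_iterate_le hq0 hq1 hlam hxi hf hC k ζ)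
      (by positivity)
  have hFm : ∀ k, Measurable (F k) := fun k =>
    (measurable_truncGen_iterate hq0 hq1 hlam hf k).const_mul _
  have hFs : ∀ ζ, HasSum (fun k => F k ζ) (semi q lam xi n t f ζ) := fun ζ =>
    (Summable.of_norm_bounded hBs fun k => hFB k ζ).hasSum
  have hsemi : ∀ ζ, |semi q lam xi n t f ζ| ≤ ∑' k, B k := fun ζ =>
    tsum_of_norm_bounded (f := fun k => F k ζ) hBs.hasSum fun k => hFB k ζ
  rw [truncGen_eq_sum hq0 hq1 hlam xi (measurable_semi hq0 hq1 hlam hxi hf hC t) hsemi h]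
  have hterm : ∀ y, HasSum (fun k => wakeRate q xi η y *
      (∫ z, F k (η.move y z) ∂landingLaw q lam η y - F k η)) (wakeRate q xi η y *
      (∫ z, semi q lam xi n t f (η.move y z) ∂landingLaw q lam η y - semi q lam xi n t f η)) := by
    intro y
    have := isProbabilityMeasure_landingLaw hq0 hq1 hlam η y
    refine HasSum.mul_left _ (HasSum.sub ?_ (hFs η))
    have hs := hasSum_integral_of_summable_integral_norm (μ := landingLaw q lam η y)
      (F := fun k z => F k (η.move y z))
      (fun k => integrable_move hq0 hq1 hlam (hFm k) (hFB k) _ _ _ _) ?_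
    · exact hs
    · refine Summable.of_nonneg_of_le (fun k => integral_nonneg fun z => norm_nonneg _)
        (fun k => ?_) hBs
      have := integral_mono_of_nonneg (μ := landingLaw q lam η y)
        (Eventually.of_forall fun z => norm_nonneg (F k (η.move y z))) (integrable_const (B k))
        (Eventually.of_forall fun z => hFB k _)
      simpa using this
  have hall := hasSum_sum (s := (finite_support_of_mem_atMost h).toFinset) fun y _ => hterm y
  rw [← hall.tsum_eq]
  refine tsum_congr fun k => ?_
  rw [← truncGen_eq_sum hq0 hq1 hlam xi (hFm k) (hFB k) h, Function.iterate_succ_apply']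
  have hlin := (truncGenEnd hq0 hq1 hlam hxi n).map_smul (t ^ k / (k.factorial : ℝ))
    ⟨(truncGen q lam xi n)^[k] f, measurable_truncGen_iterate hq0 hq1 hlam hf k, _,
      abs_truncGen_iterate_le hq0 hq1 hlam hxi hf hC k⟩
  exact congrFun (congrArg Subtype.val hlin) η

theorem hasDerivAt_semi (t : ℝ) (η : Conf) : HasDerivAt (fun s => semi q lam xi n s f η)
    (truncGen q lam xi n (semi q lam xi n t f) η) t := by
  rw [truncGen_semi hq0 hq1 hlam hxi hf hC]
  exact hasDerivAt_tsum_pow_div_factorial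
    (fun k => abs_truncGen_iterate_le hq0 hq1 hlam hxi hf hC k η) t

end semi

/-! ### Existence of the model on the whole line -/

theorem exists_mem_atMost_pair {η ζ : Conf} {m n : ℕ} (hη : η ∈ atMost m) (hζ : ζ ∈ atMost n) :
    ∃ k, η ∈ atMost k ∧ ζ ∈ atMost k :=
  ⟨max m n, atMost_mono (le_max_left _ _) hη, atMost_mono (le_max_right _ _) hζ⟩

theorem Conf.restrict_of_mem (η : Conf) {B : Set ℝ} {x : ℝ} (h : x ∈ B) : η.restrict B x = η x :=
  if_pos h

theorem Conf.restrict_of_notMem (η : Conf) {B : Set ℝ} {x : ℝ} (h : x ∉ B) : η.restrict B x = 0 :=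
  if_neg h

theorem Conf.restrict_congr (η : Conf) {B B' : Set ℝ} {x : ℝ} (h : x ∈ B ↔ x ∈ B') :
    η.restrict B x = η.restrict B' x := by
  by_cases hx : x ∈ B
  · rw [η.restrict_of_mem hx, η.restrict_of_mem (h.1 hx)]
  · rw [η.restrict_of_notMem hx, η.restrict_of_notMem fun h' => hx (h.2 h')]

theorem exists_bound_lt {lam : ℝ} (hlam : 0 < lam) (C xi t : ℝ) {ε : ℝ} (hε : 0 < ε) (u : ℝ) : ∃ X : ℝ, ∀ X' ≤ X,
    2 * C * Real.exp (-(lam / 2 * u)) * Real.exp (2 * xi * t) * Real.exp (lam / 2 * X') < ε := by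
  have : Tendsto (fun X : ℝ => 2 * C * Real.exp (-(lam / 2 * u)) * Real.exp (2 * xi * t) *
      Real.exp (lam / 2 * X)) atBot (𝓝 (2 * C * Real.exp (-(lam / 2 * u)) *
        Real.exp (2 * xi * t) * 0)) :=
    (Real.tendsto_exp_atBot.comp (tendsto_id.const_mul_atBot (half_pos hlam))).const_mul _
  rw [mul_zero] at this
  exact eventually_atBot.1 (this.eventually_lt_const hε)

/-- The semigroup started from the particles in the window `(a, v)`. -/
def openSemigroup (q lam xi t : ℝ) (f : Conf → ℝ) (a v : ℝ) (η : Conf) : ℝ :=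
  finiteSemigroup q lam xi t f (η.restrict (Set.Ioo a v))

theorem restrict_Ioo_mem (η : Conf) (a v : ℝ) :
    η.restrict (Set.Ioo a v) ∈ atMost (η.num (Set.Ioo a v)) :=
  restrict_mem_atMost η measurableSet_Ioo Set.Ioo_subset_Icc_self

/-! ### Cauchy property of the window systems for a local observable -/

section observable

variable {q lam xi : ℝ} (hq0 : 0 ≤ q) (hq1 : q ≤ 1) (hlam : 0 < lam) (hxi : 0 ≤ xi)
  {f : Conf → ℝ} (hf : Measurable f) {C : ℝ} (hC : ∀ η, |f η| ≤ C) {u v : ℝ}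
  (hloc : ∀ η ζ : Conf, (∀ x ∈ Set.Icc u v, η x = ζ x) → f η = f ζ)

-- For `X < u` the change is not seen by `f`. Otherwise the trivial bound `2 * C` suffices, as `exp
-- (lam / 2 * (X - u))` is at least `1`.
include hC hloc in
theorem hasInfluence_of_local (hlam : 0 < lam) (n : ℕ) :
    HasInfluence lam (2 * C * Real.exp (-(lam / 2 * u))) n f := by
  intro X η ζ _ _ hX
  have hC0 : 0 ≤ C := (abs_nonneg _).trans (hC η)
  rw [mul_assoc, ← Real.exp_add]
  rcases lt_or_ge X u with h | h
  · rw [hloc η ζ fun x hx => hX x (h.trans_le hx.1), sub_self, abs_zero]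
    positivity
  · have h1 : |f η - f ζ| ≤ 2 * C := by
      have h2 := hC η
      have h3 := hC ζ
      rw [abs_le] at *
      constructor <;> linarith
    refine h1.trans (le_mul_of_one_le_right (by positivity) (Real.one_le_exp ?_))
    nlinarith

include hloc in
theorem isLeftLocal_of_local (n : ℕ) : IsLeftLocal v n f := fun η ζ _ _ h =>
  hloc η ζ fun x hx => h x hx.2

include hq0 hq1 hlam hxi hf hC

theorem finiteSemigroup_abs_le {t : ℝ} (ht : 0 ≤ t) {n : ℕ} {η : Conf} (hη : η ∈ atMost n) :
    |finiteSemigroup q lam xi t f η| ≤ C := by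
  rw [finiteSemigroup_eq_semi q lam xi t f hη]
  exact abs_semi_le hq0 hq1 hlam hxi hf hC ht η

/-- The truncation level depends on the configuration, so the function is obtained as a limit over
levels that is eventually constant at each configuration. -/
theorem measurable_openSemigroup (t a v : ℝ) : Measurable (openSemigroup q lam xi t f a v) := by
  refine measurable_of_tendsto_metrizable (f := fun (n : ℕ) η => semi q lam xi n t f
    (η.restrict (Set.Ioo a v))) (fun n => ?_) ?_
  · exact (measurable_semi hq0 hq1 hlam hxi hf hC t).comp
      (Conf.measurable_restrict measurableSet_Ioo)
  · rw [tendsto_pi_nhds]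
    intro η
    refine tendsto_const_nhds.congr' ?_
    filter_upwards [eventually_ge_atTop (η.num (Set.Ioo a v))] with n hn
    exact finiteSemigroup_eq_semi q lam xi t f (atMost_mono hn (restrict_Ioo_mem η a v))

include hloc

theorem finiteSemigroup_congr_left (t : ℝ) {m n : ℕ} {η ζ : Conf} (hη : η ∈ atMost m)
    (hζ : ζ ∈ atMost n) (h : ∀ x ≤ v, η x = ζ x) :
    finiteSemigroup q lam xi t f η = finiteSemigroup q lam xi t f ζ := by
  obtain ⟨k, h1, h2⟩ := exists_mem_atMost_pair hη hζ
  rw [finiteSemigroup_eq_semi q lam xi t f h1, finiteSemigroup_eq_semi q lam xi t f h2]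
  exact isLeftLocal_semi hq0 hq1 hlam hxi hf hC (isLeftLocal_of_local hloc k) t η ζ h1 h2 h

theorem finiteSemigroup_sub_le {t : ℝ} (ht : 0 ≤ t) {m n : ℕ} {η ζ : Conf} (hη : η ∈ atMost m)
    (hζ : ζ ∈ atMost n) {X : ℝ} (h : ∀ x, X < x → η x = ζ x) :
    |finiteSemigroup q lam xi t f η - finiteSemigroup q lam xi t f ζ| ≤
      2 * C * Real.exp (-(lam / 2 * u)) * Real.exp (2 * xi * t) * Real.exp (lam / 2 * X) := by
  have hC0 : 0 ≤ C := (abs_nonneg _).trans (hC η)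
  obtain ⟨k, h1, h2⟩ := exists_mem_atMost_pair hη hζ
  rw [finiteSemigroup_eq_semi q lam xi t f h1, finiteSemigroup_eq_semi q lam xi t f h2]
  exact hasInfluence_semi hq0 hq1 hlam hxi hf hC (by positivity)
    (hasInfluence_of_local hC hloc hlam k) ht X η ζ h1 h2 h

/-- Left locality discards the particles beyond `v` in both sets; what remains differs only up to
`X`, where the influence bound applies. -/
theorem finiteSemigroup_restrict_sub_le {t : ℝ} (ht : 0 ≤ t) (η : Conf) {B B' : Set ℝ}
    (hB : MeasurableSet B) (hB' : MeasurableSet B') {a b a' b' : ℝ} (hab : B ⊆ Set.Icc a b)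
    (hab' : B' ⊆ Set.Icc a' b') {X : ℝ} (h : ∀ x, X < x → x ≤ v → (x ∈ B ↔ x ∈ B')) :
    |finiteSemigroup q lam xi t f (η.restrict B) - finiteSemigroup q lam xi t f (η.restrict B')| ≤
      2 * C * Real.exp (-(lam / 2 * u)) * Real.exp (2 * xi * t) * Real.exp (lam / 2 * X) := by
  have hBv : B ∩ Set.Iic v ⊆ Set.Icc a b := Set.inter_subset_left.trans hab
  have hBv' : B' ∩ Set.Iic v ⊆ Set.Icc a' b' := Set.inter_subset_left.trans hab'
  have m1 := restrict_mem_atMost η (hB.inter measurableSet_Iic) hBv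
  have m2 := restrict_mem_atMost η (hB'.inter measurableSet_Iic) hBv'
  rw [finiteSemigroup_congr_left hq0 hq1 hlam hxi hf hC hloc t (restrict_mem_atMost η hB hab) m1,
    finiteSemigroup_congr_left hq0 hq1 hlam hxi hf hC hloc t (restrict_mem_atMost η hB' hab') m2]
  · refine finiteSemigroup_sub_le hq0 hq1 hlam hxi hf hC hloc ht m1 m2 fun x hx => ?_
    refine η.restrict_congr ?_
    simp only [Set.mem_inter_iff, Set.mem_Iic]
    constructor <;> rintro ⟨h1, h2⟩ <;> refine ⟨?_, h2⟩
    · exact (h x hx h2).1 h1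
    · exact (h x hx h2).2 h1
  all_goals
    intro x hx
    exact η.restrict_congr (by simp [hx])

theorem exists_tendsto_windowSemigroup {t : ℝ} (ht : 0 ≤ t) (η : Conf) :
    ∃ l : ℝ, Tendsto (windowSemigroup q lam xi t f η) (atBot ×ˢ atTop) (𝓝 l) := by
  rw [← cauchy_map_iff_exists_tendsto, Metric.cauchy_iff]
  refine ⟨inferInstance, fun ε hε => ?_⟩
  obtain ⟨X, hX⟩ := exists_bound_lt hlam C xi t hε u
  -- Windows that start left of `X` and end right of `v` contain the same particles in `(X, v]`, so
  -- their expectations differ by less than `ε`.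
  refine ⟨windowSemigroup q lam xi t f η '' (Set.Iic X ×ˢ Set.Ici v), image_mem_map
    (prod_mem_prod (Iic_mem_atBot X) (Ici_mem_atTop v)), ?_⟩
  rintro _ ⟨w, hw, rfl⟩ _ ⟨w', hw', rfl⟩
  refine lt_of_le_of_lt ?_ (hX X le_rfl)
  refine finiteSemigroup_restrict_sub_le hq0 hq1 hlam hxi hf hC hloc ht η measurableSet_Icc
    measurableSet_Icc subset_rfl subset_rfl fun x hx hxv => ?_
  have h1 : w.1 ≤ X := hw.1
  have h2 : v ≤ w.2 := hw.2
  have h3 : w'.1 ≤ X := hw'.1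
  have h4 : v ≤ w'.2 := hw'.2
  simp only [Set.mem_Icc]
  constructor <;> intro _ <;> constructor <;> linarith

theorem transitionOp_sub_openSemigroup_le {t : ℝ} (ht : 0 ≤ t) (η : Conf) {v' : ℝ} (hv : v < v')
    (a : ℝ) : |transitionOp q lam xi t f η - openSemigroup q lam xi t f a v' η| ≤
      2 * C * Real.exp (-(lam / 2 * u)) * Real.exp (2 * xi * t) * Real.exp (lam / 2 * a) := by
  have hlim := tendsto_nhds_limUnder
    (exists_tendsto_windowSemigroup hq0 hq1 hlam hxi hf hC hloc ht η)
  refine le_of_tendsto (hlim.sub_const _).abs ?_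
  filter_upwards [prod_mem_prod (Iic_mem_atBot a) (Ici_mem_atTop v)] with w hw
  have h1 : w.1 ≤ a := hw.1
  have h2 : v ≤ w.2 := hw.2
  refine finiteSemigroup_restrict_sub_le hq0 hq1 hlam hxi hf hC hloc ht η measurableSet_Icc
    measurableSet_Ioo subset_rfl Set.Ioo_subset_Icc_self fun x hx hxv => ?_
  simp only [Set.mem_Icc, Set.mem_Ioo]
  constructor <;> intro _ <;> constructor <;> linarith

theorem tendsto_openSemigroup {t : ℝ} (ht : 0 ≤ t) (η : Conf) {v' : ℝ} (hv : v < v') :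
    Tendsto (fun a => openSemigroup q lam xi t f a v' η) atBot (𝓝 (transitionOp q lam xi t f η)) := by
  rw [Metric.tendsto_nhds]
  intro ε hε
  obtain ⟨X, hX⟩ := exists_bound_lt hlam C xi t hε u
  filter_upwards [Iic_mem_atBot X] with a ha
  rw [dist_comm]
  exact (transitionOp_sub_openSemigroup_le hq0 hq1 hlam hxi hf hC hloc ht η hv a).trans_lt (hX a ha)

theorem measurable_transitionOp {t : ℝ} (ht : 0 ≤ t) : Measurable (transitionOp q lam xi t f) := by
  refine measurable_of_tendsto_metrizable' (atBot : Filter ℝ) (f := fun a =>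
    openSemigroup q lam xi t f a (v + 1))
    (fun a => measurable_openSemigroup hq0 hq1 hlam hxi hf hC t a (v + 1)) ?_
  rw [tendsto_pi_nhds]
  exact fun η => tendsto_openSemigroup hq0 hq1 hlam hxi hf hC hloc ht η (lt_add_one v)

theorem abs_transitionOp_le {t : ℝ} (ht : 0 ≤ t) (η : Conf) :
    |transitionOp q lam xi t f η| ≤ C :=
  le_of_tendsto (tendsto_openSemigroup hq0 hq1 hlam hxi hf hC hloc ht η (lt_add_one v)).abs
    (Eventually.of_forall fun a =>
      finiteSemigroup_abs_le hq0 hq1 hlam hxi hf hC ht (restrict_Ioo_mem η a (v + 1)))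

end observable

theorem existsFrom {q lam xi : ℝ} (hq0 : 0 ≤ q) (hq1 : q ≤ 1) (hlam : 0 < lam) (hxi : 0 ≤ xi)
    (η : Conf) : ExistsFrom q lam xi η := by
  intro t ht f hf
  obtain ⟨C, hC⟩ := hf.bounded
  obtain ⟨u, v, hloc⟩ := hf.isLocal
  exact exists_tendsto_windowSemigroup hq0 hq1 hlam hxi hf.measurable hC hloc ht η

/-! ### Balance equations -/

/-- The balance equation between departures and landings that characterizes the stationary
measures. -/
def IsBalanced (q lam c : ℝ) (μ : Measure Conf) : Prop :=
  ∀ Ψ : Conf → ℝ → ℝ≥0∞, Measurable (Function.uncurry Ψ) →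
    ∫⁻ η, ∫⁻ y, Ψ η y ∂dep q η ∂μ =
      ENNReal.ofReal c * ∫⁻ η, ∫⁻ y, Ψ (η.add y 1) y ∂trap q lam η ∂μ

theorem Conf.add_of_ne (η : Conf) {x y : ℝ} (h : x ≠ y) (j : ℕ) : η.add y j x = η x := by
  rw [Conf.add_apply, if_neg h, add_zero]

theorem jumpRateOver_eq {q lam xi : ℝ} (hq0 : 0 ≤ q) (hq1 : q ≤ 1) (hlam : 0 < lam) (hxi : 0 ≤ xi)
    (η : Conf) (x : ℝ) : jumpRateOver q lam xi η x = ENNReal.ofReal xi *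
      ∫⁻ y, (Set.Iio x).indicator (fun y => ENNReal.ofReal (reach q lam η y x)) y ∂dep q η := by
  rw [lintegral_dep, jumpRateOver, ← ENNReal.tsum_mul_left]
  have h1 : ∀ y : Set.Iio x, ENNReal.ofReal (wakeRate q xi η y) * landingLaw q lam η y (Set.Ici x)
      = (fun y : ℝ => ENNReal.ofReal xi * (ENNReal.ofReal (1 - q ^ η y) *
        ENNReal.ofReal (reach q lam η y x))) y := by
    intro y
    rw [landingLaw_Ici hq0 hq1 hlam η y.2, wakeRate, ENNReal.ofReal_mul hxi, mul_assoc]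
  simp_rw [h1]
  refine (tsum_subtype (Set.Iio x) (fun y : ℝ => ENNReal.ofReal xi * (ENNReal.ofReal (1 - q ^ η y) *
        ENNReal.ofReal (reach q lam η y x)))).trans ?_
  refine tsum_congr fun y => ?_
  by_cases hy : y ∈ Set.Iio x
  · simp only [Set.indicator_of_mem hy]
  · simp only [Set.indicator_of_notMem hy, mul_zero]

/-- Balance turns the current into `c` times the `trap` integral of the probability to reach `x`. A
particle added at `y` does not obstruct its own flight, so the backward mass identity on `(-∞, x)`
makes this integral `1`. -/
theorem IsBalanced.lintegral_jumpRateOver {q lam xi c : ℝ} (hq0 : 0 ≤ q) (hq1 : q ≤ 1)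
    (hlam : 0 < lam) (hxi : 0 ≤ xi) {μ : Measure Conf} [IsProbabilityMeasure μ]
    (hμ : IsBalanced q lam c μ) (x : ℝ) :
    ∫⁻ η, jumpRateOver q lam xi η x ∂μ = ENNReal.ofReal (xi * c) := by
  set Ψ : Conf → ℝ → ℝ≥0∞ := fun η =>
    (Set.Iio x).indicator (fun y => ENNReal.ofReal (reach q lam η y x)) with hΨ
  have hm : Measurable (Function.uncurry Ψ) := by
    have h1 : Measurable fun p : Conf × ℝ => ENNReal.ofReal (reach q lam p.1 p.2 x) :=
      (measurable_reach q lam measurable_fst measurable_snd measurable_const).ennreal_ofReal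
    exact h1.indicator (measurable_snd (measurableSet_Iio (a := x)))
  simp_rw [jumpRateOver_eq hq0 hq1 hlam hxi]
  change ∫⁻ η, ENNReal.ofReal xi * ∫⁻ y, Ψ η y ∂dep q (id η) ∂μ = _
  rw [lintegral_const_mul _ (measurable_lintegral_dep q measurable_id hm)]
  simp only [id_eq]
  rw [hμ Ψ hm]
  have h1 : ∀ η : Conf, ∫⁻ y, Ψ (η.add y 1) y ∂trap q lam η = 1 := by
    intro η
    rw [← lintegral_reach_Iio hq0 hq1 hlam η x, ← lintegral_indicator measurableSet_Iio]
    refine lintegral_congr fun y => ?_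
    simp only [hΨ, Set.indicator]
    split_ifs
    · rw [reach_congr fun w hw => η.add_of_ne hw.1.ne' 1]
    · rfl
  simp_rw [h1]
  rw [lintegral_one, measure_univ, mul_one, ← ENNReal.ofReal_mul hxi]

theorem measurable_lintegral_landingLaw {α : Type*} [MeasurableSpace α] {q lam : ℝ} (hq0 : 0 ≤ q)
    (hlam : 0 ≤ lam) {F : α → Conf} (hF : Measurable F) {y : α → ℝ} (hy : Measurable y)
    {h : α → ℝ → ℝ≥0∞} (hh : Measurable (Function.uncurry h)) :
    Measurable fun x => ∫⁻ z, h x z ∂landingLaw q lam (F x) (y x) := by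
  have := Measurable.lintegral_kernel_prod_right
    (κ := (landKernel q lam).comap (fun x => (F x, y x)) (hF.prodMk hy)) hh
  simpa only [Kernel.comap_apply, landKernel_apply hq0 hlam] using this

/-- All flights that reach `v` give the same value and are lumped into one term of weight `reach q
lam η y v`. -/
theorem lintegral_landingLaw_of_const {q lam : ℝ} (hq0 : 0 ≤ q) (hq1 : q ≤ 1) (hlam : 0 < lam)
    (η : Conf) {y v : ℝ} (hyv : y < v) {h : ℝ → ℝ≥0∞} (hh : Measurable h) {h₀ : ℝ≥0∞}
    (hv : ∀ z, v ≤ z → h z = h₀) : ∫⁻ z, h z ∂landingLaw q lam η y =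
      ∫⁻ z in Set.Ioo y v, ENNReal.ofReal (reach q lam η y z) * h z ∂trap q lam η
        + ENNReal.ofReal (reach q lam η y v) * h₀ := by
  have h1 : ∫⁻ z in Set.Ici v, h z ∂landingLaw q lam η y =
      ENNReal.ofReal (reach q lam η y v) * h₀ := by
    rw [setLIntegral_congr_fun (g := fun _ => h₀) measurableSet_Ici hv, lintegral_const,
      Measure.restrict_apply_univ, landingLaw_Ici hq0 hq1 hlam η hyv, mul_comm]
  have h2 : ∫⁻ z in Set.Iio v, h z ∂landingLaw q lam η y =
      ∫⁻ z in Set.Ioo y v, ENNReal.ofReal (reach q lam η y z) * h z ∂trap q lam η := by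
    rw [← lintegral_indicator measurableSet_Iio,
      lintegral_landingLaw hq0 hlam.le η y (hh.indicator measurableSet_Iio),
      ← lintegral_indicator measurableSet_Ioi, ← lintegral_indicator measurableSet_Ioo]
    refine lintegral_congr fun z => ?_
    by_cases h3 : y < z <;> by_cases h4 : z < v <;> simp [Set.indicator, h3, h4]
  rw [← lintegral_add_compl _ (measurableSet_Iio (a := v)), Set.compl_Iio, h1, h2]

theorem measurable_indicator_lintegral_move {q lam : ℝ} (hq0 : 0 ≤ q) (hlam : 0 ≤ lam)
    {G : Conf → ℝ≥0∞} (hG : Measurable G) (a v : ℝ) :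
    Measurable (Function.uncurry fun η : Conf => (Set.Ioo a v).indicator fun y =>
      ∫⁻ z, G (η.move y z) ∂landingLaw q lam η y) := by
  have h1 : Measurable fun p : Conf × ℝ => ∫⁻ z, G (p.1.move p.2 z) ∂landingLaw q lam p.1 p.2 :=
    measurable_lintegral_landingLaw hq0 hlam measurable_fst measurable_snd
      (hG.comp (Conf.measurable_move (measurable_fst.comp measurable_fst)
        (measurable_snd.comp measurable_fst) measurable_snd))
  exact h1.indicator (measurable_snd (measurableSet_Ioo (a := a) (b := v)))

/-- The stationarity of the particles in the window `(a, v)`, if flying particles arrive at `a` at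
rate `c`. -/
theorem IsBalanced.window {q lam c : ℝ} (hq0 : 0 ≤ q) (hq1 : q ≤ 1) (hlam : 0 < lam)
    {μ : Measure Conf} (hμ : IsBalanced q lam c μ) {a v : ℝ}
    (hav : a < v) {G : Conf → ℝ≥0∞} (hG : Measurable G)
    (hloc : ∀ η ζ : Conf, (∀ x ∈ Set.Ioo a v, η x = ζ x) → G η = G ζ) :
    ∫⁻ η, ∫⁻ y in Set.Ioo a v, ∫⁻ z, G (η.move y z) ∂landingLaw q lam η y ∂dep q η ∂μ
      + ENNReal.ofReal c * ∫⁻ η, ∫⁻ z, G (η.add z 1) ∂landingLaw q lam η a ∂μ =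
    ∫⁻ η, dep q η (Set.Ioo a v) * G η ∂μ + ENNReal.ofReal c * ∫⁻ η, G η ∂μ := by
  have hadd : ∀ (η : Conf) (z : ℝ), v ≤ z → G (η.add z 1) = G η := fun η z hz =>
    hloc _ _ fun x hx => η.add_of_ne (hx.2.trans_le hz).ne 1
  have hGm : Measurable fun p : Conf × ℝ => G (p.1.add p.2 1) :=
    hG.comp (Conf.measurable_add measurable_fst measurable_snd 1)
  have hGz : ∀ η : Conf, Measurable fun z => G (η.add z 1) := fun η =>
    hG.comp (Conf.measurable_add measurable_const measurable_id 1)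
  set Ψ : Conf → ℝ → ℝ≥0∞ := fun η => (Set.Ioo a v).indicator fun y =>
    ∫⁻ z, G (η.move y z) ∂landingLaw q lam η y with hΨ
  have hΨm : Measurable (Function.uncurry Ψ) :=
    measurable_indicator_lintegral_move hq0 hlam.le hG a v
  have hdep : ∫⁻ η, ∫⁻ y in Set.Ioo a v, ∫⁻ z, G (η.move y z) ∂landingLaw q lam η y ∂dep q η ∂μ
      = ENNReal.ofReal c * ∫⁻ η, ∫⁻ y in Set.Ioo a v, ∫⁻ z, G (η.add z 1)
          ∂landingLaw q lam η y ∂trap q lam η ∂μ := by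
    have h1 := hμ Ψ hΨm
    simp only [hΨ, lintegral_indicator measurableSet_Ioo] at h1
    rw [h1]
    congr 1
    refine lintegral_congr fun η => ?_
    rw [← lintegral_indicator measurableSet_Ioo]
    refine lintegral_congr fun y => ?_
    simp only [Set.indicator]
    split_ifs
    -- The particle inserted by the balance equation is the one that jumps, so only its landing
    -- point `z` remains visible.
    · rw [landingLaw_congr hq0 hlam.le fun x hx => η.add_of_ne (ne_of_gt hx) 1]
      simp_rw [Conf.move_add_one]
    · rfl
  -- For the loss term, `Ψ` does not look at the departure location except for its membership in the
  -- window.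
  have harr : ∫⁻ η, dep q η (Set.Ioo a v) * G η ∂μ =
      ENNReal.ofReal c * ∫⁻ η, ∫⁻ z in Set.Ioo a v, G (η.add z 1) ∂trap q lam η ∂μ := by
    have h1 := hμ (fun η => (Set.Ioo a v).indicator fun _ => G η)
      ((hG.comp measurable_fst).indicator (measurable_snd measurableSet_Ioo))
    simp only [lintegral_indicator measurableSet_Ioo, setLIntegral_const] at h1
    simp_rw [mul_comm (dep q _ _)]
    rw [h1]
    congr 1
    refine lintegral_congr fun η => ?_
    rw [← lintegral_indicator measurableSet_Ioo]
    rfl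
  rw [hdep, harr, ← mul_add, ← mul_add]
  have hm1 : Measurable fun η : Conf => ∫⁻ z, G (η.add z 1) ∂landingLaw q lam η a :=
    measurable_lintegral_landingLaw hq0 hlam.le measurable_id measurable_const hGm
  rw [← lintegral_add_right _ hm1, ← lintegral_add_right _ hG]
  congr 1
  refine lintegral_congr fun η => ?_
  have hr : Measurable fun p : ℝ × ℝ => ENNReal.ofReal (reach q lam η p.1 p.2) :=
    (measurable_reach q lam measurable_const measurable_fst measurable_snd).ennreal_ofReal
  have hrv : ∀ z, Measurable fun y => ENNReal.ofReal (reach q lam η y z) := fun z =>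
    (measurable_reach q lam measurable_const measurable_id measurable_const).ennreal_ofReal
  have hra : ∀ y, Measurable fun z => ENNReal.ofReal (reach q lam η y z) := fun y =>
    (measurable_reach q lam measurable_const measurable_const measurable_id).ennreal_ofReal
  rw [lintegral_landingLaw_of_const hq0 hq1 hlam η hav (hGz η) fun z hz => hadd η z hz]
  have e1 : ∫⁻ y in Set.Ioo a v, ∫⁻ z, G (η.add z 1) ∂landingLaw q lam η y ∂trap q lam η =
      ∫⁻ z in Set.Ioo a v, (∫⁻ y in Set.Ioo a z, ENNReal.ofReal (reach q lam η y z)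
        ∂trap q lam η) * G (η.add z 1) ∂trap q lam η +
      (∫⁻ y in Set.Ioo a v, ENNReal.ofReal (reach q lam η y v) ∂trap q lam η) * G η := by
    have e2 : ∫⁻ y in Set.Ioo a v, ∫⁻ z, G (η.add z 1) ∂landingLaw q lam η y ∂trap q lam η =
        ∫⁻ y in Set.Ioo a v, (∫⁻ z in Set.Ioo y v, ENNReal.ofReal (reach q lam η y z) *
          G (η.add z 1) ∂trap q lam η + ENNReal.ofReal (reach q lam η y v) * G η)
          ∂trap q lam η :=
      setLIntegral_congr_fun measurableSet_Ioo fun y hy =>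
        lintegral_landingLaw_of_const hq0 hq1 hlam η hy.2 (hGz η) fun z hz => hadd η z hz
    rw [e2, lintegral_add_right _ ((hrv v).mul_const _), lintegral_mul_const _ (hrv v)]
    congr 1
    -- With the constraints `a < y < z < v` put into the integrand, Tonelli exchanges the starting
    -- point `y` and the landing point `z`.
    set k : ℝ → ℝ → ℝ≥0∞ := fun y z => if a < y ∧ y < z ∧ z < v then
      ENNReal.ofReal (reach q lam η y z) * G (η.add z 1) else 0 with hk
    have hkm : Measurable (Function.uncurry k) := by
      refine Measurable.ite ?_ (hr.mul ((hGz η).comp measurable_snd)) measurable_const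
      exact (measurableSet_lt measurable_const measurable_fst).inter
        ((measurableSet_lt measurable_fst measurable_snd).inter
          (measurableSet_lt measurable_snd measurable_const))
    have l1 : ∫⁻ y in Set.Ioo a v, ∫⁻ z in Set.Ioo y v, ENNReal.ofReal (reach q lam η y z) *
          G (η.add z 1) ∂trap q lam η ∂trap q lam η =
        ∫⁻ y, ∫⁻ z, k y z ∂trap q lam η ∂trap q lam η := by
      rw [← lintegral_indicator measurableSet_Ioo]
      refine lintegral_congr fun y => ?_
      by_cases hy : y ∈ Set.Ioo a v
      · rw [Set.indicator_of_mem hy, ← lintegral_indicator measurableSet_Ioo]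
        refine lintegral_congr fun z => ?_
        simp [hk, Set.indicator, hy.1]
      · rw [Set.indicator_of_notMem hy]
        refine (lintegral_eq_zero_of_ae_eq_zero (Eventually.of_forall fun z => ?_)).symm
        refine if_neg fun h => hy ⟨h.1, h.2.1.trans h.2.2⟩
    have l2 : ∫⁻ z in Set.Ioo a v, (∫⁻ y in Set.Ioo a z, ENNReal.ofReal (reach q lam η y z)
        ∂trap q lam η) * G (η.add z 1) ∂trap q lam η =
        ∫⁻ z, ∫⁻ y, k y z ∂trap q lam η ∂trap q lam η := by
      rw [← lintegral_indicator measurableSet_Ioo]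
      refine lintegral_congr fun z => ?_
      by_cases hz : z ∈ Set.Ioo a v
      · rw [Set.indicator_of_mem hz, ← lintegral_mul_const _ (hrv z),
          ← lintegral_indicator measurableSet_Ioo]
        refine lintegral_congr fun y => ?_
        simp [hk, Set.indicator, hz.2]
      · rw [Set.indicator_of_notMem hz]
        refine (lintegral_eq_zero_of_ae_eq_zero (Eventually.of_forall fun y => ?_)).symm
        refine if_neg fun h => hz ⟨h.1.trans h.2.1, h.2.2⟩
    rw [l1, l2, lintegral_lintegral_swap hkm.aemeasurable]
  rw [e1]
  have e3 := lintegral_reach_left hq0 hq1 hlam.le η hav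
  -- For fixed `z`, flights that start inside `(a, z)` and those that arrive over `a` together have
  -- mass `1` by the backward identity. The same identity at `v`, `e3`, accounts for the flights
  -- that leave the window.
  have e4 : ∫⁻ z in Set.Ioo a v, (∫⁻ y in Set.Ioo a z, ENNReal.ofReal (reach q lam η y z)
        ∂trap q lam η) * G (η.add z 1) ∂trap q lam η +
      ∫⁻ z in Set.Ioo a v, ENNReal.ofReal (reach q lam η a z) * G (η.add z 1) ∂trap q lam η =
      ∫⁻ z in Set.Ioo a v, G (η.add z 1) ∂trap q lam η := by
    have hraG : Measurable fun z => ENNReal.ofReal (reach q lam η a z) * G (η.add z 1) :=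
      (hra a).mul (hGz η)
    rw [← lintegral_add_right _ hraG]
    refine setLIntegral_congr_fun measurableSet_Ioo fun z hz => ?_
    rw [← add_mul, lintegral_reach_left hq0 hq1 hlam.le η hz.1, one_mul]
  rw [add_add_add_comm, e4, ← add_mul, e3, one_mul]

/-! ### Stationarity -/

theorem setLIntegral_dep_eq_sum (q : ℝ) (η : Conf) {B : Set ℝ} (hB : MeasurableSet B) (S : Finset ℝ)
    (hS : ∀ y, y ∈ S ↔ η y ≠ 0 ∧ y ∈ B) (h : ℝ → ℝ≥0∞) :
    ∫⁻ y in B, h y ∂dep q η = ∑ y ∈ S, ENNReal.ofReal (1 - q ^ η y) * h y := by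
  rw [← lintegral_indicator hB, lintegral_dep, tsum_eq_sum (s := S)]
  · exact Finset.sum_congr rfl fun y hy => by rw [Set.indicator_of_mem ((hS y).1 hy).2]
  · intro y hy
    by_cases h0 : η y = 0
    · simp [h0]
    · rw [Set.indicator_of_notMem fun h => hy ((hS y).2 ⟨h0, h⟩), mul_zero]

theorem dep_le_pts {q : ℝ} (hq0 : 0 ≤ q) (η : Conf) {B : Set ℝ} (hB : MeasurableSet B) :
    dep q η B ≤ η.pts B := by
  rw [← lintegral_indicator_one hB, ← lintegral_indicator_one hB, lintegral_dep, Conf.lintegral_pts]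
  refine ENNReal.tsum_le_tsum fun y => mul_le_mul_left ?_ _
  by_cases h0 : η y = 0
  · simp [h0]
  · calc ENNReal.ofReal (1 - q ^ η y) ≤ ENNReal.ofReal 1 :=
          ENNReal.ofReal_le_ofReal (by linarith [pow_nonneg hq0 (η y)])
      _ ≤ _ := by
          rw [ENNReal.ofReal_one]
          exact_mod_cast Nat.one_le_iff_ne_zero.2 h0

/-! ### Time derivative of the expectation under a balanced measure -/

section stationary

variable {q lam xi : ℝ} (hq0 : 0 ≤ q) (hq1 : q ≤ 1) (hlam : 0 < lam) (hxi : 0 ≤ xi)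
  {f : Conf → ℝ} (hf : Measurable f) {C : ℝ} (hC : ∀ η, |f η| ≤ C) {u v : ℝ}
  (hloc : ∀ η ζ : Conf, (∀ x ∈ Set.Icc u v, η x = ζ x) → f η = f ζ)

/-- The time derivative of `openSemigroup`. -/
def openDeriv (q lam xi t : ℝ) (f : Conf → ℝ) (a v : ℝ) (η : Conf) : ℝ :=
  truncGen q lam xi (η.num (Set.Ioo a v)) (semi q lam xi (η.num (Set.Ioo a v)) t f)
    (η.restrict (Set.Ioo a v))

include hq0 hq1 hlam hxi hf hC

theorem hasDerivAt_openSemigroup (t a v : ℝ) (η : Conf) :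
    HasDerivAt (fun s => openSemigroup q lam xi s f a v η) (openDeriv q lam xi t f a v η) t := by
  have h := hasDerivAt_semi hq0 hq1 hlam hxi (n := η.num (Set.Ioo a v)) hf hC t
    (η.restrict (Set.Ioo a v))
  have e : (fun s => openSemigroup q lam xi s f a v η) = fun s =>
      semi q lam xi (η.num (Set.Ioo a v)) s f (η.restrict (Set.Ioo a v)) :=
    funext fun s => finiteSemigroup_eq_semi q lam xi s f (restrict_Ioo_mem η a v)
  rw [e]
  exact h

theorem abs_openSemigroup_le {t : ℝ} (ht : 0 ≤ t) (a v : ℝ) (η : Conf) :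
    |openSemigroup q lam xi t f a v η| ≤ C :=
  finiteSemigroup_abs_le hq0 hq1 hlam hxi hf hC ht (restrict_Ioo_mem η a v)

theorem abs_openDeriv_le {t : ℝ} (ht : 0 ≤ t) (a v : ℝ) (η : Conf) :
    |openDeriv q lam xi t f a v η| ≤ 2 * (xi * η.num (Set.Ioo a v)) * C :=
  abs_truncGen_le hq0 hq1 hlam hxi (measurable_semi hq0 hq1 hlam hxi hf hC t)
    (abs_semi_le hq0 hq1 hlam hxi hf hC ht) _

include hloc

/-- The shift by `C` makes the observable nonnegative without changing the difference of gain and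
loss, so `IsBalanced.window` applies. Jumps of the restricted configuration may be replaced by jumps
of the full one because only `(a, v]` matters to the result. -/
theorem openDeriv_eq {t : ℝ} (ht : 0 ≤ t) {a v' : ℝ} (hv : v < v') (η : Conf) :
    openDeriv q lam xi t f a v' η = xi *
      ((∫⁻ y in Set.Ioo a v', ∫⁻ z, ENNReal.ofReal (openSemigroup q lam xi t f a v' (η.move y z) + C)
          ∂landingLaw q lam η y ∂dep q η).toReal -
        (dep q η (Set.Ioo a v') *
          ENNReal.ofReal (openSemigroup q lam xi t f a v' η + C)).toReal) := by
  classical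
  set G := openSemigroup q lam xi t f a v' with hG
  have hGm : Measurable G := measurable_openSemigroup hq0 hq1 hlam hxi hf hC t a v'
  have hGC : ∀ ζ, |G ζ| ≤ C := abs_openSemigroup_le hq0 hq1 hlam hxi hf hC ht a v'
  have hG0 : ∀ ζ, 0 ≤ G ζ + C := fun ζ => by linarith [(abs_le.1 (hGC ζ)).1]
  set n := η.num (Set.Ioo a v') with hn
  set ρ := η.restrict (Set.Ioo a v') with hρ
  have hρn : ρ ∈ atMost n := restrict_Ioo_mem η a v'
  set S := (finite_support_of_mem_atMost hρn).toFinset with hSdef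
  have hS : ∀ y, y ∈ S ↔ η y ≠ 0 ∧ y ∈ Set.Ioo a v' := by
    intro y
    rw [hSdef, Set.Finite.mem_toFinset, Function.mem_support]
    by_cases hy : y ∈ Set.Ioo a v'
    · rw [hρ, η.restrict_of_mem hy]; tauto
    · rw [hρ, η.restrict_of_notMem hy]; tauto
  have hq : ∀ m : ℕ, 0 ≤ 1 - q ^ m := fun m => sub_nonneg.2 (pow_le_one₀ hq0 hq1)
  have hint : ∀ y, Integrable (fun z => G (η.move y z)) (landingLaw q lam η y) := fun y =>
    integrable_move hq0 hq1 hlam hGm hGC _ _ _ _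
  have hland : ∀ y, ∫⁻ z, ENNReal.ofReal (G (η.move y z) + C) ∂landingLaw q lam η y =
      ENNReal.ofReal (∫ z, G (η.move y z) ∂landingLaw q lam η y + C) := by
    intro y
    have := isProbabilityMeasure_landingLaw hq0 hq1 hlam η y
    have hi := (hint y).add (integrable_const C)
    refine (ofReal_integral_eq_lintegral_ofReal hi (Eventually.of_forall fun z => hG0 _)).symm.trans ?_
    refine congrArg ENNReal.ofReal ((integral_add (hint y) (integrable_const C)).trans ?_)
    simp
  have hIC : ∀ y, 0 ≤ ∫ z, G (η.move y z) ∂landingLaw q lam η y + C := fun y => by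
    have := (abs_le.1 (abs_integral_move_le hq0 hq1 hlam hGC η y)).1
    linarith
  have h1 : (∫⁻ y in Set.Ioo a v', ∫⁻ z, ENNReal.ofReal (G (η.move y z) + C)
      ∂landingLaw q lam η y ∂dep q η).toReal =
      ∑ y ∈ S, (1 - q ^ η y) * (∫ z, G (η.move y z) ∂landingLaw q lam η y + C) := by
    rw [setLIntegral_dep_eq_sum q η measurableSet_Ioo S hS]
    simp_rw [hland, ← ENNReal.ofReal_mul (hq _)]
    rw [← ENNReal.ofReal_sum_of_nonneg fun y _ => mul_nonneg (hq _) (hIC y),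
      ENNReal.toReal_ofReal (Finset.sum_nonneg fun y _ => mul_nonneg (hq _) (hIC y))]
  have h2 : (dep q η (Set.Ioo a v') * ENNReal.ofReal (G η + C)).toReal =
      ∑ y ∈ S, (1 - q ^ η y) * (G η + C) := by
    rw [← setLIntegral_one, setLIntegral_dep_eq_sum q η measurableSet_Ioo S hS, ENNReal.toReal_mul,
      ENNReal.toReal_ofReal (hG0 η)]
    simp_rw [mul_one]
    rw [← ENNReal.ofReal_sum_of_nonneg fun y _ => hq _,
      ENNReal.toReal_ofReal (Finset.sum_nonneg fun y _ => hq _), Finset.sum_mul]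
  rw [h1, h2, ← Finset.sum_sub_distrib, Finset.mul_sum, openDeriv,
    truncGen_eq_sum hq0 hq1 hlam xi (measurable_semi hq0 hq1 hlam hxi hf hC t)
    (abs_semi_le hq0 hq1 hlam hxi hf hC ht) hρn]
  refine Finset.sum_congr rfl fun y hy => ?_
  have hyS := (hS y).1 hy
  have hρy : ρ y = η y := η.restrict_of_mem hyS.2
  have e1 : semi q lam xi n t f ρ = G η := (finiteSemigroup_eq_semi q lam xi t f hρn).symm
  -- The landing point may lie outside the window, but it lies to the right of `a`. The two
  -- configurations therefore agree up to `v`, which is enough by left locality.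
  have e2 : ∫ z, semi q lam xi n t f (ρ.move y z) ∂landingLaw q lam ρ y =
      ∫ z, G (η.move y z) ∂landingLaw q lam ρ y := by
    refine integral_congr_ae ?_
    filter_upwards [measure_eq_zero_iff_ae_notMem.1 (landingLaw_Iic hq0 hlam.le ρ y)] with z hz
    have hz' : y < z := not_le.1 hz
    have hm : ρ.move y z ∈ atMost n := move_mem_atMost hρn (hρy ▸ hyS.1) z
    rw [← finiteSemigroup_eq_semi q lam xi t f hm]
    refine finiteSemigroup_congr_left hq0 hq1 hlam hxi hf hC hloc t hm
      (restrict_Ioo_mem (η.move y z) a v') fun x hx => ?_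
    by_cases hxa : a < x
    · have hxI : x ∈ Set.Ioo a v' := ⟨hxa, hx.trans_lt hv⟩
      rw [Conf.restrict_of_mem _ hxI, Conf.move_apply, Conf.move_apply, hρ, η.restrict_of_mem hxI]
    · have hxI : x ∉ Set.Ioo a v' := fun h => hxa h.1
      have hxz : x ≠ z := fun h => hxa (h ▸ hyS.2.1.trans hz')
      rw [Conf.restrict_of_notMem _ hxI, Conf.move_apply, hρ, η.restrict_of_notMem hxI,
        if_neg hxz, Nat.zero_sub]
  -- The landing laws for `ρ` and `η` can differ beyond `v` only, where the integrand is constant.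
  have e3 : ∫ z, G (η.move y z) ∂landingLaw q lam ρ y = ∫ z, G (η.move y z) ∂landingLaw q lam η y := by
    refine integral_landingLaw_congr hq0 hq1 hlam (v := v) (fun x hx hyx => ?_)
      (hGm.comp (Conf.measurable_move measurable_const measurable_const measurable_id))
      (fun z => hGC _) (h₀ := G (η.move y (v + 1))) fun z hz => ?_
    · exact η.restrict_of_mem ⟨hyS.2.1.trans hyx, hx.trans_lt hv⟩
    · refine finiteSemigroup_congr_left hq0 hq1 hlam hxi hf hC hloc t (restrict_Ioo_mem _ a v')
        (restrict_Ioo_mem _ a v') fun x hx => ?_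
      by_cases hxI : x ∈ Set.Ioo a v'
      · rw [Conf.restrict_of_mem _ hxI, Conf.restrict_of_mem _ hxI, Conf.move_apply, Conf.move_apply,
          if_neg (hx.trans_lt hz).ne, if_neg (by linarith : x ≠ v + 1)]
      · rw [Conf.restrict_of_notMem _ hxI, Conf.restrict_of_notMem _ hxI]
  rw [e1, e2, e3, wakeRate, hρy]
  ring

variable {c : ℝ} (hc : 0 ≤ c) {μ : Measure Conf} [IsProbabilityMeasure μ]
  (hμ : IsBalanced q lam c μ)
  (hmean : ∀ a b : ℝ, ∫⁻ η, η.pts (Set.Ioo a b) ∂μ ≠ ⊤)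

/-- The bound for the effect of the particles that arrive at `a` until time `t`. -/
def arrivalBound (lam xi C u t a : ℝ) : ℝ :=
  2 * C * Real.exp (-(lam / 2 * u)) * Real.exp (2 * xi * t) * Real.exp (lam / 2 * a)

include hc hμ hmean

/-- By the window identity, gain minus loss is `c` times the mean change of the observable caused by
the missing arrivals at `a`. A particle inserted at `z` changes it by at most `arrivalBound` at `z`,
whose average over the landing law from `a` is controlled by the exponential moment. -/
theorem abs_integral_openDeriv_le {t : ℝ} (ht : 0 ≤ t) {a v' : ℝ} (hv : v < v') (hav : a < v') :
    Integrable (openDeriv q lam xi t f a v') μ ∧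
    |∫ η, openDeriv q lam xi t f a v' η ∂μ| ≤ xi * (c * (arrivalBound lam xi C u t a * 2)) := by
  have hC0 : 0 ≤ C := (abs_nonneg _).trans (hC ⟨fun _ => 0, fun _ _ => by simp⟩)
  set G := openSemigroup q lam xi t f a v' with hG
  have hGm : Measurable G := measurable_openSemigroup hq0 hq1 hlam hxi hf hC t a v'
  have hGC : ∀ ζ, |G ζ| ≤ C := abs_openSemigroup_le hq0 hq1 hlam hxi hf hC ht a v'
  set H : Conf → ℝ≥0∞ := fun η => ENNReal.ofReal (G η + C) with hH
  have hHm : Measurable H := (hGm.add_const C).ennreal_ofReal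
  have hHC : ∀ ζ, H ζ ≤ ENNReal.ofReal (2 * C) := fun ζ =>
    ENNReal.ofReal_le_ofReal (by linarith [(abs_le.1 (hGC ζ)).2])
  set gain : Conf → ℝ≥0∞ := fun η => ∫⁻ y in Set.Ioo a v', ∫⁻ z, H (η.move y z)
    ∂landingLaw q lam η y ∂dep q η with hgain
  set loss : Conf → ℝ≥0∞ := fun η => dep q η (Set.Ioo a v') * H η with hloss
  set ins : Conf → ℝ≥0∞ := fun η => ∫⁻ z, H (η.add z 1) ∂landingLaw q lam η a with hins
  have hwin : ∫⁻ η, gain η ∂μ + ENNReal.ofReal c * ∫⁻ η, ins η ∂μ =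
      ∫⁻ η, loss η ∂μ + ENNReal.ofReal c * ∫⁻ η, H η ∂μ := by
    refine hμ.window hq0 hq1 hlam hav hHm fun η ζ h => ?_
    have : η.restrict (Set.Ioo a v') = ζ.restrict (Set.Ioo a v') := by
      refine Conf.ext fun x => ?_
      by_cases hx : x ∈ Set.Ioo a v'
      · rw [η.restrict_of_mem hx, ζ.restrict_of_mem hx, h x hx]
      · rw [η.restrict_of_notMem hx, ζ.restrict_of_notMem hx]
    simp only [hH, hG, openSemigroup, this]
  have hgm : Measurable gain := by
    have := measurable_lintegral_dep q measurable_id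
      (measurable_indicator_lintegral_move hq0 hlam.le hHm a v')
    simp only [lintegral_indicator measurableSet_Ioo] at this
    exact this
  have hdm : Measurable fun η => dep q η (Set.Ioo a v') := by
    have := measurable_lintegral_dep q (measurable_id (α := Conf))
      (h := fun _ => (Set.Ioo a v').indicator 1)
      ((measurable_one.indicator measurableSet_Ioo).comp measurable_snd)
    simp only [lintegral_indicator_one measurableSet_Ioo] at this
    exact this
  have hlm : Measurable loss := hdm.mul hHm
  have hlfin : ∫⁻ η, loss η ∂μ ≠ ⊤ := by
    refine ne_top_of_le_ne_top (ENNReal.mul_ne_top (hmean a v') (ENNReal.ofReal_ne_top (r := 2 * C))) ?_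
    rw [← lintegral_mul_const' _ _ ENNReal.ofReal_ne_top]
    exact lintegral_mono fun η => mul_le_mul' (dep_le_pts hq0 η measurableSet_Ioo) (hHC η)
  have hHfin : ∫⁻ η, H η ∂μ ≠ ⊤ := by
    refine ne_top_of_le_ne_top (ENNReal.ofReal_ne_top (r := 2 * C)) ((lintegral_mono hHC).trans ?_)
    simp
  set ε := arrivalBound lam xi C u t a * 2 with hε
  have hε0 : 0 ≤ ε := by rw [hε, arrivalBound]; positivity
  -- The factor `2` in `ε` is the exponential moment bound `lam / (lam - lam / 2)`.
  have hmom : ∀ η : Conf, ∫⁻ z, ENNReal.ofReal (arrivalBound lam xi C u t z) ∂landingLaw q lam η a ≤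
      ENNReal.ofReal ε := by
    intro η
    have e : ∀ z, ENNReal.ofReal (arrivalBound lam xi C u t z) =
        ENNReal.ofReal (arrivalBound lam xi C u t a) *
          ENNReal.ofReal (Real.exp (lam / 2 * (z - a))) := by
      intro z
      rw [← ENNReal.ofReal_mul (by rw [arrivalBound]; positivity), arrivalBound, arrivalBound,
        mul_assoc _ (Real.exp (lam / 2 * a)), ← Real.exp_add]
      congr 3; ring
    rw [lintegral_congr e, lintegral_const_mul' _ _ ENNReal.ofReal_ne_top, hε, ENNReal.ofReal_mul (by
      rw [arrivalBound]; positivity)]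
    refine mul_le_mul_right ((lintegral_exp_landingLaw_le hq0 hq1 (by positivity)
      (half_lt_self hlam) η a).trans (le_of_eq ?_)) _
    congr 1; field_simp; norm_num
  -- Adding a particle at `z` changes nothing to the right of `z`, so the influence bound is used
  -- with `X = z`.
  have hdiff : ∀ (η : Conf) (z : ℝ), |G η - G (η.add z 1)| ≤ arrivalBound lam xi C u t z := by
    intro η z
    refine finiteSemigroup_sub_le hq0 hq1 hlam hxi hf hC hloc ht (restrict_Ioo_mem _ _ _)
      (restrict_Ioo_mem _ _ _) fun x hx => ?_
    by_cases hxI : x ∈ Set.Ioo a v'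
    · rw [Conf.restrict_of_mem _ hxI, Conf.restrict_of_mem _ hxI, η.add_of_ne (ne_of_gt hx)]
    · rw [Conf.restrict_of_notMem _ hxI, Conf.restrict_of_notMem _ hxI]
  have habm : Measurable fun z => ENNReal.ofReal (arrivalBound lam xi C u t z) := by
    unfold arrivalBound; fun_prop
  have hle1 : ∀ η, H η ≤ ins η + ENNReal.ofReal ε := by
    intro η
    have := isProbabilityMeasure_landingLaw hq0 hq1 hlam η a
    calc H η = ∫⁻ _, H η ∂landingLaw q lam η a := by simp
      _ ≤ ∫⁻ z, (H (η.add z 1) + ENNReal.ofReal (arrivalBound lam xi C u t z))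
            ∂landingLaw q lam η a := by
          refine lintegral_mono fun z => ?_
          refine le_trans (ENNReal.ofReal_le_ofReal ?_) ENNReal.ofReal_add_le
          linarith [(abs_le.1 (hdiff η z)).2]
      _ ≤ _ := by
          rw [lintegral_add_right _ habm]
          exact add_le_add_right (hmom η) _
  have hle2 : ∀ η, ins η ≤ H η + ENNReal.ofReal ε := by
    intro η
    have := isProbabilityMeasure_landingLaw hq0 hq1 hlam η a
    calc ins η ≤ ∫⁻ z, (H η + ENNReal.ofReal (arrivalBound lam xi C u t z))
            ∂landingLaw q lam η a := by
          refine lintegral_mono fun z => ?_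
          refine le_trans (ENNReal.ofReal_le_ofReal ?_) ENNReal.ofReal_add_le
          linarith [(abs_le.1 (hdiff η z)).1]
      _ ≤ _ := by
          rw [lintegral_add_right _ habm]
          refine add_le_add (by simp) (hmom η)
  have hLe1 : ∫⁻ η, H η ∂μ ≤ ∫⁻ η, ins η ∂μ + ENNReal.ofReal ε := by
    refine (lintegral_mono hle1).trans (le_of_eq ?_)
    rw [lintegral_add_right _ measurable_const]; simp
  have hLe2 : ∫⁻ η, ins η ∂μ ≤ ∫⁻ η, H η ∂μ + ENNReal.ofReal ε := by
    refine (lintegral_mono hle2).trans (le_of_eq ?_)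
    rw [lintegral_add_right _ measurable_const]; simp
  have hifin : ∫⁻ η, ins η ∂μ ≠ ⊤ :=
    ne_top_of_le_ne_top (ENNReal.add_ne_top.2 ⟨hHfin, ENNReal.ofReal_ne_top⟩) hLe2
  have hgfin : ∫⁻ η, gain η ∂μ ≠ ⊤ := by
    refine ne_top_of_le_ne_top (ENNReal.add_ne_top.2 ⟨hlfin, ENNReal.mul_ne_top
      ENNReal.ofReal_ne_top hHfin⟩) (le_trans le_self_add hwin.le)
  have hgi := integrable_toReal_of_lintegral_ne_top hgm.aemeasurable hgfin
  have hli := integrable_toReal_of_lintegral_ne_top hlm.aemeasurable hlfin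
  have hd : openDeriv q lam xi t f a v' = fun η => xi * ((gain η).toReal - (loss η).toReal) :=
    funext fun η => openDeriv_eq hq0 hq1 hlam hxi hf hC hloc ht hv η
  refine ⟨by rw [hd]; exact (hgi.sub hli).const_mul xi, ?_⟩
  have hint : ∫ η, openDeriv q lam xi t f a v' η ∂μ =
      xi * ((∫⁻ η, gain η ∂μ).toReal - (∫⁻ η, loss η ∂μ).toReal) := by
    rw [hd, integral_const_mul, integral_sub hgi hli,
      integral_toReal hgm.aemeasurable (ae_lt_top hgm hgfin),
      integral_toReal hlm.aemeasurable (ae_lt_top hlm hlfin)]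
  have hw := congrArg ENNReal.toReal hwin
  rw [ENNReal.toReal_add hgfin (ENNReal.mul_ne_top ENNReal.ofReal_ne_top hifin),
    ENNReal.toReal_add hlfin (ENNReal.mul_ne_top ENNReal.ofReal_ne_top hHfin),
    ENNReal.toReal_mul, ENNReal.toReal_mul, ENNReal.toReal_ofReal hc] at hw
  have r1 := ENNReal.toReal_mono (ENNReal.add_ne_top.2 ⟨hifin, ENNReal.ofReal_ne_top⟩) hLe1
  have r2 := ENNReal.toReal_mono (ENNReal.add_ne_top.2 ⟨hHfin, ENNReal.ofReal_ne_top⟩) hLe2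
  rw [ENNReal.toReal_add hifin ENNReal.ofReal_ne_top, ENNReal.toReal_ofReal hε0] at r1
  rw [ENNReal.toReal_add hHfin ENNReal.ofReal_ne_top, ENNReal.toReal_ofReal hε0] at r2
  have e : (∫⁻ η, gain η ∂μ).toReal - (∫⁻ η, loss η ∂μ).toReal =
      c * ((∫⁻ η, H η ∂μ).toReal - (∫⁻ η, ins η ∂μ).toReal) := by linarith
  rw [hint, e, abs_mul, abs_mul, abs_of_nonneg hxi, abs_of_nonneg hc]
  refine mul_le_mul_of_nonneg_left (mul_le_mul_of_nonneg_left ?_ hc) hxi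
  rw [abs_le]
  constructor <;> linarith

theorem abs_integral_openSemigroup_sub_le {t : ℝ} (ht : 0 ≤ t) {a v' : ℝ} (hv : v < v')
    (hav : a < v') : |∫ η, openSemigroup q lam xi t f a v' η ∂μ -
      ∫ η, openSemigroup q lam xi 0 f a v' η ∂μ| ≤
        t * (xi * (c * (arrivalBound lam xi C u t a * 2))) := by
  have hC0 : 0 ≤ C := (abs_nonneg _).trans (hC ⟨fun _ => 0, fun _ _ => by simp⟩)
  rcases ht.eq_or_lt with rfl | ht0
  · simp
  have hm : ∀ s, Measurable (openSemigroup q lam xi s f a v') := fun s =>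
    measurable_openSemigroup hq0 hq1 hlam hxi hf hC s a v'
  -- The derivative is dominated by the number of particles in the window, which has a finite mean
  -- and does not depend on time.
  have hNm : Integrable (fun η : Conf => 2 * (xi * (η.num (Set.Ioo a v') : ℝ)) * C) μ := by
    have h1 : Measurable fun η : Conf => η.pts (Set.Ioo a v') :=
      Conf.measurable_pts_section measurable_id (s := {p | p.2 ∈ Set.Ioo a v'})
        (measurable_snd measurableSet_Ioo)
    have h2 := integrable_toReal_of_lintegral_ne_top h1.aemeasurable (hmean a v')
    simp_rw [Conf.pts_Ioo, ENNReal.toReal_natCast] at h2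
    exact ((h2.const_mul xi).const_mul 2).mul_const C
  have hcont : ContinuousOn (fun s => ∫ η, openSemigroup q lam xi s f a v' η ∂μ) (Set.Icc 0 t) := by
    refine continuousOn_of_dominated (bound := fun _ => C) (fun s _ => (hm s).aestronglyMeasurable)
      (fun s hs => Eventually.of_forall fun η => ?_) (integrable_const C)
      (Eventually.of_forall fun η s _ => ?_)
    · exact abs_openSemigroup_le hq0 hq1 hlam hxi hf hC hs.1 a v' η
    · exact (hasDerivAt_openSemigroup hq0 hq1 hlam hxi hf hC s a v'
        η).continuousAt.continuousWithinAt
  have hder : ∀ s ∈ Set.Ioo 0 t, HasDerivAt (fun s => ∫ η, openSemigroup q lam xi s f a v' η ∂μ)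
      (∫ η, openDeriv q lam xi s f a v' η ∂μ) s := by
    intro s hs
    refine (hasDerivAt_integral_of_dominated_loc_of_deriv_le (s := Set.Ioi 0) (Ioi_mem_nhds hs.1)
      (Eventually.of_forall fun r => (hm r).aestronglyMeasurable) ?_ ?_
      (Eventually.of_forall fun η r hr => ?_) hNm
      (Eventually.of_forall fun η r _ =>
        hasDerivAt_openSemigroup hq0 hq1 hlam hxi hf hC r a v' η)).2
    · exact Integrable.of_bound (hm s).aestronglyMeasurable C (Eventually.of_forall fun η =>
        abs_openSemigroup_le hq0 hq1 hlam hxi hf hC hs.1.le a v' η)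
    · exact (abs_integral_openDeriv_le hq0 hq1 hlam hxi hf hC hloc hc hμ hmean hs.1.le hv
        hav).1.aestronglyMeasurable
    · exact abs_openDeriv_le hq0 hq1 hlam hxi hf hC (le_of_lt hr) a v' η
  -- The mean value theorem gives a bound at an intermediate time `s`; `arrivalBound` grows with
  -- time, so `t` may replace `s`.
  obtain ⟨s, hs, heq⟩ := exists_hasDerivAt_eq_slope _ _ ht0 hcont hder
  have hb := (abs_integral_openDeriv_le hq0 hq1 hlam hxi hf hC hloc hc hμ hmean hs.1.le hv hav).2
  rw [heq, sub_zero, abs_div, abs_of_pos ht0, div_le_iff₀ ht0, mul_comm _ t] at hb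
  refine hb.trans ?_
  have : arrivalBound lam xi C u s a ≤ arrivalBound lam xi C u t a := by
    unfold arrivalBound
    have := hs.2.le
    gcongr
  gcongr

/-- As `a → -∞` the expectations over the windows converge to those of the whole line, at times `t`
and `0`, while the effect of the missing arrivals tends to zero. -/
theorem integral_transitionOp_eq {t : ℝ} (ht : 0 ≤ t) :
    ∫ η, transitionOp q lam xi t f η ∂μ = ∫ η, f η ∂μ := by
  have hti : ∀ s, 0 ≤ s → Integrable (transitionOp q lam xi s f) μ := fun s hs =>
    Integrable.of_bound (measurable_transitionOp hq0 hq1 hlam hxi hf hC hloc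
      hs).aestronglyMeasurable C (Eventually.of_forall
        (abs_transitionOp_le hq0 hq1 hlam hxi hf hC hloc hs))
  have h1 : ∀ s, 0 ≤ s → Tendsto (fun a => ∫ η, openSemigroup q lam xi s f a (v + 1) η ∂μ) atBot
      (𝓝 (∫ η, transitionOp q lam xi s f η ∂μ)) := by
    intro s hs
    refine tendsto_integral_filter_of_dominated_convergence (fun _ => C)
      (Eventually.of_forall fun a => (measurable_openSemigroup hq0 hq1 hlam hxi hf hC s a
        (v + 1)).aestronglyMeasurable) (Eventually.of_forall fun a => Eventually.of_forall fun η => ?_)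
      (integrable_const C) (Eventually.of_forall fun η =>
        tendsto_openSemigroup hq0 hq1 hlam hxi hf hC hloc hs η (lt_add_one v))
    exact abs_openSemigroup_le hq0 hq1 hlam hxi hf hC hs a (v + 1) η
  have h2 : ∀ η, transitionOp q lam xi 0 f η = f η := by
    intro η
    refine tendsto_nhds_unique (tendsto_openSemigroup hq0 hq1 hlam hxi hf hC hloc le_rfl η
      (lt_add_one v)) (tendsto_const_nhds.congr' ?_)
    filter_upwards [Iio_mem_atBot u] with a ha
    -- At time `0` only the term `k = 0` of the exponential series survives.
    rw [openSemigroup, finiteSemigroup, tsum_eq_single 0]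
    · simp only [pow_zero, Nat.factorial_zero, Nat.cast_one, div_one, one_mul,
        Function.iterate_zero, id_eq]
      refine hloc _ _ fun x hx => ?_
      have hxI : x ∈ Set.Ioo a (v + 1) := ⟨lt_of_lt_of_le ha hx.1, by linarith [hx.2]⟩
      exact (η.restrict_of_mem hxI).symm
    · intro k hk
      simp [hk]
  have h3 : Tendsto (fun a => t * (xi * (c * (arrivalBound lam xi C u t a * 2)))) atBot (𝓝 0) := by
    have : Tendsto (fun a : ℝ => Real.exp (lam / 2 * a)) atBot (𝓝 0) :=
      Real.tendsto_exp_atBot.comp (tendsto_id.const_mul_atBot (half_pos hlam))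
    unfold arrivalBound
    simpa using ((((this.const_mul (2 * C * Real.exp (-(lam / 2 * u)) *
      Real.exp (2 * xi * t))).mul_const 2).const_mul c).const_mul xi).const_mul t
  have h4 := ((h1 t ht).sub (h1 0 le_rfl)).abs
  have h5 := le_of_tendsto_of_tendsto h4 h3 (by
    filter_upwards [Iio_mem_atBot (v + 1)] with a ha
    exact abs_integral_openSemigroup_sub_le hq0 hq1 hlam hxi hf hC hloc hc hμ hmean ht
      (lt_add_one v) ha)
  simp_rw [h2] at h5
  exact sub_eq_zero.1 (abs_eq_zero.1 (le_antisymm h5 (abs_nonneg _)))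

end stationary

theorem IsBalanced.isStationary {q lam xi c : ℝ} (hq0 : 0 ≤ q) (hq1 : q ≤ 1) (hlam : 0 < lam)
    (hxi : 0 ≤ xi) (hc : 0 ≤ c) {μ : Measure Conf} [hp : IsProbabilityMeasure μ]
    (hμ : IsBalanced q lam c μ) (hmean : ∀ a b : ℝ, ∫⁻ η, η.pts (Set.Ioo a b) ∂μ ≠ ⊤) :
    IsStationary q lam xi μ where
  isProbabilityMeasure := hp
  existsFrom := Eventually.of_forall (existsFrom hq0 hq1 hlam hxi)
  law t ht f hf := by
    obtain ⟨C, hC⟩ := hf.bounded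
    obtain ⟨u, v, hloc⟩ := hf.isLocal
    exact ⟨Integrable.of_bound (measurable_transitionOp hq0 hq1 hlam hxi hf.measurable hC hloc
      ht).aestronglyMeasurable C (Eventually.of_forall
        (abs_transitionOp_le hq0 hq1 hlam hxi hf.measurable hC hloc ht)),
      integral_transitionOp_eq hq0 hq1 hlam hxi hf.measurable hC hloc hc hμ hmean ht⟩

/-! ### Infinite products of probability measures -/

section InfinitePi

variable {ι : Type*} [DecidableEq ι] {X : ι → Type*} [∀ i, MeasurableSpace (X i)]
  (P : ∀ i, Measure (X i)) [∀ i, IsProbabilityMeasure (P i)]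

theorem measurable_update_prod (k : ι) :
    Measurable fun p : (∀ i, X i) × X k => Function.update p.1 k p.2 := by
  refine measurable_pi_iff.2 fun i => ?_
  by_cases hi : i = k
  · subst hi; simpa using measurable_snd
  · simp only [Function.update_of_ne hi]
    exact (measurable_pi_apply i).comp measurable_fst

/-- Resampling one coordinate independently preserves a product measure; this is how a single cell
or a single point is isolated below. -/
theorem infinitePi_map_update (k : ι) :
    ((Measure.infinitePi P).prod (P k)).map (fun p => Function.update p.1 k p.2) =
      Measure.infinitePi P := by
  refine Measure.eq_infinitePi P fun s t ht => ?_
  have hs : MeasurableSet (Set.pi (s : Set ι) t) := .pi s.countable_toSet fun i _ => ht i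
  rw [Measure.map_apply (measurable_update_prod k) hs]
  have e : (fun p : (∀ i, X i) × X k => Function.update p.1 k p.2) ⁻¹' Set.pi (s : Set ι) t =
      (Set.pi ((s.erase k : Finset ι) : Set ι) t) ×ˢ (if k ∈ s then t k else Set.univ) := by
    ext ⟨ω, e⟩
    simp only [Set.mem_preimage, Set.mem_pi, Set.mem_prod, Finset.mem_coe, Finset.mem_erase]
    constructor
    · intro h
      refine ⟨fun i hi => by simpa [hi.1] using h i hi.2, ?_⟩
      split_ifs with hk
      · simpa using h k hk
      · trivial
    · rintro ⟨h1, h2⟩ i hi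
      by_cases hik : i = k
      · subst hik; simpa [hi] using h2
      · simpa [hik] using h1 i ⟨hik, hi⟩
  rw [e, Measure.prod_prod, Measure.infinitePi_pi P fun i _ => ht i]
  split_ifs with hk
  · rw [Finset.prod_erase_mul _ _ hk]
  · rw [Finset.erase_eq_of_notMem hk, measure_univ, mul_one]

theorem lintegral_infinitePi_update (k : ι) {F : (∀ i, X i) → ℝ≥0∞} (hF : Measurable F) :
    ∫⁻ ω, F ω ∂Measure.infinitePi P =
      ∫⁻ ω, ∫⁻ e, F (Function.update ω k e) ∂P k ∂Measure.infinitePi P := by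
  conv_lhs => rw [← infinitePi_map_update P k]
  rw [lintegral_map hF (measurable_update_prod k)]
  exact lintegral_prod _ (hF.comp (measurable_update_prod k)).aemeasurable

end InfinitePi

/-- An infinite product of copies of a probability measure is exchangeable. -/
theorem lintegral_infinitePi_perm {ι E : Type*} [MeasurableSpace E] (ν : Measure E)
    [IsProbabilityMeasure ν] (σ : Equiv.Perm ι) {F : (ι → E) → ℝ≥0∞} (hF : Measurable F) :
    ∫⁻ s, F (s ∘ σ) ∂Measure.infinitePi (fun _ : ι => ν) =
      ∫⁻ s, F s ∂Measure.infinitePi (fun _ : ι => ν) := by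
  have hm : Measurable fun s : ι → E => s ∘ σ :=
    measurable_pi_iff.2 fun i => measurable_pi_apply (σ i)
  have e : (Measure.infinitePi (fun _ : ι => ν)).map (fun s => s ∘ σ) =
      Measure.infinitePi (fun _ : ι => ν) := by
    classical
    refine Measure.eq_infinitePi _ fun s t ht => ?_
    rw [Measure.map_apply hm (.pi s.countable_toSet fun i _ => ht i)]
    have : (fun x : ι → E => x ∘ σ) ⁻¹' Set.pi (s : Set ι) t =
        Set.pi ((s.map σ.toEmbedding : Finset ι) : Set ι) fun i => t (σ.symm i) := by
      ext x
      simp only [Set.mem_preimage, Set.mem_pi, Function.comp_apply, Finset.coe_map,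
        Equiv.coe_toEmbedding, Set.forall_mem_image, Finset.mem_coe, Equiv.symm_apply_apply]
    rw [this, Measure.infinitePi_pi _ fun i _ => ht _, Finset.prod_map]
    simp
  conv_rhs => rw [← e]
  rw [lintegral_map hF hm]

/-! ### Poisson samples -/

theorem measurable_sum_range {α : Type*} [MeasurableSpace α] {N : α → ℕ} (hN : Measurable N)
    {f : ℕ → α → ℝ≥0∞} (hf : ∀ i, Measurable (f i)) :
    Measurable fun x => ∑ i ∈ Finset.range (N x), f i x := by
  have e : (fun x => ∑ i ∈ Finset.range (N x), f i x) =
      fun x => ∑' i, if i < N x then f i x else 0 := by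
    funext x
    rw [tsum_eq_sum (s := Finset.range (N x)) fun i hi => if_neg (by simpa using hi)]
    exact Finset.sum_congr rfl fun i hi => (if_pos (Finset.mem_range.1 hi)).symm
  rw [e]
  exact Measurable.tsum fun i => Measurable.ite
    (measurableSet_lt measurable_const hN) (hf i) measurable_const

theorem lintegral_poissonMeasure (r : ℝ≥0) (g : ℕ → ℝ≥0∞) :
    ∫⁻ n, g n ∂poissonMeasure r =
      ∑' n, ENNReal.ofReal (Real.exp (-r) * r ^ n / n.factorial) * g n := by
  simp [poissonMeasure, lintegral_sum_measure]

/-- Size biasing a Poisson variable shifts it by one; this is the source of the Mecke formula. -/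
theorem poisson_weight_succ (r : ℝ≥0) (n : ℕ) :
    ENNReal.ofReal (Real.exp (-r) * r ^ (n + 1) / (n + 1).factorial) * (n + 1 : ℕ) =
      r * ENNReal.ofReal (Real.exp (-r) * r ^ n / n.factorial) := by
  rw [← ENNReal.ofReal_natCast, ← ENNReal.ofReal_coe_nnreal, ← ENNReal.ofReal_mul (by positivity),
    ← ENNReal.ofReal_mul (by positivity)]
  congr 1
  rw [Nat.factorial_succ]
  have : (n.factorial : ℝ) ≠ 0 := by positivity
  push_cast
  field_simp
  ring

/-- The Mecke formula for a Poisson number of independent samples. -/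
theorem lintegral_sum_poisson_samples {E : Type*} [MeasurableSpace E] (ν : Measure E)
    [IsProbabilityMeasure ν] (r : ℝ≥0) {F : E → ℕ × (ℕ → E) → ℝ≥0∞}
    (hF : Measurable (Function.uncurry F))
    (hsymm : ∀ e n s i, i ≤ n → F e (n + 1, s ∘ Equiv.swap i n) = F e (n + 1, s)) :
    ∫⁻ p, ∑ i ∈ Finset.range p.1, F (p.2 i) p
        ∂(poissonMeasure r).prod (Measure.infinitePi fun _ : ℕ => ν) =
      r * ∫⁻ p, ∫⁻ e, F e (p.1 + 1, Function.update p.2 p.1 e) ∂ν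
        ∂(poissonMeasure r).prod (Measure.infinitePi fun _ : ℕ => ν) := by
  have hFi : ∀ i, Measurable fun p : ℕ × (ℕ → E) => F (p.2 i) p := fun i => by
    have h : Measurable fun p : ℕ × (ℕ → E) => (p.2 i, p) :=
      ((measurable_pi_apply i).comp measurable_snd).prodMk measurable_id
    exact hF.comp h
  have hFn : ∀ n i, Measurable fun s : ℕ → E => F (s i) (n, s) := fun n i =>
    (hFi i).comp measurable_prodMk_left
  have hu : Measurable fun x : (ℕ × (ℕ → E)) × E => F x.2 (x.1.1 + 1, Function.update x.1.2 x.1.1 x.2) := by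
    refine hF.comp (measurable_snd.prodMk (((measurable_fst.comp measurable_fst).add_const 1).prodMk ?_))
    refine measurable_pi_iff.2 fun i => ?_
    simp only [Function.update_apply]
    exact Measurable.ite (measurableSet_eq_fun measurable_const (measurable_fst.comp measurable_fst))
      measurable_snd ((measurable_pi_apply i).comp (measurable_snd.comp measurable_fst))
  rw [lintegral_prod _ (measurable_sum_range measurable_fst hFi).aemeasurable,
    lintegral_prod _ hu.lintegral_prod_right'.aemeasurable, lintegral_poissonMeasure,
    lintegral_poissonMeasure, tsum_eq_zero_add' ENNReal.summable, ← ENNReal.tsum_mul_left]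
  simp only [Finset.range_zero, Finset.sum_empty, lintegral_zero, mul_zero, zero_add]
  -- Zero samples contribute nothing, so the left side is now indexed by `n + 1` samples and matches
  -- `n` samples on the right.
  refine tsum_congr fun n => ?_
  rw [lintegral_finsetSum _ fun i _ => hFn (n + 1) i]
  -- Exchangeability moves the chosen sample to the last slot `n`, where it can be resampled; the `n
  -- + 1` choices then contribute equally.
  have hi : ∀ i ∈ Finset.range (n + 1), ∫⁻ s, F (s i) (n + 1, s) ∂Measure.infinitePi (fun _ : ℕ => ν) =
      ∫⁻ s, ∫⁻ e, F e (n + 1, Function.update s n e) ∂ν ∂Measure.infinitePi (fun _ : ℕ => ν) := by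
    intro i hi
    rw [← lintegral_infinitePi_perm ν (Equiv.swap i n) (hFn (n + 1) i)]
    have e : ∀ s : ℕ → E, F ((s ∘ Equiv.swap i n) i) (n + 1, s ∘ Equiv.swap i n) =
        F (s n) (n + 1, s) := fun s => by
      rw [hsymm _ n s i (Nat.lt_succ_iff.1 (Finset.mem_range.1 hi))]
      simp
    simp_rw [e]
    rw [lintegral_infinitePi_update (fun _ : ℕ => ν) n (hFn (n + 1) n)]
    simp
  rw [Finset.sum_congr rfl hi, Finset.sum_const, Finset.card_range, nsmul_eq_mul, ← mul_assoc,
    poisson_weight_succ, mul_assoc]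

/-! ### The configuration of a marked Poisson process -/

namespace PoissonData

theorem toConf_apply (ω : PoissonData) (x : ℝ) : ω.toConf x = ∑ i ∈ Finset.range (ω ⌊x⌋).1,
    open Classical in if (⌊x⌋ : ℝ) + ((ω ⌊x⌋).2 i).1 = x then ((ω ⌊x⌋).2 i).2 else 0 := rfl

-- A sum over all real locations is regrouped by cells. A point whose position lies outside `[0, 1)`
-- falls into a foreign cell and is not seen by `toConf`, hence the condition on the right.
open Classical in
theorem tsum_cells (ω : PoissonData) (w : ℤ → ℕ → ℝ≥0∞) (h : ℝ → ℝ≥0∞) :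
    ∑' y, (∑ i ∈ Finset.range (ω ⌊y⌋).1, if (⌊y⌋ : ℝ) + ((ω ⌊y⌋).2 i).1 = y then w ⌊y⌋ i else 0) * h y =
      ∑' k, ∑ i ∈ Finset.range (ω k).1, if ((ω k).2 i).1 ∈ Set.Ico (0 : ℝ) 1 then
        w k i * h (k + ((ω k).2 i).1) else 0 := by
  have e1 : ∀ y, (∑ i ∈ Finset.range (ω ⌊y⌋).1,
      if (⌊y⌋ : ℝ) + ((ω ⌊y⌋).2 i).1 = y then w ⌊y⌋ i else 0) * h y =
      ∑' k : ℤ, ∑ i ∈ Finset.range (ω k).1,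
        if y = k + ((ω k).2 i).1 then if ⌊y⌋ = k then w k i * h y else 0 else 0 := by
    intro y
    rw [tsum_eq_single ⌊y⌋ fun k hk => by simp [hk.symm], Finset.sum_mul]
    refine Finset.sum_congr rfl fun i _ => ?_
    by_cases hy : y = ⌊y⌋ + ((ω ⌊y⌋).2 i).1
    · rw [if_pos hy.symm, if_pos hy, if_pos rfl]
    · rw [if_neg fun h => hy h.symm, if_neg hy, zero_mul]
  simp_rw [e1]
  rw [ENNReal.tsum_comm]
  refine tsum_congr fun k => ?_
  rw [Summable.tsum_finsetSum fun i _ => ENNReal.summable]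
  refine Finset.sum_congr rfl fun i _ => ?_
  rw [tsum_ite_eq]
  have : ⌊(k : ℝ) + ((ω k).2 i).1⌋ = k ↔ ((ω k).2 i).1 ∈ Set.Ico (0 : ℝ) 1 := by
    rw [Int.floor_intCast_add, add_eq_left, Int.floor_eq_zero_iff]
  simp only [this]

open Classical in
theorem lintegral_pts_toConf (ω : PoissonData) (h : ℝ → ℝ≥0∞) :
    ∫⁻ y, h y ∂ω.toConf.pts = ∑' k, ∑ i ∈ Finset.range (ω k).1,
      if ((ω k).2 i).1 ∈ Set.Ico (0 : ℝ) 1 then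
        (((ω k).2 i).2 : ℝ≥0∞) * h (k + ((ω k).2 i).1) else 0 := by
  rw [Conf.lintegral_pts, ← tsum_cells ω (fun k i => (((ω k).2 i).2 : ℝ≥0∞)) h]
  refine tsum_congr fun y => ?_
  rw [toConf_apply]
  push_cast
  rfl

theorem measurable_count (k : ℤ) : Measurable fun ω : PoissonData => (ω k).1 :=
  measurable_fst.comp (measurable_pi_apply k)

theorem measurable_position (k : ℤ) (i : ℕ) : Measurable fun ω : PoissonData => ((ω k).2 i).1 :=
  measurable_fst.comp ((measurable_pi_apply i).comp (measurable_snd.comp (measurable_pi_apply k)))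

theorem measurable_mark (k : ℤ) (i : ℕ) : Measurable fun ω : PoissonData => ((ω k).2 i).2 :=
  measurable_snd.comp ((measurable_pi_apply i).comp (measurable_snd.comp (measurable_pi_apply k)))

theorem measurable_toConf : Measurable toConf := by
  classical
  refine Conf.measurable_of_pts fun a b => ?_
  simp_rw [← lintegral_indicator_one measurableSet_Ioc, lintegral_pts_toConf]
  refine Measurable.tsum fun k => measurable_sum_range (measurable_count k) fun i => ?_
  refine Measurable.ite (measurable_position k i measurableSet_Ico) ?_ measurable_const
  exact ((measurable_from_nat (f := fun n => (n : ℝ≥0∞))).comp (measurable_mark k i)).mul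
    ((measurable_one.indicator measurableSet_Ioc).comp ((measurable_position k i).const_add _))

/-- The points lie in their cells and do not coincide. -/
def IsSimple (ω : PoissonData) : Prop :=
  ∀ k, (∀ i, ((ω k).2 i).1 ∈ Set.Ico (0 : ℝ) 1) ∧ ∀ i j, i ≠ j → ((ω k).2 i).1 ≠ ((ω k).2 j).1

/-- No linearity of `g` in the multiplicity is available, so every occupied location must come from
exactly one point. Points of mark `0` are harmless by `hg`. -/
theorem IsSimple.tsum_eq {ω : PoissonData} (hω : ω.IsSimple) {g : ℝ → ℝ≥0∞}
    (hg : ∀ y, ω.toConf y = 0 → g y = 0) :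
    ∑' y, g y = ∑' k, ∑ i ∈ Finset.range (ω k).1, g (k + ((ω k).2 i).1) := by
  classical
  have h := tsum_cells ω (fun _ _ => 1) g
  simp only [(hω _).1, if_true, one_mul] at h
  rw [← h]
  refine tsum_congr fun y => ?_
  by_cases hy : ω.toConf y = 0
  · rw [hg y hy, mul_zero]
  · rw [toConf_apply] at hy
    obtain ⟨i, hi, hne⟩ := Finset.exists_ne_zero_of_sum_ne_zero hy
    have hiy : (⌊y⌋ : ℝ) + ((ω ⌊y⌋).2 i).1 = y := by by_contra h; exact hne (if_neg h)
    rw [Finset.sum_eq_single i, if_pos hiy, one_mul]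
    · intro j _ hj
      refine if_neg fun h => (hω ⌊y⌋).2 j i hj ?_
      linarith
    · exact fun h => absurd hi h

/-- The new point goes into slot `p.1`, the first one not in use. -/
theorem toConf_insert (ω : PoissonData) (k : ℤ) (p : ℕ × (ℕ → ℝ × ℕ)) {e : ℝ × ℕ}
    (he : e.1 ∈ Set.Ico (0 : ℝ) 1) :
    toConf (Function.update ω k (p.1 + 1, Function.update p.2 p.1 e)) =
      (toConf (Function.update ω k p)).add (k + e.1) e.2 := by
  classical
  refine Conf.ext fun x => ?_
  rw [Conf.add_apply, toConf_apply, toConf_apply]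
  by_cases hx : ⌊x⌋ = k
  · rw [hx, Function.update_self, Function.update_self, Finset.sum_range_succ]
    simp only [Function.update_self]
    congr 1
    · refine Finset.sum_congr rfl fun i hi => ?_
      rw [Function.update_of_ne (Finset.mem_range.1 hi).ne]
    · simp only [eq_comm]
  · have hne : x ≠ k + e.1 := by
      rintro rfl
      refine hx ?_
      rw [Int.floor_intCast_add, add_eq_left, Int.floor_eq_zero_iff]
      exact he
    rw [if_neg hne, add_zero, Function.update_of_ne hx, Function.update_of_ne hx]

theorem toConf_swap (ω : PoissonData) (k : ℤ) (n : ℕ) (s : ℕ → ℝ × ℕ) {i : ℕ} (hi : i ≤ n) :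
    toConf (Function.update ω k (n + 1, s ∘ Equiv.swap i n)) =
      toConf (Function.update ω k (n + 1, s)) := by
  classical
  refine Conf.ext fun x => ?_
  rw [toConf_apply, toConf_apply]
  by_cases hx : ⌊x⌋ = k
  · rw [hx, Function.update_self, Function.update_self]
    refine Finset.sum_equiv (Equiv.swap i n) (fun j => ?_) fun j _ => rfl
    simp only [Finset.mem_range]
    rcases eq_or_ne j i with rfl | hji
    · rw [Equiv.swap_apply_left]; omega
    · rcases eq_or_ne j n with rfl | hjn
      · rw [Equiv.swap_apply_right]; omega
      · rw [Equiv.swap_apply_of_ne_of_ne hji hjn]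
  · rw [Function.update_of_ne hx, Function.update_of_ne hx]

end PoissonData

/-! ### The Mecke formula for the marked Poisson process -/

section marked

variable (r : ℝ≥0) (marks : PMF ℕ)

instance : IsProbabilityMeasure (poissonDataLaw r marks) := by
  unfold poissonDataLaw; infer_instance

instance : IsProbabilityMeasure (markedPoisson r marks) :=
  Measure.isProbabilityMeasure_map PoissonData.measurable_toConf.aemeasurable

theorem ae_position_mem : ∀ᵐ e ∂uniform01.prod marks.toMeasure, e.1 ∈ Set.Ico (0 : ℝ) 1 := by
  have h : ∀ᵐ x ∂uniform01, x ∈ Set.Ico (0 : ℝ) 1 := ae_restrict_mem measurableSet_Ico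
  exact Measure.quasiMeasurePreserving_fst.ae h

theorem ae_isSimple : ∀ᵐ ω ∂poissonDataLaw r marks, PoissonData.IsSimple ω := by
  have hs1 : ∀ᵐ s ∂Measure.infinitePi fun _ : ℕ => uniform01.prod marks.toMeasure,
      ∀ i, (s i).1 ∈ Set.Ico (0 : ℝ) 1 :=
    ae_all_iff.2 fun i => (measurePreserving_eval_infinitePi
      (fun _ : ℕ => uniform01.prod marks.toMeasure) i).quasiMeasurePreserving.ae
        (ae_position_mem marks)
  have hs2 : ∀ᵐ s ∂Measure.infinitePi fun _ : ℕ => uniform01.prod marks.toMeasure,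
      ∀ i j, i ≠ j → (s i).1 ≠ (s j).1 := by
    refine ae_all_iff.2 fun i => ae_all_iff.2 fun j => ?_
    by_cases hij : i = j
    · simp [hij]
    have hm : MeasurableSet {s : ℕ → ℝ × ℕ | (s i).1 = (s j).1} :=
      measurableSet_eq_fun (measurable_fst.comp (measurable_pi_apply i))
        (measurable_fst.comp (measurable_pi_apply j))
    have h0 : Measure.infinitePi (fun _ : ℕ => uniform01.prod marks.toMeasure)
        {s | (s i).1 = (s j).1} = 0 := by
      -- Given the position of sample `j`, the resampled position `i` hits it with probability zero,
      -- as the uniform law has no atoms.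
      rw [← lintegral_indicator_one hm, lintegral_infinitePi_update _ i (measurable_one.indicator hm)]
      refine lintegral_eq_zero_of_ae_eq_zero (Eventually.of_forall fun s => ?_)
      have e : ∀ e : ℝ × ℕ, ({s : ℕ → ℝ × ℕ | (s i).1 = (s j).1}.indicator 1
          (Function.update s i e) : ℝ≥0∞) = (({(s j).1} : Set ℝ) ×ˢ Set.univ).indicator 1 e := by
        intro e
        simp [Set.indicator_apply, Function.update_of_ne (Ne.symm hij)]
      simp_rw [e]
      rw [lintegral_indicator_one ((measurableSet_singleton _).prod .univ), Measure.prod_prod]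
      simp [uniform01]
    filter_upwards [measure_eq_zero_iff_ae_notMem.1 h0] with s hs _
    exact hs
  refine ae_all_iff.2 fun k => ?_
  have hcell : ∀ᵐ p ∂(poissonMeasure r).prod
      (Measure.infinitePi fun _ : ℕ => uniform01.prod marks.toMeasure),
      (∀ i, (p.2 i).1 ∈ Set.Ico (0 : ℝ) 1) ∧ ∀ i j, i ≠ j → (p.2 i).1 ≠ (p.2 j).1 :=
    Measure.quasiMeasurePreserving_snd.ae (hs1.and hs2)
  exact (measurePreserving_eval_infinitePi (fun _ : ℤ => (poissonMeasure r).prod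
    (Measure.infinitePi fun _ : ℕ => uniform01.prod marks.toMeasure)) k).quasiMeasurePreserving.ae hcell

theorem tsum_lintegral_uniform01 {g : ℝ → ℝ≥0∞} (hg : Measurable g) :
    ∑' k : ℤ, ∫⁻ x, g (k + x) ∂uniform01 = ∫⁻ y, g y := by
  have h : ∀ k : ℤ, ∫⁻ x, g (k + x) ∂uniform01 = ∫⁻ y in Set.Ico (k : ℝ) (k + 1), g y := by
    intro k
    rw [uniform01, ← (measurePreserving_add_left volume (k : ℝ)).setLIntegral_comp_preimage
      measurableSet_Ico hg]
    simp
  simp_rw [h]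
  rw [← lintegral_iUnion (fun k => measurableSet_Ico) (Set.pairwise_disjoint_Ico_intCast ℝ),
    iUnion_Ico_intCast, setLIntegral_univ]

theorem lintegral_marked_point {f : ℝ → ℕ → ℝ≥0∞} (hf : ∀ j, Measurable fun x => f x j) :
    ∫⁻ e, f e.1 e.2 ∂uniform01.prod marks.toMeasure = ∑' j, marks j * ∫⁻ x, f x j ∂uniform01 := by
  have hm : Measurable fun e : ℝ × ℕ => f e.1 e.2 := measurable_from_prod_countable_left hf
  rw [lintegral_prod_symm _ hm.aemeasurable, lintegral_countable']
  refine tsum_congr fun j => ?_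
  rw [PMF.toMeasure_apply_singleton _ _ (measurableSet_singleton j), mul_comm]

/-- The law of the points of one cell. -/
def cellLaw : Measure (ℕ × (ℕ → ℝ × ℕ)) :=
  (poissonMeasure r).prod (Measure.infinitePi fun _ : ℕ => uniform01.prod marks.toMeasure)

instance : IsProbabilityMeasure (cellLaw r marks) := by unfold cellLaw; infer_instance

theorem lintegral_poissonDataLaw_update (k : ℤ) {F : PoissonData → ℝ≥0∞} (hF : Measurable F) :
    ∫⁻ ω, F ω ∂poissonDataLaw r marks =
      ∫⁻ ω, (∫⁻ p, F (Function.update ω k p) ∂cellLaw r marks) ∂poissonDataLaw r marks :=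
  lintegral_infinitePi_update (fun _ : ℤ => cellLaw r marks) k hF

/-- Dividing by the multiplicity turns the sum over uncountably many locations into an integral
against the counting measure, whose kernel is measurable. -/
theorem measurable_tsum_of_zero {G : Conf → ℝ → ℝ≥0∞} (hG : Measurable (Function.uncurry G))
    (h0 : ∀ η y, η y = 0 → G η y = 0) : Measurable fun η => ∑' y, G η y := by
  have h : Measurable (Function.uncurry fun (η : Conf) y => G η y / (η y : ℝ≥0∞)) :=
    hG.div ((measurable_from_nat (f := fun n => (n : ℝ≥0∞))).comp
      (Conf.measurable_eval measurable_fst measurable_snd))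
  convert Conf.measurable_lintegral_pts measurable_id h using 2 with η
  rw [Conf.lintegral_pts]
  refine tsum_congr fun y => ?_
  by_cases hy : η y = 0
  · simp [hy, h0 η y hy]
  · exact (ENNReal.mul_div_cancel (by exact_mod_cast hy) (ENNReal.natCast_ne_top _)).symm

theorem measurable_cell_points {G : Conf → ℝ → ℝ≥0∞} (hG : Measurable (Function.uncurry G))
    (k : ℤ) : Measurable fun ω : PoissonData =>
      ∑ i ∈ Finset.range (ω k).1, G ω.toConf (k + ((ω k).2 i).1) := by
  refine measurable_sum_range (PoissonData.measurable_count k) fun i => ?_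
  have h : Measurable fun ω : PoissonData => (ω.toConf, (k : ℝ) + ((ω k).2 i).1) :=
    PoissonData.measurable_toConf.prodMk ((PoissonData.measurable_position k i).const_add _)
  exact hG.comp h

/-- Cell `k` is resampled with the others fixed, the formula for a Poisson number of samples is
applied to it, and the resampling is undone. -/
theorem lintegral_cell_points {G : Conf → ℝ → ℝ≥0∞} (hG : Measurable (Function.uncurry G)) (k : ℤ) :
    ∫⁻ ω, ∑ i ∈ Finset.range (ω k).1, G ω.toConf (k + ((ω k).2 i).1) ∂poissonDataLaw r marks =
      r * ∫⁻ ω, (∫⁻ e, G (ω.toConf.add (k + e.1) e.2) (k + e.1) ∂uniform01.prod marks.toMeasure)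
        ∂poissonDataLaw r marks := by
  have hm := measurable_cell_points hG k
  have hm2 : Measurable fun ω : PoissonData =>
      ∫⁻ e, G (ω.toConf.add (k + e.1) e.2) (k + e.1) ∂uniform01.prod marks.toMeasure := by
    refine Measurable.lintegral_prod_right' (f := fun x : PoissonData × (ℝ × ℕ) =>
      G (x.1.toConf.add (k + x.2.1) x.2.2) (k + x.2.1)) ?_
    have h1 : ∀ j : ℕ, Measurable fun x : PoissonData × ℝ =>
        G (x.1.toConf.add (k + x.2) j) (k + x.2) := by
      intro j
      have h : Measurable fun x : PoissonData × ℝ =>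
          (x.1.toConf.add (k + x.2) j, (k : ℝ) + x.2) :=
        (Conf.measurable_add (PoissonData.measurable_toConf.comp measurable_fst)
          (measurable_snd.const_add _) j).prodMk (measurable_snd.const_add _)
      exact hG.comp h
    have h2 : Measurable fun x : (PoissonData × ℝ) × ℕ =>
        G (x.1.1.toConf.add (k + x.1.2) x.2) (k + x.1.2) := measurable_from_prod_countable_left h1
    have h3 : Measurable fun x : PoissonData × (ℝ × ℕ) => ((x.1, x.2.1), x.2.2) :=
      (measurable_fst.prodMk (measurable_fst.comp measurable_snd)).prodMk
        (measurable_snd.comp measurable_snd)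
    have h4 := h2.comp h3
    simpa only [Function.comp_def] using h4
  rw [lintegral_poissonDataLaw_update r marks k hm, lintegral_poissonDataLaw_update r marks k hm2,
    ← lintegral_const_mul' _ _ ENNReal.coe_ne_top]
  refine lintegral_congr fun ω => ?_
  simp only [Function.update_self]
  have hF : Measurable (Function.uncurry fun (e : ℝ × ℕ) (p : ℕ × (ℕ → ℝ × ℕ)) =>
      G (PoissonData.toConf (Function.update ω k p)) (k + e.1)) := by
    have h : Measurable fun x : (ℝ × ℕ) × (ℕ × (ℕ → ℝ × ℕ)) =>
        (PoissonData.toConf (Function.update ω k x.2), (k : ℝ) + x.1.1) :=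
      (PoissonData.measurable_toConf.comp ((measurable_update ω).comp measurable_snd)).prodMk
        ((measurable_fst.comp measurable_fst).const_add _)
    exact hG.comp h
  refine (lintegral_sum_poisson_samples (uniform01.prod marks.toMeasure) r hF
    fun e n s i hi => by rw [PoissonData.toConf_swap ω k n s hi]).trans ?_
  congr 1
  refine lintegral_congr fun p => lintegral_congr_ae ?_
  filter_upwards [ae_position_mem marks] with e he
  rw [PoissonData.toConf_insert ω k p he]

/-- The Mecke formula for the locations of a marked Poisson process. -/
theorem lintegral_tsum_markedPoisson {G : Conf → ℝ → ℝ≥0∞} (hG : Measurable (Function.uncurry G))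
    (h0 : ∀ η y, η y = 0 → G η y = 0) :
    ∫⁻ η, ∑' y, G η y ∂markedPoisson r marks =
      r * ∑' j, marks j * ∫⁻ η, (∫⁻ y, G (η.add y j) y) ∂markedPoisson r marks := by
  have hj : ∀ j : ℕ, Measurable (Function.uncurry fun (η : Conf) (y : ℝ) => G (η.add y j) y) := by
    intro j
    have h : Measurable fun x : Conf × ℝ => (x.1.add x.2 j, x.2) :=
      (Conf.measurable_add measurable_fst measurable_snd j).prodMk measurable_snd
    exact hG.comp h
  have hjx : ∀ (η : Conf) (j : ℕ), Measurable fun y => G (η.add y j) y := fun η j =>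
    (hj j).comp measurable_prodMk_left
  have hjl : ∀ j : ℕ, Measurable fun η : Conf => ∫⁻ y, G (η.add y j) y := fun j =>
    (hj j).lintegral_prod_right'
  have hjk : ∀ (j : ℕ) (k : ℤ), Measurable fun ω : PoissonData =>
      ∫⁻ x, G (ω.toConf.add (k + x) j) (k + x) ∂uniform01 := by
    intro j k
    have h : Measurable fun x : PoissonData × ℝ => (x.1.toConf, (k : ℝ) + x.2) :=
      (PoissonData.measurable_toConf.comp measurable_fst).prodMk (measurable_snd.const_add _)
    exact ((hj j).comp h).lintegral_prod_right'
  rw [markedPoisson, lintegral_map (measurable_tsum_of_zero hG h0) PoissonData.measurable_toConf]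
  have e1 : ∫⁻ ω, ∑' y, G (PoissonData.toConf ω) y ∂poissonDataLaw r marks =
      ∫⁻ ω, ∑' k : ℤ, ∑ i ∈ Finset.range (ω k).1, G (PoissonData.toConf ω) (k + ((ω k).2 i).1)
        ∂poissonDataLaw r marks := by
    refine lintegral_congr_ae ?_
    filter_upwards [ae_isSimple r marks] with ω hω
    exact hω.tsum_eq (h0 _)
  rw [e1, lintegral_tsum fun k => (measurable_cell_points hG k).aemeasurable]
  simp_rw [lintegral_cell_points r marks hG]
  rw [ENNReal.tsum_mul_left]
  congr 1
  have e2 : ∀ k : ℤ, ∫⁻ ω, (∫⁻ e, G (ω.toConf.add (k + e.1) e.2) (k + e.1)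
      ∂uniform01.prod marks.toMeasure) ∂poissonDataLaw r marks =
      ∑' j, marks j * ∫⁻ ω, (∫⁻ x, G (ω.toConf.add (k + x) j) (k + x) ∂uniform01)
        ∂poissonDataLaw r marks := by
    intro k
    have h : ∀ ω : PoissonData, ∫⁻ e, G (ω.toConf.add (k + e.1) e.2) (k + e.1)
        ∂uniform01.prod marks.toMeasure =
        ∑' j, marks j * ∫⁻ x, G (ω.toConf.add (k + x) j) (k + x) ∂uniform01 := fun ω =>
      lintegral_marked_point marks (f := fun x j => G (ω.toConf.add (k + x) j) (k + x)) fun j =>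
        (hjx ω.toConf j).comp (measurable_id.const_add (k : ℝ))
    simp_rw [h]
    rw [lintegral_tsum fun j => ((hjk j k).const_mul _).aemeasurable]
    exact tsum_congr fun j => lintegral_const_mul _ (hjk j k)
  simp_rw [e2]
  rw [ENNReal.tsum_comm]
  refine tsum_congr fun j => ?_
  rw [ENNReal.tsum_mul_left, ← lintegral_tsum fun k => (hjk j k).aemeasurable,
    lintegral_map (hjl j) PoissonData.measurable_toConf]
  congr 1
  -- Uniform positions in all unit cells together make up Lebesgue measure on the line.
  exact lintegral_congr fun ω => tsum_lintegral_uniform01 (hjx ω.toConf j)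

end marked

/-! ### The stationary measures -/

/-- The occupied locations are countable, so a stack inserted at a Lebesgue-typical point meets no
other particle there. -/
theorem Conf.ae_eq_zero (η : Conf) : ∀ᵐ y, η y = 0 := by
  have hc : (Function.support η.1).Countable := by
    have : Function.support η.1 = ⋃ n : ℕ, Function.support η.1 ∩ Set.Icc (-(n : ℝ)) n := by
      rw [← Set.inter_iUnion, Set.iUnion_eq_univ_iff.2 fun x => ?_, Set.inter_univ]
      obtain ⟨n, hn⟩ := exists_nat_ge |x|
      exact ⟨n, abs_le.1 hn⟩
    rw [this]
    exact Set.countable_iUnion fun n => (η.2 _ _).countable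
  filter_upwards [hc.ae_notMem volume] with y hy
  simpa using hy

/-! ### Balance and density for `m_{c,λ}` -/

section stationaryMeasure

variable {q lam c : ℝ} (hq0 : 0 < q) (hq1 : q < 1) (hlam : 0 < lam)

theorem stationaryMeasure_zero : stationaryMeasure q lam 0 = Measure.dirac Conf.empty :=
  dif_neg fun h => lt_irrefl _ h.2.1

instance : IsProbabilityMeasure (stationaryMeasure q lam c) := by
  unfold stationaryMeasure; split_ifs <;> infer_instance

include hq0 hq1 in
theorem summable_phi_one (hc0 : 0 ≤ c) (hc1 : c < 1) :
    Summable fun k : ℕ => ((k + 1 : ℕ) : ℝ) ^ 1 * c ^ (k + 1) / (1 - q ^ (k + 1)) := by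
  have hs : Summable fun k : ℕ => (k : ℝ) ^ 1 * c ^ k :=
    summable_pow_mul_geometric_of_norm_lt_one 1 (by rwa [Real.norm_of_nonneg hc0])
  have hg : Summable fun k : ℕ => ((k + 1 : ℕ) : ℝ) ^ 1 * c ^ (k + 1) / (1 - q) :=
    ((summable_nat_add_iff (f := fun k : ℕ => (k : ℝ) ^ 1 * c ^ k) 1).mpr hs).div_const _
  refine Summable.of_nonneg_of_le (fun k => ?_) (fun k => ?_) hg
  · have : q ^ (k + 1) ≤ 1 := pow_le_one₀ hq0.le hq1.le
    exact div_nonneg (by positivity) (by linarith)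
  · have : q ^ (k + 1) ≤ q := pow_le_of_le_one hq0.le hq1.le (by omega)
    exact div_le_div_of_nonneg_left (by positivity) (by linarith) (by linarith)

include hq0 hq1 hlam

/-- The Mecke formula for the stationary measures. -/
theorem lintegral_tsum_stationaryMeasure (hc0 : 0 < c) (hc1 : c < 1) {G : Conf → ℝ → ℝ≥0∞}
    (hG : Measurable (Function.uncurry G)) (h0 : ∀ η y, η y = 0 → G η y = 0) :
    ∫⁻ η, ∑' y, G η y ∂stationaryMeasure q lam c =
      ∑' j : ℕ, ENNReal.ofReal (lam * (c ^ (j + 1) / (1 - q ^ (j + 1)))) *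
        ∫⁻ η, (∫⁻ y, G (η.add y (j + 1)) y) ∂stationaryMeasure q lam c := by
  have hp := phi_zero_pos hq0 hq1 hc0 hc1
  have e : stationaryMeasure q lam c = markedPoisson (lam * phi q 0 c).toNNReal
      (markLaw q c hq0 hq1 hc0 hc1) := dif_pos ⟨⟨hq0, hq1⟩, hc0, hc1⟩
  have hm : ∀ j, markLaw q c hq0 hq1 hc0 hc1 j = ENNReal.ofReal (markProb q c j) := fun _ => rfl
  -- The mark `0` has probability zero, so the sum starts at one particle; the factor `phi q 0 c` of
  -- the intensity then cancels the normalization of the marks.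
  rw [e, lintegral_tsum_markedPoisson _ _ hG h0, tsum_eq_zero_add' ENNReal.summable,
    hm 0, markProb, if_pos rfl, ENNReal.ofReal_zero, zero_mul, zero_add, ← ENNReal.tsum_mul_left]
  refine tsum_congr fun j => ?_
  rw [← mul_assoc]
  congr 1
  change ENNReal.ofReal (lam * phi q 0 c) * _ = _
  rw [hm, ← ENNReal.ofReal_mul (mul_pos hlam hp).le, markProb, if_neg (Nat.succ_ne_zero j)]
  congr 1
  field_simp

/-- A stack of `j + 1` particles is released at rate `1 - q ^ (j + 1)`, exactly the denominator of
its mark weight. Purely geometric weights remain. -/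
theorem lintegral_dep_stationaryMeasure (hc0 : 0 < c) (hc1 : c < 1) {Ψ : Conf → ℝ → ℝ≥0∞}
    (hΨ : Measurable (Function.uncurry Ψ)) :
    ∫⁻ η, (∫⁻ y, Ψ η y ∂dep q η) ∂stationaryMeasure q lam c =
      ∑' j : ℕ, ENNReal.ofReal (lam * c ^ (j + 1)) *
        ∫⁻ η, (∫⁻ y, Ψ (η.add y (j + 1)) y) ∂stationaryMeasure q lam c := by
  have hw : Measurable fun n : ℕ => ENNReal.ofReal (1 - q ^ n) := measurable_from_nat
  have hG : Measurable (Function.uncurry fun (η : Conf) y => ENNReal.ofReal (1 - q ^ η y) * Ψ η y) :=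
    (hw.comp (Conf.measurable_eval measurable_fst measurable_snd)).mul hΨ
  simp_rw [lintegral_dep]
  rw [lintegral_tsum_stationaryMeasure hq0 hq1 hlam hc0 hc1 hG fun η y hy => by simp [hy]]
  refine tsum_congr fun j => ?_
  have hq : 0 < 1 - q ^ (j + 1) := sub_pos.2 (pow_lt_one₀ hq0.le hq1 (Nat.succ_ne_zero j))
  have e : ∀ η : Conf, ∫⁻ y, ENNReal.ofReal (1 - q ^ (η.add y (j + 1)) y) * Ψ (η.add y (j + 1)) y =
      ENNReal.ofReal (1 - q ^ (j + 1)) * ∫⁻ y, Ψ (η.add y (j + 1)) y := by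
    intro η
    rw [← lintegral_const_mul' _ _ ENNReal.ofReal_ne_top]
    refine lintegral_congr_ae ?_
    filter_upwards [η.ae_eq_zero] with y hy
    rw [Conf.add_apply, hy, if_pos rfl, zero_add]
  simp_rw [e]
  rw [lintegral_const_mul' _ _ ENNReal.ofReal_ne_top, ← mul_assoc,
    ← ENNReal.ofReal_mul (mul_nonneg hlam.le (div_nonneg (by positivity) hq.le))]
  congr 2
  field_simp

/-- In the geometric sum over stack sizes, the term of size one is `c` times the Lebesgue part of
`trap`. The larger sizes are `c` times the same sum with one particle added to each stack, which is
the atomic part. -/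
theorem isBalanced_stationaryMeasure (hc0 : 0 ≤ c) (hc1 : c < 1) :
    IsBalanced q lam c (stationaryMeasure q lam c) := by
  intro Ψ hΨ
  rcases hc0.eq_or_lt with rfl | hc0
  -- For `c = 0` the configuration is empty: there are no departures, and the factor `c` kills the
  -- right side.
  · have hm : Measurable fun η : Conf => ∫⁻ y, Ψ η y ∂dep q η :=
      measurable_lintegral_dep q measurable_id hΨ
    rw [stationaryMeasure_zero, lintegral_dirac' _ hm, lintegral_dep]
    simp [Conf.empty]
  have hadd : Measurable fun x : Conf × ℝ => (x.1.add x.2 1, x.2) :=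
    (Conf.measurable_add measurable_fst measurable_snd 1).prodMk measurable_snd
  have hΨ1 : Measurable (Function.uncurry fun (η : Conf) y => Ψ (η.add y 1) y) := hΨ.comp hadd
  have hadd2 : ∀ (η : Conf) (y : ℝ) (j : ℕ), (η.add y (j + 1)).add y 1 = η.add y (j + 1 + 1) := by
    classical
    intro η y j
    refine Conf.ext fun x => ?_
    simp only [Conf.add_apply]
    split_ifs <;> omega
  have hl : Measurable fun η : Conf => ENNReal.ofReal lam * ∫⁻ y, Ψ (η.add y 1) y :=
    hΨ1.lintegral_prod_right'.const_mul _
  simp_rw [lintegral_trap]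
  rw [lintegral_add_left hl,
    lintegral_const_mul' _ _ ENNReal.ofReal_ne_top,
    lintegral_dep_stationaryMeasure hq0 hq1 hlam hc0 hc1 hΨ,
    lintegral_dep_stationaryMeasure hq0 hq1 hlam hc0 hc1 hΨ1, tsum_eq_zero_add' ENNReal.summable,
    mul_add, ← ENNReal.tsum_mul_left]
  simp_rw [hadd2, ← mul_assoc, ← ENNReal.ofReal_mul hc0.le]
  congr 1
  · simp only [zero_add, pow_one, mul_comm lam]
  · refine tsum_congr fun j => ?_
    congr 2
    ring

/-- Stacks of size `j` have intensity `lam * c ^ j / (1 - q ^ j)`; weighting by `j` and summing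
gives `lam * phi q 1 c`. -/
theorem lintegral_pts_stationaryMeasure (hc0 : 0 ≤ c) (hc1 : c < 1) {B : Set ℝ}
    (hB : MeasurableSet B) : ∫⁻ η, η.pts B ∂stationaryMeasure q lam c =
      ENNReal.ofReal (lam * phi q 1 c) * volume B := by
  rcases hc0.eq_or_lt with rfl | hc0
  · have hm : Measurable fun η : Conf => η.pts B :=
      Conf.measurable_pts_section measurable_id (s := {p | p.2 ∈ B}) (measurable_snd hB)
    rw [stationaryMeasure_zero, lintegral_dirac' _ hm, Conf.pts_apply _ hB]
    simp [Conf.empty, phi]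
  have hG : Measurable (Function.uncurry fun (η : Conf) y => (η y : ℝ≥0∞) * B.indicator 1 y) :=
    ((measurable_from_nat (f := fun n => (n : ℝ≥0∞))).comp
      (Conf.measurable_eval measurable_fst measurable_snd)).mul
      ((measurable_one.indicator hB).comp measurable_snd)
  simp_rw [Conf.pts_apply _ hB]
  rw [lintegral_tsum_stationaryMeasure hq0 hq1 hlam hc0 hc1 hG fun η y hy => by simp [hy]]
  have e : ∀ (j : ℕ) (η : Conf), ∫⁻ y, ((η.add y (j + 1)) y : ℝ≥0∞) * B.indicator 1 y =
      ((j + 1 : ℕ) : ℝ≥0∞) * volume B := by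
    intro j η
    rw [← lintegral_indicator_one hB, ← lintegral_const_mul' _ _ (ENNReal.natCast_ne_top _)]
    refine lintegral_congr_ae ?_
    filter_upwards [η.ae_eq_zero] with y hy
    rw [Conf.add_apply, hy, if_pos rfl, zero_add]
  have hq : ∀ j : ℕ, 0 < 1 - q ^ (j + 1) := fun j =>
    sub_pos.2 (pow_lt_one₀ hq0.le hq1 (Nat.succ_ne_zero j))
  simp_rw [e, lintegral_const, measure_univ, mul_one, ← mul_assoc]
  rw [ENNReal.tsum_mul_right, phi, ← tsum_mul_left, ENNReal.ofReal_tsum_of_nonneg (fun j => ?_)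
    ((summable_phi_one hq0 hq1 hc0.le hc1).mul_left lam)]
  · congr 1
    refine tsum_congr fun j => ?_
    rw [← ENNReal.ofReal_natCast, ← ENNReal.ofReal_mul
      (mul_nonneg hlam.le (div_nonneg (by positivity) (hq j).le))]
    congr 1
    ring
  · exact mul_nonneg hlam.le (div_nonneg (by positivity) (hq j).le)

end stationaryMeasure

end

end ExpJump

/-! ### The proposition -/

theorem propositionB2 (q lam xi c : ℝ) (hq0 : 0 < q) (hq1 : q < 1) (hlam : 0 < lam) (hxi : 0 < xi)
    (hc0 : 0 ≤ c) (hc1 : c < 1) :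
    ExpJump.IsStationary q lam xi (ExpJump.stationaryMeasure q lam c) ∧
    (∀ u v : ℝ, u ≤ v →
      ∫⁻ η, ((ExpJump.Conf.num η (Set.Ioc u v) : ℕ) : ENNReal)
          ∂(ExpJump.stationaryMeasure q lam c) =
        ENNReal.ofReal (lam * ExpJump.phi q 1 c * (v - u))) ∧
    (∀ x : ℝ,
      ∫⁻ η, ExpJump.jumpRateOver q lam xi η x ∂(ExpJump.stationaryMeasure q lam c) =
        ENNReal.ofReal (xi * c)) := by
  have hμ := ExpJump.isBalanced_stationaryMeasure hq0 hq1 hlam hc0 hc1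
  refine ⟨hμ.isStationary hq0.le hq1.le hlam hxi.le hc0 fun a b => ?_, fun u v huv => ?_,
    hμ.lintegral_jumpRateOver hq0.le hq1.le hlam hxi.le⟩
  · rw [ExpJump.lintegral_pts_stationaryMeasure hq0 hq1 hlam hc0 hc1 measurableSet_Ioo,
      Real.volume_Ioo]
    exact ENNReal.mul_ne_top ENNReal.ofReal_ne_top ENNReal.ofReal_ne_top
  · simp_rw [← ExpJump.Conf.pts_Ioc]
    rw [ExpJump.lintegral_pts_stationaryMeasure hq0 hq1 hlam hc0 hc1 measurableSet_Ioc,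
      Real.volume_Ioc, ← ENNReal.ofReal_mul' (sub_nonneg.2 huv)]
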